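/- **Theorem 3.6.** Let $1<p<\infty$, let $\Omega\subset\mathbb R^n$ be a bounded domain (open and connected) of class $C^1$, let $\Gamma_D\subseteq\partial\Omega$ and $\Gamma_N:=\partial\Omega\setminus\overline{\Gamma_D}$. On $\mathbb R^{N\times n}$ use $\langle x,y\rangle=\mathrm{tr}(xy^T)$ and $|x|=\langle x,x\rangle^{1/2}$, and put $V(\xi):=(1+|\xi|^2)^{\frac{p-2}{4}}\xi$. For $\omega\subseteq\Omega$ open, $C^1(\overline\omega,\mathbb R^N)$ denotes the functions that are continuous on $\overline\omega$ and differentiable in $\omega$ with a gradient that extends continuously to $\overline\omega$, and $\mathrm{Var}(\omega,\mathbb R^N)$ denotes the closure in $W^{1,p}(\omega,\mathbb R^N)$ of $$\{\varphi\in C^1(\overline\omega,\mathbb R^N):\ \varphi(x)=0\ \text{ for all } x\in(\Gamma_D\cap\overline\omega)\cup(\partial\omega\cap\Omega)\}.$$ Let $F\colon\mathbb R^{N\times n}\to\mathbb R$, $u\in C^1(\overline\Omega,\mathbb R^N)$ and $c_2>0$ satisfy: * (H0) $F\in C^2(\mathbb R^{N\times n})$; * (H1) there is $c_1>0$ with $|F(z)|\le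 c_1(1+|z|^p)$ for all $z\in\mathbb R^{N\times n}$; * (H2) with $Q=(0,1)^n$, for every $z\in\mathbb R^{N\times n}$ and every $\varphi\in W^{1,\infty}_0(Q,\mathbb R^N)$, $$c_2\int_Q|V(\nabla\varphi)|^2\,dx\le\int_Q\bigl(F(z+\nabla\varphi)-F(z)\bigr)\,dx;$$ * (H2') for every $x_0\in\Gamma_N$, with $\mathrm n(x_0)$ the outer unit normal to $\partial\Omega$ at $x_0$ and $B^-:=\{y\in B(x_0,1):\langle y-x_0,\mathrm n(x_0)\rangle<0\}$, and for every $\varphi\in C^\infty(\overline{B^-},\mathbb R^N)$ with $\varphi=0$ on $\partial B(x_0,1)\cap\overline{B^-}$, $$c_2\int_{B^-}|V(\nabla\varphi)|^2\,dx\le\int_{B^-}\bigl(F(\nabla u(x_0)+\nabla\varphi)-F(\nabla u(x_0))\bigr)\,dx;$$ * $u$ is an $F$-extremal: $\int_\Omega\langle F'(\nabla u),\nabla\varphi\rangle\,dx=0$ for every $\varphi\in\mathrm{Var}(\Omega,\mathbb R^N)$. Then there exists $\overline R>0$ such that, for every $x_0\in\overline\Omega$, with $\Omega(x_0,\overline R):=\Omega\cap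 B(x_0,\overline R)$, and every $\varphi\in\mathrm{Var}(\Omega(x_0,\overline R),\mathbb R^N)$, $$\frac{c_2}{2}\int_{\Omega(x_0,\overline R)}|V(\nabla\varphi)|^2\,dx\le\int_{\Omega(x_0,\overline R)}\bigl(F(\nabla u+\nabla\varphi)-F(\nabla u)\bigr)\,dx.$$ -/

import Mathlib

open scoped ContDiff

noncomputable section

namespace Zhang

/-- `ℝⁿ` with its Euclidean norm and inner product. -/
abbrev Vec (n : ℕ) : Type := EuclideanSpace ℝ (Fin n)

/-- `ℝ^{N×n}` with `⟨x, y⟩ = tr (x yᵀ)` and `|x| = ⟨x, x⟩^{1/2}`; the entry in row `i` and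
column `j` of `z` is `z (i, j)`. -/
abbrev Mat (N n : ℕ) : Type := EuclideanSpace ℝ (Fin N × Fin n)

/-- The matrix of a linear map `ℝⁿ → ℝᴺ` in the canonical bases. -/
def toMat {N n : ℕ} (L : Vec n →L[ℝ] Vec N) : Mat N n :=
  WithLp.toLp 2 fun ij => L (EuclideanSpace.single ij.2 1) ij.1

/-- The classical gradient (Jacobian matrix) of `φ` at `x`. -/
def grad {N n : ℕ} (φ : Vec n → Vec N) (x : Vec n) : Mat N n :=
  toMat (fderiv ℝ φ x)

/-- `V_β(ξ) = (1 + |ξ|²)^{(β-1)/2} ξ`. -/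
def Vaux {N n : ℕ} (β : ℝ) (ξ : Mat N n) : Mat N n :=
  (1 + ‖ξ‖ ^ 2) ^ ((β - 1) / 2) • ξ

/-- `V = V_{p/2}`. -/
def V {N n : ℕ} (p : ℝ) (ξ : Mat N n) : Mat N n :=
  Vaux (p / 2) ξ

/-! ### Function spaces -/

/-- `φ ∈ C¹(Ū, ℝᴺ)` with gradient `Dφ`, for an open set `U`: `φ` is continuous on `Ū`,
differentiable in `U`, and its gradient in `U` extends to the continuous function `Dφ` on `Ū`. -/
structure IsC1Closure {N n : ℕ} (U : Set (Vec n)) (φ : Vec n → Vec N)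
    (Dφ : Vec n → Mat N n) : Prop where
  continuousOn : ContinuousOn φ (closure U)
  differentiableAt : ∀ x ∈ U, DifferentiableAt ℝ φ x
  grad_eq : ∀ x ∈ U, grad φ x = Dφ x
  continuousOn_grad : ContinuousOn Dφ (closure U)

/-- `η ∈ C_c^∞(U, E)`. -/
structure IsTestFunction {n : ℕ} {E : Type*} [NormedAddCommGroup E] [NormedSpace ℝ E]
    (U : Set (Vec n)) (η : Vec n → E) : Prop where
  contDiff : ContDiff ℝ ∞ η
  hasCompactSupport : HasCompactSupport η
  tsupport_subset : tsupport η ⊆ U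

/-- `φ ∈ W^{1,q}(U, ℝᴺ)` with weak gradient `Dφ`. -/
structure IsSobolev {N n : ℕ} (U : Set (Vec n)) (q : ENNReal) (φ : Vec n → Vec N)
    (Dφ : Vec n → Mat N n) : Prop where
  memLp : MeasureTheory.MemLp φ q (MeasureTheory.volume.restrict U)
  memLp_grad : MeasureTheory.MemLp Dφ q (MeasureTheory.volume.restrict U)
  weak_grad : ∀ η : Vec n → ℝ, IsTestFunction U η → ∀ (i : Fin N) (j : Fin n),
    ∫ x in U, φ x i * fderiv ℝ η x (EuclideanSpace.single j 1) = -∫ x in U, Dφ x (i, j) * η x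

/-- The `W^{1,q}(U)`-distance of two functions with gradients `Dφ` and `Dψ`. -/
def sobolevDist {N n : ℕ} (U : Set (Vec n)) (q : ENNReal) (φ : Vec n → Vec N)
    (Dφ : Vec n → Mat N n) (ψ : Vec n → Vec N) (Dψ : Vec n → Mat N n) : ENNReal :=
  MeasureTheory.eLpNorm (φ - ψ) q (MeasureTheory.volume.restrict U) +
    MeasureTheory.eLpNorm (Dφ - Dψ) q (MeasureTheory.volume.restrict U)

/-- `φ ∈ W_0^{1,∞}(U, ℝᴺ) = W^{1,∞}(U, ℝᴺ) ∩ W_0^{1,1}(U, ℝᴺ)` with weak gradient `Dφ`, where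
`W_0^{1,1}` is the closure of `C_c^∞` in `W^{1,1}`. -/
structure IsSobolevZeroInfty {N n : ℕ} (U : Set (Vec n)) (φ : Vec n → Vec N)
    (Dφ : Vec n → Mat N n) : Prop where
  isSobolev : IsSobolev U ⊤ φ Dφ
  approx : ∀ ε : ENNReal, 0 < ε → ∃ ψ : Vec n → Vec N,
    IsTestFunction U ψ ∧ sobolevDist U 1 φ Dφ ψ (grad ψ) < ε

/-- `φ ∈ Var(U, ℝᴺ)` with weak gradient `Dφ`: the closure in `W^{1,p}(U, ℝᴺ)` of the functions in
`C¹(Ū, ℝᴺ)` that vanish on `(Γ_D ∩ Ū) ∪ (∂U ∩ Ω)`. -/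
structure IsVariation {N n : ℕ} (Ω ΓD : Set (Vec n)) (p : ℝ) (U : Set (Vec n))
    (φ : Vec n → Vec N) (Dφ : Vec n → Mat N n) : Prop where
  isSobolev : IsSobolev U (ENNReal.ofReal p) φ Dφ
  approx : ∀ ε : ENNReal, 0 < ε → ∃ (ψ : Vec n → Vec N) (Dψ : Vec n → Mat N n),
    IsC1Closure U ψ Dψ ∧ (∀ x ∈ (ΓD ∩ closure U) ∪ (frontier U ∩ Ω), ψ x = 0) ∧
      sobolevDist U (ENNReal.ofReal p) φ Dφ ψ Dψ < ε

/-! ### The domain -/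

/-- Near `x₀`, in the ball of radius `r`, the set `Ω` is the part below the graph of the `C¹`
function `g`, where "up" is the unit vector `e` and `g` is a function of the component
orthogonal to `e` only. -/
structure IsC1Graph {n : ℕ} (Ω : Set (Vec n)) (x₀ : Vec n) (r : ℝ) (e : Vec n)
    (g : Vec n → ℝ) : Prop where
  radius_pos : 0 < r
  norm_eq_one : ‖e‖ = 1
  contDiff : ContDiff ℝ 1 g
  invariant : ∀ (x : Vec n) (t : ℝ), g (x + t • e) = g x
  mem_iff : ∀ x ∈ Metric.ball x₀ r, x ∈ Ω ↔ inner ℝ e x < g x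

/-- `Ω` is a bounded domain (open and connected) of class `C¹`. -/
structure IsBoundedC1Domain {n : ℕ} (Ω : Set (Vec n)) : Prop where
  isOpen : IsOpen Ω
  isConnected : IsConnected Ω
  isBounded : Bornology.IsBounded Ω
  isC1 : ∀ x₀ ∈ frontier Ω, ∃ (r : ℝ) (e : Vec n) (g : Vec n → ℝ), IsC1Graph Ω x₀ r e g

/-- `ν` is the outer unit normal to `∂Ω` at `x₀ ∈ ∂Ω`: the normalization of `e - ∇g(x₀)` when
`Ω` is, near `x₀`, the part below the graph of `g` in direction `e`. -/
def IsOuterUnitNormal {n : ℕ} (Ω : Set (Vec n)) (x₀ ν : Vec n) : Prop :=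
  ∃ (r : ℝ) (e : Vec n) (g : Vec n → ℝ), IsC1Graph Ω x₀ r e g ∧
    ν = ‖e - gradient g x₀‖⁻¹ • (e - gradient g x₀)

/-- The free part `Γ_N = ∂Ω ∖ closure Γ_D` of the boundary. -/
def freeBoundary {n : ℕ} (Ω ΓD : Set (Vec n)) : Set (Vec n) :=
  frontier Ω \ closure ΓD

/-- `B⁻_ν`: the half of the unit ball at `x₀` where `⟨y - x₀, ν⟩ < 0`. -/
def halfBall {n : ℕ} (x₀ ν : Vec n) : Set (Vec n) :=
  {y ∈ Metric.ball x₀ 1 | inner ℝ (y - x₀) ν < 0}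

/-- The open unit cube `Q = (0,1)ⁿ`. -/
def unitCube (n : ℕ) : Set (Vec n) :=
  {x | ∀ i, x i ∈ Set.Ioo (0 : ℝ) 1}

/-! ### The hypotheses on the integrand -/

/-- `p`-growth: `|F(z)| ≤ c₁ (1 + |z|^p)`. -/
def HasPGrowth {N n : ℕ} (p : ℝ) (F : Mat N n → ℝ) : Prop :=
  ∃ c₁ : ℝ, 0 < c₁ ∧ ∀ z : Mat N n, |F z| ≤ c₁ * (1 + ‖z‖ ^ p)

/-- Strong `p`-quasiconvexity with constant `c₂`. -/
def IsStronglyQuasiconvex {N n : ℕ} (p c₂ : ℝ) (F : Mat N n → ℝ) : Prop :=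
  ∀ (z : Mat N n) (φ : Vec n → Vec N) (Dφ : Vec n → Mat N n),
    IsSobolevZeroInfty (unitCube n) φ Dφ →
      c₂ * ∫ x in unitCube n, ‖V p (Dφ x)‖ ^ 2 ≤ ∫ x in unitCube n, (F (z + Dφ x) - F z)

/-- Strong quasiconvexity on the free boundary with constant `c₂`, at the gradient `Du` of a
function in `C¹(Ω̄, ℝᴺ)`. -/
def IsStronglyQuasiconvexAtFreeBoundary {N n : ℕ} (p c₂ : ℝ) (F : Mat N n → ℝ)
    (Ω ΓD : Set (Vec n)) (Du : Vec n → Mat N n) : Prop :=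
  ∀ x₀ ∈ freeBoundary Ω ΓD, ∀ ν : Vec n, IsOuterUnitNormal Ω x₀ ν →
    ∀ φ : Vec n → Vec N, ContDiffOn ℝ ∞ φ (closure (halfBall x₀ ν)) →
      (∀ x ∈ Metric.sphere x₀ 1 ∩ closure (halfBall x₀ ν), φ x = 0) →
        c₂ * ∫ x in halfBall x₀ ν, ‖V p (grad φ x)‖ ^ 2 ≤
          ∫ x in halfBall x₀ ν, (F (Du x₀ + grad φ x) - F (Du x₀))

/-- `u ∈ W^{1,p}(Ω, ℝᴺ)`, with weak gradient `Du`, is an `F`-extremal. -/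
structure IsExtremal {N n : ℕ} (p : ℝ) (F : Mat N n → ℝ) (Ω ΓD : Set (Vec n))
    (u : Vec n → Vec N) (Du : Vec n → Mat N n) : Prop where
  isSobolev : IsSobolev Ω (ENNReal.ofReal p) u Du
  euler_lagrange : ∀ (φ : Vec n → Vec N) (Dφ : Vec n → Mat N n), IsVariation Ω ΓD p Ω φ Dφ →
    ∫ x in Ω, inner ℝ (gradient F (Du x)) (Dφ x) = 0

end Zhang

end

/-!
Oscillating test functions show that the quasiconvex integrand `F` is convex along rank-one
directions, so its derivative grows at most like `(1 + |z|)^{p-1}`. The quasiconvexity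
inequalities, holding for all multiples `tφ`, force `∫ DF(z) ∇φ = 0`, so they bound from below
the integral of the excess `F(z + ξ) - F(z) - DF(z) ξ` at `ξ = ∇φ`. The excess varies by at most
`ε |V(ξ)|²` when `z` moves a little, so on a small ball `∇u` may be frozen at one point.

Let `U` lie in such a ball. If `closure U` misses the free boundary, a variation on `U` extends by
zero and quasiconvexity rescaled to a ball applies, at any base point. If `closure U` meets the
free boundary at `x₁`, freeze at `x₁` and straighten `∂Ω` by a volume-preserving shear; its
derivative is close to the identity because `∂Ω` is `C¹`, so the shear costs another
`ε |V(ξ)|²`, and the half-ball condition at `x₁` applies.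

The linear term `∫ DF(∇u) ∇φ` vanishes by the Euler–Lagrange equation once `φ` is extended by zero
to `Ω`. For this extension to be `C¹` up to the boundary, the values of `φ` are first truncated
near `0`; letting the truncation level tend to `0`, and then using density, gives all variations.
-/

noncomputable section

namespace Zhang

open MeasureTheory Filter Topology Metric Set

/-! ### The excess and the function `V` -/

section Growth

variable {E : Type*} [NormedAddCommGroup E] [NormedSpace ℝ E] {F : E → ℝ} {p C : ℝ}

/-- The derivative has growth of order `p - 1` with constant `C`: `|DF(z)| ≤ C (1 + |z|)^{p-1}`. -/
def HasGradGrowth (p C : ℝ) (F : E → ℝ) : Prop :=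
  ∀ z, ‖fderiv ℝ F z‖ ≤ C * (1 + ‖z‖) ^ (p - 1)

lemma HasGradGrowth.nonneg (h : HasGradGrowth p C F) : 0 ≤ C := by
  simpa using (norm_nonneg _).trans (h 0)

lemma HasGradGrowth.abs_sub_le (hp : 1 ≤ p) (h : HasGradGrowth p C F)
    (hF : Differentiable ℝ F) (x y : E) :
    |F x - F y| ≤ C * (1 + ‖x‖ + ‖y‖) ^ (p - 1) * ‖x - y‖ := by
  have hC := h.nonneg
  refine (convex_segment y x).norm_image_sub_le_of_norm_fderiv_le (𝕜 := ℝ) (fun z _ => hF z)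
    (fun z hz => (h z).trans ?_) (left_mem_segment ℝ y x) (right_mem_segment ℝ y x)
  have hz' : ‖z‖ ≤ ‖x‖ + ‖y‖ :=
    (convexOn_univ_norm.le_max_of_mem_segment (mem_univ y) (mem_univ x) hz).trans
      (max_le (by linarith [norm_nonneg x]) (by linarith [norm_nonneg y]))
  gcongr ?_ * ?_ ^ ?_
  linarith

lemma HasGradGrowth.abs_sub_le_mul_rpow (hp : 1 ≤ p) (h : HasGradGrowth p C F)
    (hF : Differentiable ℝ F) {x y : E} {A s : ℝ} (hs : 1 ≤ s) (hx : ‖x‖ ≤ A * s)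
    (hy : ‖y‖ ≤ A * s) :
    |F x - F y| ≤ C * (1 + 2 * A) ^ (p - 1) * s ^ (p - 1) * ‖x - y‖ := by
  have hC := h.nonneg
  have hA : 0 ≤ A := nonneg_of_mul_nonneg_left ((norm_nonneg x).trans hx) (by linarith)
  calc |F x - F y| ≤ C * (1 + ‖x‖ + ‖y‖) ^ (p - 1) * ‖x - y‖ := h.abs_sub_le hp hF x y
    _ ≤ C * ((1 + 2 * A) * s) ^ (p - 1) * ‖x - y‖ := by gcongr; linarith
    _ = C * (1 + 2 * A) ^ (p - 1) * s ^ (p - 1) * ‖x - y‖ := by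
        rw [Real.mul_rpow (by positivity) (by positivity), ← mul_assoc C]

lemma HasGradGrowth.abs_sub_translate_le (hp : 1 ≤ p) (h : HasGradGrowth p C F)
    (hF : Differentiable ℝ F) {M : ℝ} {z : E} (hz : ‖z‖ ≤ M) (ξ η : E) :
    |F (z + ξ) - F z - (F (z + η) - F z)| ≤
      C * (1 + 2 * M) ^ (p - 1) * (1 + ‖ξ‖ + ‖η‖) ^ (p - 1) * ‖ξ - η‖ := by
  have hM : 0 ≤ M := (norm_nonneg z).trans hz
  have hsum : 1 + ‖z + ξ‖ + ‖z + η‖ ≤ (1 + 2 * M) * (1 + ‖ξ‖ + ‖η‖) := by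
    nlinarith [norm_add_le z ξ, norm_add_le z η, mul_nonneg hM (norm_nonneg ξ),
      mul_nonneg hM (norm_nonneg η)]
  have hC := h.nonneg
  calc |F (z + ξ) - F z - (F (z + η) - F z)| = |F (z + ξ) - F (z + η)| := by
        rw [sub_sub_sub_cancel_right]
    _ ≤ C * (1 + ‖z + ξ‖ + ‖z + η‖) ^ (p - 1) * ‖(z + ξ) - (z + η)‖ := h.abs_sub_le hp hF _ _
    _ ≤ C * ((1 + 2 * M) * (1 + ‖ξ‖ + ‖η‖)) ^ (p - 1) * ‖ξ - η‖ := by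
        rw [add_sub_add_left_eq_sub]
        gcongr
    _ = _ := by rw [Real.mul_rpow (by positivity) (by positivity), ← mul_assoc]

end Growth

section VSq

/-- `|V(ξ)|²` as a function of `s = |ξ|`. -/
def vSq (p s : ℝ) : ℝ := (1 + s ^ 2) ^ ((p - 2) / 2) * s ^ 2

lemma norm_V_sq {N n : ℕ} (p : ℝ) (ξ : Mat N n) : ‖V p ξ‖ ^ 2 = vSq p ‖ξ‖ := by
  have h : (0 : ℝ) ≤ 1 + ‖ξ‖ ^ 2 := by positivity
  rw [V, Vaux, norm_smul, mul_pow, vSq, Real.norm_of_nonneg (Real.rpow_nonneg h _),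
    ← Real.rpow_natCast, ← Real.rpow_mul h]
  congr 2
  push_cast
  ring

variable (p : ℝ)

lemma vSq_nonneg (s : ℝ) : 0 ≤ vSq p s := by
  unfold vSq; positivity

lemma vSq_zero : vSq p 0 = 0 := by simp [vSq]

lemma vSq_eq_sub (s : ℝ) :
    vSq p s = (1 + s ^ 2) ^ (p / 2) - (1 + s ^ 2) ^ ((p - 2) / 2) := by
  have h : (1 + s ^ 2) ^ (p / 2) = (1 + s ^ 2) ^ ((p - 2) / 2) * (1 + s ^ 2) := by
    conv_rhs => rw [← Real.rpow_add_one (by positivity)]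
    ring_nf
  rw [h, vSq]
  ring

lemma continuous_vSq : Continuous (vSq p) := by
  unfold vSq
  refine Continuous.mul (Continuous.rpow_const (by fun_prop) fun s => Or.inl ?_) (by fun_prop)
  positivity

lemma continuous_norm_V_sq (N n : ℕ) : Continuous fun ξ : Mat N n => ‖V p ξ‖ ^ 2 := by
  simp_rw [norm_V_sq]
  exact (continuous_vSq p).comp continuous_norm

lemma min_one_two_rpow_le {b q : ℝ} (h1 : 1 ≤ b) (h2 : b ≤ 2) : min 1 ((2 : ℝ) ^ q) ≤ b ^ q := by
  rcases le_total 0 q with hq | hq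
  · exact (min_le_left _ _).trans (Real.one_le_rpow h1 hq)
  · exact (min_le_right _ _).trans (Real.rpow_le_rpow_of_nonpos (by linarith) h2 hq)

lemma exists_pow_le_vSq : ∃ c : ℝ, 0 < c ∧
    (∀ s, 0 ≤ s → s ≤ 1 → c * s ^ 2 ≤ vSq p s) ∧ ∀ s, 1 ≤ s → c * s ^ p ≤ vSq p s := by
  refine ⟨min 1 ((2 : ℝ) ^ ((p - 2) / 2)), by positivity, fun s h0 h1 => ?_, fun s h1 => ?_⟩
  · exact mul_le_mul_of_nonneg_right (min_one_two_rpow_le (by nlinarith) (by nlinarith))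
      (sq_nonneg s)
  · have hs : 0 < s := by linarith
    have hfactor : 1 + s ^ 2 = (1 + (s ^ 2)⁻¹) * s ^ 2 := by field_simp; ring
    have hinv : (s ^ 2)⁻¹ ≤ 1 := inv_le_one_of_one_le₀ (by nlinarith)
    have hinv_nonneg : 0 ≤ (s ^ 2)⁻¹ := by positivity
    have hpow : s ^ p = (s ^ 2) ^ ((p - 2) / 2) * s ^ 2 := by
      rw [← Real.rpow_natCast s 2, ← Real.rpow_mul hs.le, ← Real.rpow_add hs]
      congr 1; push_cast; ring
    rw [vSq, hfactor, Real.mul_rpow (by positivity) (by positivity), hpow, mul_assoc]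
    exact mul_le_mul_of_nonneg_right (min_one_two_rpow_le (by linarith) (by linarith))
      (by positivity)

variable {p}

lemma vSq_le_vSq (hp : 0 ≤ p) {s t : ℝ} (hs : 0 ≤ s) (hst : s ≤ t) : vSq p s ≤ vSq p t := by
  have hsq : s ^ 2 ≤ t ^ 2 := pow_le_pow_left₀ hs hst 2
  rcases le_total 0 ((p - 2) / 2) with hq | hq
  · unfold vSq
    gcongr
  · have h1 : (1 + s ^ 2) ^ (p / 2) ≤ (1 + t ^ 2) ^ (p / 2) := by gcongr
    have h2 : (1 + t ^ 2) ^ ((p - 2) / 2) ≤ (1 + s ^ 2) ^ ((p - 2) / 2) :=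
      Real.rpow_le_rpow_of_nonpos (by positivity) (by linarith) hq
    rw [vSq_eq_sub, vSq_eq_sub]
    linarith

lemma rpow_abs_mul_rpow_le {l : ℝ} (hl : 0 < l) (hl1 : l ≤ 1) (p s : ℝ) :
    l ^ |p - 2| * (1 + s ^ 2) ^ ((p - 2) / 2) ≤ (1 + (l * s) ^ 2) ^ ((p - 2) / 2) := by
  rcases le_total 0 (p - 2) with hq | hq
  · have hl2 : l ^ (p - 2) = (l ^ 2) ^ ((p - 2) / 2) := by
      rw [← Real.rpow_natCast l 2, ← Real.rpow_mul hl.le]; congr 1; push_cast; ring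
    rw [abs_of_nonneg hq, hl2, ← Real.mul_rpow (by positivity) (by positivity)]
    exact Real.rpow_le_rpow (by positivity) (by nlinarith) (by linarith)
  · have hs : (l * s) ^ 2 ≤ s ^ 2 := by
      rw [mul_pow]
      exact mul_le_of_le_one_left (sq_nonneg s) (pow_le_one₀ hl.le hl1)
    calc l ^ |p - 2| * (1 + s ^ 2) ^ ((p - 2) / 2) ≤ 1 * (1 + s ^ 2) ^ ((p - 2) / 2) := by
          gcongr
          exact Real.rpow_le_one hl.le hl1 (abs_nonneg _)
      _ ≤ _ := by
          rw [one_mul]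
          exact Real.rpow_le_rpow_of_nonpos (by positivity) (by linarith) (by linarith)

lemma rpow_mul_vSq_le {l : ℝ} (hl : 0 < l) (hl1 : l ≤ 1) (p s : ℝ) :
    l ^ (|p - 2| + 2) * vSq p s ≤ vSq p (l * s) := by
  have hsplit : l ^ (|p - 2| + 2) = l ^ |p - 2| * l ^ 2 := by
    rw [Real.rpow_add hl, Real.rpow_two]
  calc l ^ (|p - 2| + 2) * vSq p s
      = (l ^ |p - 2| * (1 + s ^ 2) ^ ((p - 2) / 2)) * (l ^ 2 * s ^ 2) := by
        rw [hsplit, vSq]; ring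
    _ ≤ (1 + (l * s) ^ 2) ^ ((p - 2) / 2) * (l ^ 2 * s ^ 2) :=
        mul_le_mul_of_nonneg_right (rpow_abs_mul_rpow_le hl hl1 p s) (by positivity)
    _ = vSq p (l * s) := by rw [vSq, mul_pow]

lemma one_sub_mul_vSq_le (hp : 0 ≤ p) {d s t : ℝ} (hd : 0 ≤ d) (hd1 : d < 1)
    (hs : 0 ≤ s) (hst : (1 - d) * s ≤ t) :
    (1 - (|p - 2| + 2) * d) * vSq p s ≤ vSq p t := by
  have bernoulli := one_add_mul_self_le_rpow_one_add (s := -d) (by linarith)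
    (p := |p - 2| + 2) (by linarith [abs_nonneg (p - 2)])
  calc (1 - (|p - 2| + 2) * d) * vSq p s ≤ (1 - d) ^ (|p - 2| + 2) * vSq p s := by
        refine mul_le_mul_of_nonneg_right ?_ (vSq_nonneg _ _)
        rw [← sub_eq_add_neg] at bernoulli
        linarith
    _ ≤ vSq p ((1 - d) * s) := rpow_mul_vSq_le (by linarith) (by linarith) p s
    _ ≤ vSq p t := vSq_le_vSq hp (mul_nonneg (by linarith) hs) hst

lemma hasDerivAt_vSq (p r : ℝ) : HasDerivAt (vSq p)
    (2 * r * ((p - 2) / 2) * (1 + r ^ 2) ^ ((p - 2) / 2 - 1) * r ^ 2 +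
      (1 + r ^ 2) ^ ((p - 2) / 2) * (2 * r)) r := by
  have hsq : HasDerivAt (fun r : ℝ => r ^ 2) (2 * r) r := by simpa using hasDerivAt_pow 2 r
  exact ((hsq.const_add 1).rpow_const (Or.inl (by positivity))).mul hsq

lemma rpow_mul_abs_le (hp : 1 ≤ p) (r : ℝ) :
    (1 + r ^ 2) ^ ((p - 2) / 2) * |r| ≤ (1 + |r|) ^ (p - 1) := by
  have hpos : (0 : ℝ) < 1 + r ^ 2 := by positivity
  calc (1 + r ^ 2) ^ ((p - 2) / 2) * |r|
      ≤ (1 + r ^ 2) ^ ((p - 2) / 2) * (1 + r ^ 2) ^ ((1 : ℝ) / 2) := by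
        gcongr
        rw [← Real.sqrt_eq_rpow]
        exact Real.abs_le_sqrt (by linarith)
    _ = (1 + r ^ 2) ^ ((p - 1) / 2) := by rw [← Real.rpow_add hpos]; ring_nf
    _ ≤ ((1 + |r|) ^ 2) ^ ((p - 1) / 2) :=
        Real.rpow_le_rpow hpos.le (by nlinarith [sq_abs r, abs_nonneg r]) (by linarith)
    _ = (1 + |r|) ^ (p - 1) := by
        rw [← Real.rpow_natCast (1 + |r|) 2, ← Real.rpow_mul (by positivity)]
        congr 1; push_cast; ring

lemma hasGradGrowth_vSq (hp : 1 ≤ p) : HasGradGrowth p (|p - 2| + 2) (vSq p) := by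
  intro r
  rw [← norm_deriv_eq_norm_fderiv, (hasDerivAt_vSq p r).deriv, Real.norm_eq_abs, Real.norm_eq_abs]
  set q := (p - 2) / 2 with hq
  have hpos : (0 : ℝ) < 1 + r ^ 2 := by positivity
  have hquot : (1 + r ^ 2) ^ (q - 1) * r ^ 2 ≤ (1 + r ^ 2) ^ q := by
    calc (1 + r ^ 2) ^ (q - 1) * r ^ 2 ≤ (1 + r ^ 2) ^ (q - 1) * (1 + r ^ 2) := by
          gcongr; linarith
      _ = (1 + r ^ 2) ^ q := by rw [← Real.rpow_add_one hpos.ne', sub_add_cancel]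
  calc |2 * r * q * (1 + r ^ 2) ^ (q - 1) * r ^ 2 + (1 + r ^ 2) ^ q * (2 * r)|
      ≤ |2 * r * q * (1 + r ^ 2) ^ (q - 1) * r ^ 2| + |(1 + r ^ 2) ^ q * (2 * r)| :=
        abs_add_le _ _
    _ = |p - 2| * |r| * ((1 + r ^ 2) ^ (q - 1) * r ^ 2) + 2 * ((1 + r ^ 2) ^ q * |r|) := by
        have habs : |q| = |p - 2| / 2 := by rw [hq, abs_div, abs_two]
        simp only [abs_mul, habs, abs_of_nonneg (Real.rpow_nonneg hpos.le _), abs_two,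
          abs_of_nonneg (sq_nonneg r)]
        ring
    _ ≤ |p - 2| * |r| * (1 + r ^ 2) ^ q + 2 * ((1 + r ^ 2) ^ q * |r|) := by gcongr
    _ = (|p - 2| + 2) * ((1 + r ^ 2) ^ q * |r|) := by ring
    _ ≤ (|p - 2| + 2) * (1 + |r|) ^ (p - 1) := by
        gcongr
        exact rpow_mul_abs_le hp r

lemma abs_norm_V_sq_sub_le {N n : ℕ} (hp : 1 ≤ p) (ξ η : Mat N n) :
    |‖V p ξ‖ ^ 2 - ‖V p η‖ ^ 2| ≤
      (|p - 2| + 2) * (1 + ‖ξ‖ + ‖η‖) ^ (p - 1) * ‖ξ - η‖ := by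
  rw [norm_V_sq, norm_V_sq]
  calc |vSq p ‖ξ‖ - vSq p ‖η‖|
      ≤ (|p - 2| + 2) * (1 + ‖‖ξ‖‖ + ‖‖η‖‖) ^ (p - 1) * ‖‖ξ‖ - ‖η‖‖ :=
        (hasGradGrowth_vSq hp).abs_sub_le hp
          (fun r => (hasDerivAt_vSq p r).differentiableAt) _ _
    _ ≤ _ := by
        rw [norm_norm, norm_norm]
        gcongr
        exact abs_norm_sub_norm_le ξ η

end VSq

section Excess

variable {E : Type*} [NormedAddCommGroup E] [NormedSpace ℝ E] {F : E → ℝ}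

/-- The excess `F(z + ξ) - F(z) - DF(z) ξ` of `F` over its first order expansion at `z`. -/
def excess (F : E → ℝ) (z ξ : E) : ℝ := F (z + ξ) - F z - fderiv ℝ F z ξ

lemma excess_zero (F : E → ℝ) (z : E) : excess F z 0 = 0 := by simp [excess]

lemma hasFDerivAt_excess (hF : Differentiable ℝ F) (z ξ : E) :
    HasFDerivAt (excess F z) (fderiv ℝ F (z + ξ) - fderiv ℝ F z) ξ :=
  (((hasFDerivAt_comp_add_left z).2 (hF (z + ξ)).hasFDerivAt).sub_const _).sub
    (fderiv ℝ F z).hasFDerivAt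

lemma continuous_excess (hF : ContDiff ℝ 1 F) :
    Continuous fun q : E × E => excess F q.1 q.2 := by
  have hF₀ := hF.continuous
  have hF₁ : Continuous (fderiv ℝ F) := hF.continuous_fderiv one_ne_zero
  unfold excess
  exact Continuous.sub (by fun_prop) ((hF₁.comp continuous_fst).clm_apply continuous_snd)

lemma continuous_excess_right (hF : Continuous F) (z : E) : Continuous (excess F z) := by
  unfold excess
  fun_prop

lemma abs_excess_sub_excess_le (hF : ContDiff ℝ 2 F) {z ξ η : E} {r a : ℝ}
    (ha : ∀ y ∈ closedBall z r, ‖fderiv ℝ (fderiv ℝ F) y‖ ≤ a) (hξ : ‖ξ‖ ≤ r) (hη : ‖η‖ ≤ r) :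
    |excess F z ξ - excess F z η| ≤ a * r * ‖ξ - η‖ := by
  have hr : 0 ≤ r := (norm_nonneg ξ).trans hξ
  have ha0 : 0 ≤ a := (norm_nonneg (fderiv ℝ (fderiv ℝ F) z)).trans (ha z (mem_closedBall_self hr))
  have hdF : Differentiable ℝ F := hF.differentiable two_ne_zero
  have hdF' : Differentiable ℝ (fderiv ℝ F) :=
    (hF.fderiv_right (m := 1) le_rfl).differentiable one_ne_zero
  refine (convex_closedBall (0 : E) r).norm_image_sub_le_of_norm_hasFDerivWithin_le
    (fun y _ => (hasFDerivAt_excess hdF z y).hasFDerivWithinAt) (fun y hy => ?_)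
    (mem_closedBall_zero_iff.2 hη) (mem_closedBall_zero_iff.2 hξ)
  have hy' : ‖y‖ ≤ r := mem_closedBall_zero_iff.1 hy
  have hmean := (convex_closedBall z r).norm_image_sub_le_of_norm_fderiv_le (𝕜 := ℝ)
    (fun y _ => hdF' y) ha (mem_closedBall_self hr) (y := z + y) (by simpa using hy')
  rw [add_sub_cancel_left] at hmean
  exact hmean.trans (by gcongr)

lemma abs_excess_sub_excess_base_le (hF : ContDiff ℝ 2 F) {z z' ξ : E} {a : ℝ}
    (ha : ∀ y ∈ closedBall (0 : E) ‖ξ‖,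
      ‖fderiv ℝ (fderiv ℝ F) (z + y) - fderiv ℝ (fderiv ℝ F) (z' + y)‖ ≤ a) :
    |excess F z ξ - excess F z' ξ| ≤ a * ‖ξ‖ ^ 2 := by
  have hdF : Differentiable ℝ F := hF.differentiable two_ne_zero
  have hdF' : Differentiable ℝ (fderiv ℝ F) :=
    (hF.fderiv_right (m := 1) le_rfl).differentiable one_ne_zero
  let G : E → ℝ := fun y => F (z + y) - F (z' + y)
  have hG : fderiv ℝ G = fun y => fderiv ℝ F (z + y) - fderiv ℝ F (z' + y) := funext fun y =>
    (((hasFDerivAt_comp_add_left z).2 (hdF (z + y)).hasFDerivAt).sub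
      ((hasFDerivAt_comp_add_left z').2 (hdF (z' + y)).hasFDerivAt)).fderiv
  have hG' (y : E) : fderiv ℝ (fderiv ℝ G) y =
      fderiv ℝ (fderiv ℝ F) (z + y) - fderiv ℝ (fderiv ℝ F) (z' + y) := by
    rw [hG]
    exact (((hasFDerivAt_comp_add_left z).2 (hdF' (z + y)).hasFDerivAt).sub
      ((hasFDerivAt_comp_add_left z').2 (hdF' (z' + y)).hasFDerivAt)).fderiv
  have hexcess : excess F z ξ - excess F z' ξ = excess G 0 ξ - excess G 0 0 := by
    simp only [excess, hG, G, zero_add, add_zero, map_zero, sub_apply]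
    ring
  have hG2 : ContDiff ℝ 2 G := by fun_prop
  rw [hexcess]
  refine (abs_excess_sub_excess_le hG2 (a := a) (r := ‖ξ‖) (fun y hy => ?_) le_rfl
    (by simp)).trans_eq (by rw [sub_zero]; ring)
  rw [hG']
  exact ha y hy

lemma exists_norm_fderiv_fderiv_le [ProperSpace E] (hF : ContDiff ℝ 2 F) (M : ℝ) :
    ∃ L : ℝ, 0 ≤ L ∧ ∀ z ∈ closedBall (0 : E) M, ‖fderiv ℝ (fderiv ℝ F) z‖ ≤ L := by
  have hF₂ : Continuous (fderiv ℝ (fderiv ℝ F)) :=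
    (hF.fderiv_right (m := 1) le_rfl).continuous_fderiv one_ne_zero
  obtain ⟨L, hL⟩ := (isCompact_closedBall (0 : E) M).exists_bound_of_continuousOn
    (f := fderiv ℝ (fderiv ℝ F)) hF₂.continuousOn
  exact ⟨max L 0, le_max_right _ _, fun z hz => (hL z hz).trans (le_max_left _ _)⟩

variable {p C M : ℝ}

lemma abs_excess_sub_excess_base_le_rpow (hp : 1 ≤ p) (hF : ContDiff ℝ 2 F)
    (hG : HasGradGrowth p C F) {L : ℝ} (hL0 : 0 ≤ L)
    (hL : ∀ y ∈ closedBall (0 : E) M, ‖fderiv ℝ (fderiv ℝ F) y‖ ≤ L) {z z' ξ : E}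
    (hz : ‖z‖ ≤ M) (hz' : ‖z'‖ ≤ M) (hξ : 1 ≤ ‖ξ‖) :
    |excess F z ξ - excess F z' ξ| ≤
      (2 * (C * (1 + 2 * (M + 1)) ^ (p - 1)) + L) * ‖z - z'‖ * ‖ξ‖ ^ p := by
  have hM : 0 ≤ M := (norm_nonneg z).trans hz
  have hC := hG.nonneg
  have hdF : Differentiable ℝ F := hF.differentiable two_ne_zero
  have hdF' : Differentiable ℝ (fderiv ℝ F) :=
    (hF.fderiv_right (m := 1) le_rfl).differentiable one_ne_zero
  have hpow : ‖ξ‖ ^ (p - 1) ≤ ‖ξ‖ ^ p := Real.rpow_le_rpow_of_exponent_le hξ (by linarith)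
  have hpow' : ‖ξ‖ ≤ ‖ξ‖ ^ p := Real.self_le_rpow_of_one_le hξ hp
  have hshift : |F (z + ξ) - F (z' + ξ)| ≤
      C * (1 + 2 * (M + 1)) ^ (p - 1) * ‖ξ‖ ^ (p - 1) * ‖z - z'‖ := by
    rw [← add_sub_add_right_eq_sub z z' ξ]
    exact hG.abs_sub_le_mul_rpow hp hdF hξ ((norm_add_le z ξ).trans (by nlinarith))
      ((norm_add_le z' ξ).trans (by nlinarith))
  have hbase : |F z - F z'| ≤ C * (1 + 2 * (M + 1)) ^ (p - 1) * ‖ξ‖ ^ (p - 1) * ‖z - z'‖ :=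
    hG.abs_sub_le_mul_rpow hp hdF hξ (by nlinarith) (by nlinarith)
  have hlinear : |fderiv ℝ F z ξ - fderiv ℝ F z' ξ| ≤ L * ‖z - z'‖ * ‖ξ‖ :=
    ((fderiv ℝ F z - fderiv ℝ F z').le_opNorm ξ).trans <| by
      gcongr
      exact (convex_closedBall (0 : E) M).norm_image_sub_le_of_norm_fderiv_le (𝕜 := ℝ)
        (fun y _ => hdF' y) hL (mem_closedBall_zero_iff.2 hz') (mem_closedBall_zero_iff.2 hz)
  calc |excess F z ξ - excess F z' ξ|
      = |(F (z + ξ) - F (z' + ξ)) - (F z - F z') - (fderiv ℝ F z ξ - fderiv ℝ F z' ξ)| := by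
        unfold excess; ring_nf
    _ ≤ |F (z + ξ) - F (z' + ξ)| + |F z - F z'| + |fderiv ℝ F z ξ - fderiv ℝ F z' ξ| :=
        (abs_sub _ _).trans (add_le_add_left (abs_sub _ _) _)
    _ ≤ C * (1 + 2 * (M + 1)) ^ (p - 1) * ‖ξ‖ ^ p * ‖z - z'‖ +
          C * (1 + 2 * (M + 1)) ^ (p - 1) * ‖ξ‖ ^ p * ‖z - z'‖ + L * ‖z - z'‖ * ‖ξ‖ ^ p := by
        gcongr
        · exact hshift.trans (by gcongr)
        · exact hbase.trans (by gcongr)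
        · exact hlinear.trans (by gcongr)
    _ = _ := by ring

lemma exists_abs_excess_sub_excess_base_le [ProperSpace E] (hp : 1 ≤ p) (hF : ContDiff ℝ 2 F)
    (hG : HasGradGrowth p C F) (M : ℝ) {ε : ℝ} (hε : 0 < ε) :
    ∃ δ : ℝ, 0 < δ ∧ ∀ z z' : E, ‖z‖ ≤ M → ‖z'‖ ≤ M → ‖z - z'‖ ≤ δ → ∀ ξ,
      |excess F z ξ - excess F z' ξ| ≤ ε * vSq p ‖ξ‖ := by
  obtain ⟨c, hc, hsmall, hlarge⟩ := exists_pow_le_vSq p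
  have hunif := (isCompact_closedBall (0 : E) (M + 1)).uniformContinuousOn_of_continuous
    ((hF.fderiv_right (m := 1) le_rfl).continuous_fderiv one_ne_zero).continuousOn
  rw [Metric.uniformContinuousOn_iff_le] at hunif
  obtain ⟨δ, hδ, hunif⟩ := hunif (ε * c) (by positivity)
  obtain ⟨L, hL0, hL⟩ := exists_norm_fderiv_fderiv_le hF M
  have hC := hG.nonneg
  set K := 2 * (C * (1 + 2 * (|M| + 1)) ^ (p - 1)) + L with hK
  have hK0 : 0 ≤ K := by positivity
  refine ⟨min δ (ε * c / (K + 1)), by positivity, fun z z' hz hz' hzz ξ => ?_⟩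
  rcases le_total ‖ξ‖ 1 with hξ | hξ
  · have hball {w y : E} (hw : ‖w‖ ≤ M) (hy : y ∈ closedBall (0 : E) ‖ξ‖) :
        w + y ∈ closedBall (0 : E) (M + 1) :=
      mem_closedBall_zero_iff.2 ((norm_add_le _ _).trans
        (add_le_add hw ((mem_closedBall_zero_iff.1 hy).trans hξ)))
    calc |excess F z ξ - excess F z' ξ| ≤ ε * c * ‖ξ‖ ^ 2 := by
          refine abs_excess_sub_excess_base_le hF fun y hy => ?_
          have hdist : dist (z + y) (z' + y) ≤ δ := by
            rw [dist_add_right, dist_eq_norm]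
            exact hzz.trans (min_le_left _ _)
          simpa only [dist_eq_norm] using hunif _ (hball hz hy) _ (hball hz' hy) hdist
      _ = ε * (c * ‖ξ‖ ^ 2) := by ring
      _ ≤ ε * vSq p ‖ξ‖ := by gcongr; exact hsmall _ (norm_nonneg ξ) hξ
  · have hM : |M| = M := abs_of_nonneg ((norm_nonneg z).trans hz)
    calc |excess F z ξ - excess F z' ξ| ≤ K * ‖z - z'‖ * ‖ξ‖ ^ p := by
          rw [hK, hM]
          exact abs_excess_sub_excess_base_le_rpow hp hF hG hL0 hL hz hz' hξ
      _ ≤ (K + 1) * (ε * c / (K + 1)) * ‖ξ‖ ^ p := by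
          gcongr
          · linarith
          · exact hzz.trans (min_le_right _ _)
      _ = ε * (c * ‖ξ‖ ^ p) := by field_simp
      _ ≤ ε * vSq p ‖ξ‖ := by gcongr; exact hlarge _ hξ

lemma abs_excess_sub_excess_le_rpow (hp : 1 ≤ p) (hF : Differentiable ℝ F)
    (hG : HasGradGrowth p C F) {z ξ η : E} {d : ℝ} (hd1 : d ≤ 1) (hz : ‖z‖ ≤ M) (hξ : 1 ≤ ‖ξ‖)
    (hη : ‖η - ξ‖ ≤ d * ‖ξ‖) :
    |excess F z η - excess F z ξ| ≤ 2 * (C * (1 + 2 * (M + 2)) ^ (p - 1)) * d * ‖ξ‖ ^ p := by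
  have hM : 0 ≤ M := (norm_nonneg z).trans hz
  have hC := hG.nonneg
  have hd : 0 ≤ d := nonneg_of_mul_nonneg_left ((norm_nonneg _).trans hη) (by linarith)
  have hη2 : ‖η‖ ≤ 2 * ‖ξ‖ := by
    have := norm_le_norm_add_norm_sub' η ξ
    nlinarith
  have hpow : ‖ξ‖ ^ (p - 1) * ‖ξ‖ = ‖ξ‖ ^ p := by
    rw [← Real.rpow_add_one (by positivity), sub_add_cancel]
  have hpow' : ‖ξ‖ ≤ ‖ξ‖ ^ p := Real.self_le_rpow_of_one_le hξ hp
  have hvalue : |F (z + η) - F (z + ξ)| ≤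
      C * (1 + 2 * (M + 2)) ^ (p - 1) * ‖ξ‖ ^ (p - 1) * ‖η - ξ‖ := by
    rw [← add_sub_add_left_eq_sub η ξ z]
    exact hG.abs_sub_le_mul_rpow hp hF hξ ((norm_add_le z η).trans (by nlinarith))
      ((norm_add_le z ξ).trans (by nlinarith))
  have hgrad : ‖fderiv ℝ F z‖ ≤ C * (1 + 2 * (M + 2)) ^ (p - 1) :=
    (hG z).trans (by gcongr; linarith)
  have hlinear : |fderiv ℝ F z η - fderiv ℝ F z ξ| ≤
      C * (1 + 2 * (M + 2)) ^ (p - 1) * ‖η - ξ‖ := by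
    rw [← map_sub]
    exact ((fderiv ℝ F z).le_opNorm _).trans (by gcongr)
  calc |excess F z η - excess F z ξ|
      = |(F (z + η) - F (z + ξ)) - (fderiv ℝ F z η - fderiv ℝ F z ξ)| := by
        unfold excess; ring_nf
    _ ≤ |F (z + η) - F (z + ξ)| + |fderiv ℝ F z η - fderiv ℝ F z ξ| := abs_sub _ _
    _ ≤ C * (1 + 2 * (M + 2)) ^ (p - 1) * ‖ξ‖ ^ (p - 1) * (d * ‖ξ‖) +
          C * (1 + 2 * (M + 2)) ^ (p - 1) * (d * ‖ξ‖ ^ p) := by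
        gcongr
        · exact hvalue.trans (by gcongr)
        · exact hlinear.trans (by gcongr; exact hη.trans (by gcongr))
    _ = _ := by rw [← hpow]; ring

lemma exists_abs_excess_sub_excess_le [ProperSpace E] (hp : 1 ≤ p) (hF : ContDiff ℝ 2 F)
    (hG : HasGradGrowth p C F) (M : ℝ) :
    ∃ K : ℝ, ∀ z : E, ‖z‖ ≤ M → ∀ (d : ℝ) (ξ η : E), 0 ≤ d → d ≤ 1 →
      ‖η - ξ‖ ≤ d * ‖ξ‖ → |excess F z η - excess F z ξ| ≤ K * d * vSq p ‖ξ‖ := by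
  obtain ⟨c, hc, hsmall, hlarge⟩ := exists_pow_le_vSq p
  obtain ⟨L, hL0, hL⟩ := exists_norm_fderiv_fderiv_le hF (M + 2)
  have hC := hG.nonneg
  set B := 2 * (C * (1 + 2 * (|M| + 2)) ^ (p - 1)) with hB
  have hB0 : 0 ≤ B := by positivity
  refine ⟨(2 * L + B) / c, fun z hz d ξ η hd hd1 hη => ?_⟩
  rcases le_total ‖ξ‖ 1 with hξ | hξ
  · have hη2 : ‖η‖ ≤ 2 * ‖ξ‖ := by
      have := norm_le_norm_add_norm_sub' η ξ
      nlinarith [norm_nonneg ξ]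
    calc |excess F z η - excess F z ξ| ≤ L * (2 * ‖ξ‖) * ‖η - ξ‖ :=
          abs_excess_sub_excess_le hF
            (fun y hy => hL y (closedBall_subset_closedBall' (by simp; linarith) hy)) hη2
            (by linarith [norm_nonneg ξ])
      _ ≤ L * (2 * ‖ξ‖) * (d * ‖ξ‖) := by gcongr
      _ = 2 * L * (d * ‖ξ‖ ^ 2) := by ring
      _ ≤ (2 * L + B) * (d * ‖ξ‖ ^ 2) := by gcongr; linarith
      _ = (2 * L + B) / c * d * (c * ‖ξ‖ ^ 2) := by field_simp
      _ ≤ (2 * L + B) / c * d * vSq p ‖ξ‖ := by gcongr; exact hsmall _ (norm_nonneg ξ) hξ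
  · have hM : |M| = M := abs_of_nonneg ((norm_nonneg z).trans hz)
    calc |excess F z η - excess F z ξ| ≤ B * d * ‖ξ‖ ^ p := by
          rw [hB, hM]
          exact abs_excess_sub_excess_le_rpow hp (hF.differentiable two_ne_zero) hG hd1 hz hξ hη
      _ ≤ (2 * L + B) * d * ‖ξ‖ ^ p := by gcongr; linarith
      _ = (2 * L + B) / c * d * (c * ‖ξ‖ ^ p) := by field_simp
      _ ≤ (2 * L + B) / c * d * vSq p ‖ξ‖ := by gcongr; exact hlarge _ hξ

end Excess

/-! ### Gradient fields and test functions -/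

section Matrices

variable {N n : ℕ}

/-- The identification `toMat` of linear maps with matrices, as an isomorphism. -/
def matEquiv (N n : ℕ) : (Vec n →L[ℝ] Vec N) ≃L[ℝ] Mat N n :=
  LinearEquiv.toContinuousLinearEquiv
    { toFun := toMat
      map_add' := fun L L' => by ext ij; simp [toMat]
      map_smul' := fun c L => by ext ij; simp [toMat]
      invFun := fun z => (Matrix.toLpLin 2 2 (.of fun i j => z (i, j))).toContinuousLinearMap
      left_inv := fun L => by
        refine ContinuousLinearMap.coe_injective
          ((EuclideanSpace.basisFun (Fin n) ℝ).toBasis.ext fun j => ?_)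
        ext i
        simp [toMat, Matrix.toLpLin_apply]
      right_inv := fun z => by ext ij; simp [toMat, Matrix.toLpLin_apply] }

lemma grad_eq_matEquiv (φ : Vec n → Vec N) (x : Vec n) :
    grad φ x = matEquiv N n (fderiv ℝ φ x) := rfl

lemma continuous_grad {φ : Vec n → Vec N} (hφ : ContDiff ℝ 1 φ) : Continuous (grad φ) :=
  (matEquiv N n).continuous.comp (hφ.continuous_fderiv one_ne_zero)

lemma hasCompactSupport_grad {φ : Vec n → Vec N} (hφ : HasCompactSupport φ) :
    HasCompactSupport (grad φ) :=
  (hφ.fderiv ℝ).comp_left (g := matEquiv N n) (map_zero _)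

lemma exists_norm_grad_le {φ : Vec n → Vec N} (hφ : ContDiff ℝ 1 φ) (hφc : HasCompactSupport φ) :
    ∃ M : ℝ, ∀ x, ‖grad φ x‖ ≤ M :=
  (hasCompactSupport_grad hφc).exists_bound_of_continuous (continuous_grad hφ)

lemma grad_const_smul (t : ℝ) (φ : Vec n → Vec N) (x : Vec n) :
    grad (t • φ) x = t • grad φ x := by
  rw [grad_eq_matEquiv, grad_eq_matEquiv, fderiv_const_smul_field, Pi.smul_apply, map_smul]

/-- The matrix product `ξ A`. -/
def mulRight (ξ : Mat N n) (A : Vec n →L[ℝ] Vec n) : Mat N n :=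
  matEquiv N n (((matEquiv N n).symm ξ).comp A)

lemma exists_norm_mulRight_sub_le (N n : ℕ) :
    ∃ C : ℝ, 0 < C ∧ ∀ (ξ : Mat N n) (A : Vec n →L[ℝ] Vec n),
      ‖mulRight ξ A - ξ‖ ≤ C * ‖A - ContinuousLinearMap.id ℝ _‖ * ‖ξ‖ := by
  set T : (Vec n →L[ℝ] Vec N) →L[ℝ] Mat N n := (matEquiv N n).toContinuousLinearMap
  set S : Mat N n →L[ℝ] (Vec n →L[ℝ] Vec N) := (matEquiv N n).symm.toContinuousLinearMap
  refine ⟨‖T‖ * ‖S‖ + 1, by positivity, fun ξ A => ?_⟩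
  set I := ContinuousLinearMap.id ℝ (Vec n)
  have hsub : mulRight ξ A - ξ = T ((S ξ).comp (A - I)) := by
    rw [ContinuousLinearMap.comp_sub, map_sub, ContinuousLinearMap.comp_id]
    exact congrArg (mulRight ξ A - ·) ((matEquiv N n).apply_symm_apply ξ).symm
  calc ‖mulRight ξ A - ξ‖ ≤ ‖T‖ * (‖S‖ * ‖ξ‖ * ‖A - I‖) := by
        rw [hsub]
        refine (T.le_opNorm _).trans ?_
        gcongr
        exact (ContinuousLinearMap.opNorm_comp_le _ _).trans (by gcongr; exact S.le_opNorm ξ)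
    _ = ‖T‖ * ‖S‖ * ‖A - I‖ * ‖ξ‖ := by ring
    _ ≤ (‖T‖ * ‖S‖ + 1) * ‖A - I‖ * ‖ξ‖ := by gcongr; linarith

end Matrices

section BoundedFields

variable {α E : Type*} [MeasurableSpace α] {μ : Measure α} [IsFiniteMeasure μ]
  [NormedAddCommGroup E] [ProperSpace E]

lemma integrable_continuous_comp {f : α → E} (hf : AEStronglyMeasurable f μ) {M : ℝ}
    (hM : ∀ᵐ x ∂μ, ‖f x‖ ≤ M) {H : E → ℝ} (hH : Continuous H) :
    Integrable (fun x => H (f x)) μ := by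
  obtain ⟨C, hC⟩ := (isCompact_closedBall (0 : E) M).exists_bound_of_continuousOn hH.continuousOn
  refine Integrable.of_bound (hH.comp_aestronglyMeasurable hf) C ?_
  filter_upwards [hM] with x hx
  exact hC _ (mem_closedBall_zero_iff.2 hx)

lemma tendsto_integral_continuous_comp {ι : Type*} {l : Filter ι} [l.IsCountablyGenerated]
    {f : ι → α → E} {g : α → E} (hf : ∀ᶠ k in l, AEStronglyMeasurable (f k) μ) {M : ℝ}
    (hM : ∀ᶠ k in l, ∀ᵐ x ∂μ, ‖f k x‖ ≤ M) (hg : ∀ᵐ x ∂μ, Tendsto (fun k => f k x) l (𝓝 (g x)))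
    {H : E → ℝ} (hH : Continuous H) :
    Tendsto (fun k => ∫ x, H (f k x) ∂μ) l (𝓝 (∫ x, H (g x) ∂μ)) := by
  obtain ⟨C, hC⟩ := (isCompact_closedBall (0 : E) M).exists_bound_of_continuousOn hH.continuousOn
  refine tendsto_integral_filter_of_dominated_convergence (fun _ => C) ?_ ?_
    (integrable_const C) ?_
  · filter_upwards [hf] with k hk using hH.comp_aestronglyMeasurable hk
  · filter_upwards [hM] with k hk
    filter_upwards [hk] with x hx
    exact hC _ (mem_closedBall_zero_iff.2 hx)
  · filter_upwards [hg] with x hx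
    exact (hH.tendsto _).comp hx

lemma hasDerivAt_integral_comp {H H' : ℝ → E → ℝ} (hd : ∀ t ξ, HasDerivAt (H · ξ) (H' t ξ) t)
    (hH : ∀ t, Continuous (H t)) (hH' : Continuous fun q : ℝ × E => H' q.1 q.2)
    {D : α → E} (hD : AEStronglyMeasurable D μ) {M : ℝ} (hM : ∀ᵐ x ∂μ, ‖D x‖ ≤ M) (t₀ : ℝ) :
    HasDerivAt (fun t => ∫ x, H t (D x) ∂μ) (∫ x, H' t₀ (D x) ∂μ) t₀ := by
  obtain ⟨C, hC⟩ := ((isCompact_Icc (a := t₀ - 1) (b := t₀ + 1)).prod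
    (isCompact_closedBall (0 : E) M)).exists_bound_of_continuousOn hH'.continuousOn
  have hs : Icc (t₀ - 1) (t₀ + 1) ∈ 𝓝 t₀ := Icc_mem_nhds (by linarith) (by linarith)
  refine (hasDerivAt_integral_of_dominated_loc_of_deriv_le (bound := fun _ => C)
    (F' := fun t x => H' t (D x)) hs
    (Eventually.of_forall fun t => (hH t).comp_aestronglyMeasurable hD)
    (integrable_continuous_comp hD hM (hH t₀)) ?_ ?_ (integrable_const C) ?_).2
  · exact (hH'.comp (by fun_prop : Continuous fun ξ : E => (t₀, ξ))).comp_aestronglyMeasurable hD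
  · filter_upwards [hM] with x hx t ht
    exact hC (t, D x) ⟨ht, mem_closedBall_zero_iff.2 hx⟩
  · exact Eventually.of_forall fun x t _ => hd t (D x)

end BoundedFields

lemma nonneg_of_hasDerivAt_of_isLocalMin {m m' : ℝ → ℝ} {m'' a : ℝ} (hmin : IsLocalMin m a)
    (hm : ∀ t, HasDerivAt m (m' t) t) (hm' : HasDerivAt m' m'' a) : 0 ≤ m'' := by
  have hderiv : deriv m = m' := funext fun t => (hm t).deriv
  have hdd : deriv (deriv m) a = m'' := by rw [hderiv, hm'.deriv]
  by_contra! hneg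
  have hmax : IsLocalMax m a := isLocalMax_of_deriv_deriv_neg (hdd ▸ hneg)
    hmin.deriv_eq_zero (hm a).continuousAt
  have hconst : m =ᶠ[𝓝 a] fun _ => m a := by
    filter_upwards [hmin, hmax] with t h₁ h₂ using le_antisymm h₂ h₁
  have hzero : m'' = 0 := by
    rw [← hdd, hconst.deriv.deriv_eq]
    simp
  exact hneg.ne hzero

section Line

variable {E : Type*} [NormedAddCommGroup E] [NormedSpace ℝ E] {F : E → ℝ}

lemma hasDerivAt_add_smul (z v : E) (t : ℝ) : HasDerivAt (fun t : ℝ => z + t • v) v t := by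
  simpa using ((hasDerivAt_id t).smul_const v).const_add z

lemma hasDerivAt_comp_add_smul (hF : Differentiable ℝ F) (z v : E) (t : ℝ) :
    HasDerivAt (fun t : ℝ => F (z + t • v)) (fderiv ℝ F (z + t • v) v) t :=
  (hF _).hasFDerivAt.comp_hasDerivAt t (hasDerivAt_add_smul z v t)

lemma hasDerivAt_fderiv_comp_add_smul (hF : Differentiable ℝ (fderiv ℝ F)) (z v : E) (t : ℝ) :
    HasDerivAt (fun t : ℝ => fderiv ℝ F (z + t • v) v)
      (fderiv ℝ (fderiv ℝ F) (z + t • v) v v) t := by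
  simpa using ((hF _).hasFDerivAt.comp_hasDerivAt t (hasDerivAt_add_smul z v t)).clm_apply
    (hasDerivAt_const t v)

variable {α : Type*} [MeasurableSpace α] {μ : Measure α} {D : α → E} {M : ℝ}

lemma isLocalMin_integral_add_smul {z : E} (h : ∀ t : ℝ, 0 ≤ ∫ x, (F (z + t • D x) - F z) ∂μ) :
    IsLocalMin (fun t : ℝ => ∫ x, (F (z + t • D x) - F z) ∂μ) 0 :=
  Eventually.of_forall fun t => by simpa using h t

variable [IsFiniteMeasure μ] [ProperSpace E]

lemma hasDerivAt_integral_add_smul (hF : ContDiff ℝ 1 F) (z : E)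
    (hD : AEStronglyMeasurable D μ) (hM : ∀ᵐ x ∂μ, ‖D x‖ ≤ M) (t : ℝ) :
    HasDerivAt (fun t : ℝ => ∫ x, (F (z + t • D x) - F z) ∂μ)
      (∫ x, fderiv ℝ F (z + t • D x) (D x) ∂μ) t := by
  have hF₀ := hF.continuous
  have hF₁ := hF.continuous_fderiv one_ne_zero
  refine hasDerivAt_integral_comp (H := fun t ξ => F (z + t • ξ) - F z)
    (H' := fun t ξ => fderiv ℝ F (z + t • ξ) ξ)
    (fun t ξ => (hasDerivAt_comp_add_smul (hF.differentiable one_ne_zero) z ξ t).sub_const _)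
    (fun t => by fun_prop) ?_ hD hM t
  exact (hF₁.comp (by fun_prop)).clm_apply continuous_snd

lemma hasDerivAt_integral_fderiv_add_smul (hF : ContDiff ℝ 2 F) (z : E)
    (hD : AEStronglyMeasurable D μ) (hM : ∀ᵐ x ∂μ, ‖D x‖ ≤ M) (t : ℝ) :
    HasDerivAt (fun t : ℝ => ∫ x, fderiv ℝ F (z + t • D x) (D x) ∂μ)
      (∫ x, fderiv ℝ (fderiv ℝ F) (z + t • D x) (D x) (D x) ∂μ) t := by
  have hF₁ : ContDiff ℝ 1 (fderiv ℝ F) := hF.fderiv_right le_rfl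
  have hc₁ := hF₁.continuous
  have hc₂ := hF₁.continuous_fderiv one_ne_zero
  refine hasDerivAt_integral_comp (H := fun t ξ => fderiv ℝ F (z + t • ξ) ξ)
    (H' := fun t ξ => fderiv ℝ (fderiv ℝ F) (z + t • ξ) ξ ξ)
    (fun t ξ => hasDerivAt_fderiv_comp_add_smul (hF₁.differentiable one_ne_zero) z ξ t)
    (fun t => ?_) ?_ hD hM t
  · exact (hc₁.comp (by fun_prop)).clm_apply continuous_id
  · exact ((hc₂.comp (by fun_prop)).clm_apply continuous_snd).clm_apply continuous_snd

lemma integral_fderiv_eq_zero_of_nonneg (hF : ContDiff ℝ 1 F) {z : E}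
    (hD : AEStronglyMeasurable D μ) (hM : ∀ᵐ x ∂μ, ‖D x‖ ≤ M)
    (h : ∀ t : ℝ, 0 ≤ ∫ x, (F (z + t • D x) - F z) ∂μ) : ∫ x, fderiv ℝ F z (D x) ∂μ = 0 := by
  simpa using (isLocalMin_integral_add_smul h).hasDerivAt_eq_zero
    (hasDerivAt_integral_add_smul hF z hD hM 0)

lemma integral_fderiv_fderiv_nonneg (hF : ContDiff ℝ 2 F) {z : E}
    (hD : AEStronglyMeasurable D μ) (hM : ∀ᵐ x ∂μ, ‖D x‖ ≤ M)
    (h : ∀ t : ℝ, 0 ≤ ∫ x, (F (z + t • D x) - F z) ∂μ) :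
    0 ≤ ∫ x, fderiv ℝ (fderiv ℝ F) z (D x) (D x) ∂μ := by
  simpa using nonneg_of_hasDerivAt_of_isLocalMin (isLocalMin_integral_add_smul h)
    (hasDerivAt_integral_add_smul (hF.of_le one_le_two) z hD hM)
    (hasDerivAt_integral_fderiv_add_smul hF z hD hM 0)

end Line

section WeakGradient

variable {n : ℕ}

lemma integral_fderiv_eq_zero {f : Vec n → ℝ} {f' : Vec n → Vec n →L[ℝ] ℝ}
    (hf : ∀ x, HasFDerivAt f (f' x) x) (hfi : Integrable f) (v : Vec n)
    (hfi' : Integrable fun x => f' x v) : ∫ x, f' x v = 0 := by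
  have := integral_bilinear_hasFDerivAt_right_eq_neg_left_of_integrable (μ := volume)
    (B := ContinuousLinearMap.mul ℝ ℝ) (f := fun _ : Vec n => (1 : ℝ)) (f' := fun _ => 0)
    (g := f) (g' := f') (v := v) (by simp) (by simpa using hfi') (by simpa using hfi)
    (fun x _ => hasFDerivAt_const _ _) (fun x _ => hf x)
  simpa using this

lemma continuous_of_eq_zero_off_closed {X : Type*} [TopologicalSpace X] {U K : Set X}
    (hU : IsOpen U) (hK : IsClosed K) (hKU : K ⊆ U) {f : X → ℝ} (hf : ContinuousOn f U)
    (hf₀ : ∀ x ∉ K, f x = 0) : Continuous f := by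
  rw [continuous_iff_continuousAt]
  intro x
  by_cases hx : x ∈ K
  · exact hf.continuousAt (hU.mem_nhds (hKU hx))
  · have hzero : f =ᶠ[𝓝 x] fun _ => 0 := by
      filter_upwards [hK.isOpen_compl.mem_nhds hx] with y hy using hf₀ y hy
    exact continuousAt_const.congr hzero.symm

lemma integrable_of_eq_zero_off_compact {U K : Set (Vec n)} (hU : IsOpen U) (hK : IsCompact K)
    (hKU : K ⊆ U) {f : Vec n → ℝ} (hf : ContinuousOn f U) (hf₀ : ∀ x ∉ K, f x = 0) :
    Integrable f :=
  (continuous_of_eq_zero_off_closed hU hK.isClosed hKU hf hf₀).integrable_of_hasCompactSupport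
    (HasCompactSupport.intro hK hf₀)

lemma hasFDerivAt_mul_of_tsupport_subset {U : Set (Vec n)} {f η : Vec n → ℝ}
    (hf : ∀ x ∈ U, DifferentiableAt ℝ f x) (hη : Differentiable ℝ η) (hηU : tsupport η ⊆ U)
    (x : Vec n) :
    HasFDerivAt (fun x => f x * η x) (f x • fderiv ℝ η x + η x • fderiv ℝ f x) x := by
  by_cases hx : x ∈ tsupport η
  · exact (hf x (hηU hx)).hasFDerivAt.mul (hη x).hasFDerivAt
  · have hη₀ : η x = 0 := image_eq_zero_of_notMem_tsupport hx
    have hη₁ : fderiv ℝ η x = 0 :=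
      image_eq_zero_of_notMem_tsupport fun h => hx (tsupport_fderiv_subset ℝ h)
    have hzero : (fun x => f x * η x) =ᶠ[𝓝 x] fun _ => 0 := by
      filter_upwards [(isClosed_tsupport η).isOpen_compl.mem_nhds hx] with y hy
      rw [image_eq_zero_of_notMem_tsupport hy, mul_zero]
    simpa [hη₀, hη₁] using (hasFDerivAt_const (0 : ℝ) x).congr_of_eventuallyEq hzero

lemma setIntegral_mul_fderiv_eq_neg {U : Set (Vec n)} (hU : IsOpen U) {f : Vec n → ℝ}
    (hf : ∀ x ∈ U, DifferentiableAt ℝ f x) {v : Vec n}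
    (hf' : ContinuousOn (fun x => fderiv ℝ f x v) U) {η : Vec n → ℝ} (hη : IsTestFunction U η) :
    ∫ x in U, f x * fderiv ℝ η x v = -∫ x in U, fderiv ℝ f x v * η x := by
  have hKU := hη.tsupport_subset
  have hηd : Differentiable ℝ η := hη.contDiff.differentiable (by simp)
  have hfc : ContinuousOn f U := fun x hx => (hf x hx).continuousAt.continuousWithinAt
  have hηc' : Continuous fun x => fderiv ℝ η x v :=
    (hη.contDiff.continuous_fderiv (by simp)).clm_apply continuous_const
  have hη₀ {x : Vec n} (hx : x ∉ tsupport η) : η x = 0 := image_eq_zero_of_notMem_tsupport hx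
  have hη₁ {x : Vec n} (hx : x ∉ tsupport η) : fderiv ℝ η x = 0 :=
    image_eq_zero_of_notMem_tsupport fun h => hx (tsupport_fderiv_subset ℝ h)
  have hleft₀ : ∀ x ∉ tsupport η, f x * fderiv ℝ η x v = 0 := fun x hx => by simp [hη₁ hx]
  have hright₀ : ∀ x ∉ tsupport η, fderiv ℝ f x v * η x = 0 := fun x hx => by simp [hη₀ hx]
  have hleft : Integrable fun x => f x * fderiv ℝ η x v :=
    integrable_of_eq_zero_off_compact hU hη.hasCompactSupport hKU
      (hfc.mul hηc'.continuousOn) hleft₀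
  have hright : Integrable fun x => fderiv ℝ f x v * η x :=
    integrable_of_eq_zero_off_compact hU hη.hasCompactSupport hKU
      (hf'.mul hηd.continuous.continuousOn) hright₀
  have hprod : Integrable fun x => f x * η x :=
    integrable_of_eq_zero_off_compact hU hη.hasCompactSupport hKU
      (hfc.mul hηd.continuous.continuousOn) fun x hx => by simp [hη₀ hx]
  have hderiv : ∀ x, (f x • fderiv ℝ η x + η x • fderiv ℝ f x) v =
      f x * fderiv ℝ η x v + fderiv ℝ f x v * η x := fun x => by simp [mul_comm]
  have hzero := integral_fderiv_eq_zero (hasFDerivAt_mul_of_tsupport_subset hf hηd hKU) hprod v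
    ((hleft.add hright).congr (.of_forall fun x => (hderiv x).symm))
  simp only [hderiv] at hzero
  rw [integral_add hleft hright] at hzero
  have hrestrict {f : Vec n → ℝ} (hf : ∀ x ∉ tsupport η, f x = 0) : ∫ x in U, f x = ∫ x, f x :=
    setIntegral_eq_integral_of_forall_compl_eq_zero fun x hx => hf x fun h => hx (hKU h)
  rw [hrestrict hleft₀, hrestrict hright₀]
  exact eq_neg_of_add_eq_zero_left hzero

lemma setIntegral_mul_fderiv_eq_neg_of_grad_eq {N : ℕ} {U : Set (Vec n)} (hU : IsOpen U)
    {φ : Vec n → Vec N} {Dφ : Vec n → Mat N n} (hd : ∀ x ∈ U, DifferentiableAt ℝ φ x)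
    (hg : ∀ x ∈ U, grad φ x = Dφ x) (hc : ContinuousOn Dφ U) {η : Vec n → ℝ}
    (hη : IsTestFunction U η) (i : Fin N) (j : Fin n) :
    ∫ x in U, φ x i * fderiv ℝ η x (EuclideanSpace.single j 1) =
      -∫ x in U, Dφ x (i, j) * η x := by
  have hcoord : ∀ x ∈ U, HasFDerivAt (fun y => φ y i)
      ((EuclideanSpace.proj i : Vec N →L[ℝ] ℝ).comp (fderiv ℝ φ x)) x := fun x hx =>
    (EuclideanSpace.proj i : Vec N →L[ℝ] ℝ).hasFDerivAt.comp x (hd x hx).hasFDerivAt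
  have hentry : EqOn (fun x => fderiv ℝ (fun y => φ y i) x (EuclideanSpace.single j 1))
      (fun x => Dφ x (i, j)) U := fun x hx => by
    simp only [(hcoord x hx).fderiv, ← hg x hx]
    rfl
  have hDij : ContinuousOn (fun x => Dφ x (i, j)) U :=
    (EuclideanSpace.proj (i, j) : Mat N n →L[ℝ] ℝ).continuous.comp_continuousOn hc
  rw [setIntegral_mul_fderiv_eq_neg hU (fun x hx => (hcoord x hx).differentiableAt)
    (hDij.congr hentry) hη]
  exact congrArg Neg.neg (setIntegral_congr_fun hU.measurableSet fun x hx =>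
    congrArg (· * η x) (hentry hx))

variable {E : Type*} [NormedAddCommGroup E] [NormedSpace ℝ E] {U : Set (Vec n)}

lemma IsTestFunction.contDiff_one {φ : Vec n → E} (hφ : IsTestFunction U φ) : ContDiff ℝ 1 φ :=
  hφ.contDiff.of_le (by exact_mod_cast le_top)

lemma isTestFunction_of_eq_zero_off {K : Set (Vec n)} (hK : IsCompact K) (hKU : K ⊆ U)
    {φ : Vec n → E} (hφ : ContDiff ℝ ∞ φ) (hφ₀ : ∀ x ∉ K, φ x = 0) : IsTestFunction U φ :=
  ⟨hφ, HasCompactSupport.intro hK hφ₀,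
    (closure_minimal (Function.support_subset_iff'.2 hφ₀) hK.isClosed).trans hKU⟩

lemma IsTestFunction.const_smul {φ : Vec n → E} (hφ : IsTestFunction U φ) (t : ℝ) :
    IsTestFunction U (t • φ) :=
  isTestFunction_of_eq_zero_off hφ.hasCompactSupport hφ.tsupport_subset (hφ.contDiff.const_smul t)
    fun x hx => by simp [image_eq_zero_of_notMem_tsupport hx]

lemma IsTestFunction.isSobolevZeroInfty {N : ℕ} (hU : IsOpen U) {φ : Vec n → Vec N}
    (hφ : IsTestFunction U φ) : IsSobolevZeroInfty U φ (grad φ) where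
  isSobolev :=
    { memLp :=
        (hφ.contDiff_one.continuous.memLp_of_hasCompactSupport hφ.hasCompactSupport).restrict U
      memLp_grad := ((continuous_grad hφ.contDiff_one).memLp_of_hasCompactSupport
        (hasCompactSupport_grad hφ.hasCompactSupport)).restrict U
      weak_grad := fun _ => setIntegral_mul_fderiv_eq_neg_of_grad_eq hU
        (fun x _ => hφ.contDiff_one.differentiable one_ne_zero x) (fun _ _ => rfl)
        (continuous_grad hφ.contDiff_one).continuousOn }
  approx := fun ε hε => ⟨φ, hφ, by simpa [sobolevDist] using hε⟩

end WeakGradient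

/-! ### Rank-one convexity and growth of the derivative -/

section Cube

lemma isOpen_unitCube (n : ℕ) : IsOpen (unitCube n) := by
  simp only [unitCube, ofPred_forall]
  exact isOpen_iInter_of_finite fun i =>
    isOpen_Ioo.preimage (EuclideanSpace.proj i : Vec n →L[ℝ] ℝ).continuous

lemma isBounded_unitCube (n : ℕ) : Bornology.IsBounded (unitCube n) := by
  refine isBounded_iff_forall_norm_le.2 ⟨√n, fun x hx => ?_⟩
  rw [EuclideanSpace.norm_eq]
  refine Real.sqrt_le_sqrt ?_
  calc ∑ i, ‖x i‖ ^ 2 ≤ ∑ _i : Fin n, (1 : ℝ) := by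
        refine Finset.sum_le_sum fun i _ => pow_le_one₀ (norm_nonneg _) ?_
        rw [Real.norm_of_nonneg (hx i).1.le]
        exact (hx i).2.le
    _ = n := by simp

instance (n : ℕ) : IsFiniteMeasure (volume.restrict (unitCube n)) :=
  isFiniteMeasure_restrict.2 (isBounded_unitCube n).measure_lt_top.ne

/-- The centre of the unit cube. -/
def cubeCenter (n : ℕ) : Vec n := WithLp.toLp 2 fun _ => 1 / 2

lemma ball_cubeCenter_subset (n : ℕ) : ball (cubeCenter n) (1 / 2) ⊆ unitCube n := by
  intro x hx i
  rw [mem_ball, dist_eq_norm] at hx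
  have hcoord : |x i - 1 / 2| < 1 / 2 :=
    (PiLp.norm_apply_le (x - cubeCenter n) i).trans_lt hx
  rw [abs_lt] at hcoord
  exact ⟨by linarith [hcoord.1], by linarith [hcoord.2]⟩

end Cube

section RankOne

variable {N n : ℕ} {F : Mat N n → ℝ}

/-- Quasiconvexity of `F`, tested with smooth functions of compact support in the unit cube. -/
def IsQuasiconvex (F : Mat N n → ℝ) : Prop :=
  ∀ (z : Mat N n) (φ : Vec n → Vec N), IsTestFunction (unitCube n) φ →
    0 ≤ ∫ x in unitCube n, (F (z + grad φ x) - F z)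

lemma IsStronglyQuasiconvex.isQuasiconvex {p c₂ : ℝ} (hc₂ : 0 ≤ c₂)
    (hF : IsStronglyQuasiconvex p c₂ F) : IsQuasiconvex F := fun z _ hφ =>
  (mul_nonneg hc₂ (integral_nonneg fun _ => by positivity)).trans
    (hF z _ _ (hφ.isSobolevZeroInfty (isOpen_unitCube n)))

lemma IsQuasiconvex.add_smul_nonneg (hqc : IsQuasiconvex F) (z : Mat N n) {φ : Vec n → Vec N}
    (hφ : IsTestFunction (unitCube n) φ) (t : ℝ) :
    0 ≤ ∫ x in unitCube n, (F (z + t • grad φ x) - F z) := by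
  simpa only [grad_const_smul] using hqc z _ (hφ.const_smul t)

lemma IsQuasiconvex.secondVariation_nonneg (hqc : IsQuasiconvex F) (hF : ContDiff ℝ 2 F)
    (z : Mat N n) {φ : Vec n → Vec N} (hφ : IsTestFunction (unitCube n) φ) :
    0 ≤ ∫ x in unitCube n, fderiv ℝ (fderiv ℝ F) z (grad φ x) (grad φ x) := by
  obtain ⟨M, hM⟩ := exists_norm_grad_le hφ.contDiff_one hφ.hasCompactSupport
  exact integral_fderiv_fderiv_nonneg hF
    (continuous_grad hφ.contDiff_one).aestronglyMeasurable (.of_forall hM)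
    (hqc.add_smul_nonneg z hφ)

/-- The rank-one matrix `e ⊗ L`, as a linear function of the functional `L`. -/
def rankOne (e : Vec N) : (Vec n →L[ℝ] ℝ) →L[ℝ] Mat N n :=
  (matEquiv N n : (Vec n →L[ℝ] Vec N) →L[ℝ] Mat N n).comp
    ((ContinuousLinearMap.smulRightL ℝ (Vec n) (Vec N)).flip e)

lemma rankOne_single_proj (i : Fin N) (j : Fin n) :
    rankOne (EuclideanSpace.single i 1) (EuclideanSpace.proj j : Vec n →L[ℝ] ℝ) =
      EuclideanSpace.single (i, j) 1 := by
  ext ⟨a, b⟩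
  change (EuclideanSpace.single b (1 : ℝ) : Vec n) j * (EuclideanSpace.single i (1 : ℝ) : Vec N) a =
    (EuclideanSpace.single (i, j) (1 : ℝ) : Mat N n) (a, b)
  simp only [PiLp.single_apply, Prod.mk.injEq, ite_and, mul_ite, mul_one, mul_zero,
    eq_comm (a := j)]

lemma grad_mul_smul {η f : Vec n → ℝ} {x : Vec n} (hη : DifferentiableAt ℝ η x)
    {f' : Vec n →L[ℝ] ℝ} (hf : HasFDerivAt f f' x) (e : Vec N) :
    grad (fun x => (η x * f x) • e) x = η x • rankOne e f' + f x • rankOne e (fderiv ℝ η x) := by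
  rw [← map_smul, ← map_smul, ← map_add]
  exact congrArg toMat ((hη.hasFDerivAt.mul hf).smul_const e).fderiv

lemma nonneg_of_forall_sq_mul_add_nonneg {a b c : ℝ} (hc : 0 < c)
    (h : ∀ k : ℝ, 0 ≤ b + k ^ 2 * a * c) : 0 ≤ a := by
  by_contra! ha
  have hden : 0 < -a * c := mul_pos (neg_pos.2 ha) hc
  have hk := h (√((|b| + 1) / (-a * c)))
  rw [Real.sq_sqrt (by positivity), mul_assoc, div_mul_eq_mul_div, ← neg_neg (a * c),
    ← neg_mul, mul_neg, neg_div, mul_div_cancel_right₀ _ hden.ne'] at hk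
  linarith [le_abs_self b]

lemma IsTestFunction.integrable_sq {U : Set (Vec n)} {η : Vec n → ℝ} (hη : IsTestFunction U η) :
    Integrable (fun x => η x ^ 2) (volume.restrict U) :=
  ((hη.contDiff.continuous.pow 2).integrable_of_hasCompactSupport
    (.intro hη.hasCompactSupport fun x hx => by
      simp [image_eq_zero_of_notMem_tsupport hx])).restrict

lemma exists_bump_unitCube (n : ℕ) : ∃ η : Vec n → ℝ, IsTestFunction (unitCube n) η ∧
    0 < ∫ x in unitCube n, η x ^ 2 := by
  let η : ContDiffBump (cubeCenter n) := ⟨1 / 8, 1 / 4, by norm_num, by norm_num⟩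
  have hη : IsTestFunction (unitCube n) η :=
    ⟨η.contDiff, η.hasCompactSupport, by
      rw [η.tsupport_eq]
      exact (closedBall_subset_ball (by norm_num)).trans (ball_cubeCenter_subset n)⟩
  refine ⟨η, hη, (setIntegral_pos_iff_support_of_nonneg_ae
    (.of_forall fun x => sq_nonneg (η x)) hη.integrable_sq).2 ?_⟩
  refine (measure_ball_pos volume (cubeCenter n) (r := 1 / 8) (by norm_num)).trans_le
    (measure_mono fun x hx => ⟨?_, ball_cubeCenter_subset n (ball_subset_ball (by norm_num) hx)⟩)
  simp [η.one_of_mem_closedBall (ball_subset_closedBall hx)]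

/- On adding the second variations at `η cos(k L) e` and `η sin(k L) e` the mixed terms cancel, and
the rank-one second derivative is left with the dominant factor `k²`. -/
lemma oscillation_apply_apply_add (B : Mat N n →L[ℝ] Mat N n →L[ℝ] ℝ) (e : Vec N)
    (L : Vec n →L[ℝ] ℝ) (k : ℝ) {η : Vec n → ℝ} {x : Vec n} (hη : DifferentiableAt ℝ η x) :
    B (grad (fun x => (η x * Real.cos (k * L x)) • e) x)
        (grad (fun x => (η x * Real.cos (k * L x)) • e) x) +
      B (grad (fun x => (η x * Real.sin (k * L x)) • e) x)
        (grad (fun x => (η x * Real.sin (k * L x)) • e) x) =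
      B (rankOne e (fderiv ℝ η x)) (rankOne e (fderiv ℝ η x)) +
        k ^ 2 * B (rankOne e L) (rankOne e L) * η x ^ 2 := by
  rw [grad_mul_smul hη (L.hasFDerivAt.const_mul k).cos,
    grad_mul_smul hη (L.hasFDerivAt.const_mul k).sin]
  simp only [map_add, map_smul, add_apply, smul_apply, smul_eq_mul]
  linear_combination (B (rankOne e (fderiv ℝ η x)) (rankOne e (fderiv ℝ η x)) +
    k ^ 2 * η x ^ 2 * B (rankOne e L) (rankOne e L)) * Real.sin_sq_add_cos_sq (k * L x)

lemma IsQuasiconvex.secondVariation_oscillation_nonneg (hqc : IsQuasiconvex F) (hF : ContDiff ℝ 2 F)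
    (z : Mat N n) (e : Vec N) (L : Vec n →L[ℝ] ℝ) {η : Vec n → ℝ}
    (hη : IsTestFunction (unitCube n) η) (k : ℝ) :
    0 ≤ (∫ x in unitCube n, fderiv ℝ (fderiv ℝ F) z (rankOne e (fderiv ℝ η x))
        (rankOne e (fderiv ℝ η x))) +
      k ^ 2 * fderiv ℝ (fderiv ℝ F) z (rankOne e L) (rankOne e L) *
        ∫ x in unitCube n, η x ^ 2 := by
  set B := fderiv ℝ (fderiv ℝ F) z
  have hη₁ := hη.contDiff_one
  have hB : Continuous fun ξ => B ξ ξ := B.continuous.clm_apply continuous_id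
  have htest {f : Vec n → ℝ} (hf : ContDiff ℝ ∞ f) :
      IsTestFunction (unitCube n) fun x => (η x * f x) • e :=
    isTestFunction_of_eq_zero_off hη.hasCompactSupport hη.tsupport_subset
      ((hη.contDiff.mul hf).smul contDiff_const)
      fun x hx => by simp [image_eq_zero_of_notMem_tsupport hx]
  have hint {φ : Vec n → Vec N} (hφ : IsTestFunction (unitCube n) φ) :
      Integrable (fun x => B (grad φ x) (grad φ x)) (volume.restrict (unitCube n)) := by
    obtain ⟨M, hM⟩ := exists_norm_grad_le hφ.contDiff_one hφ.hasCompactSupport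
    exact integrable_continuous_comp (H := fun ξ => B ξ ξ)
      (continuous_grad hφ.contDiff_one).aestronglyMeasurable (.of_forall hM) hB
  have hcos := htest (f := fun x => Real.cos (k * L x)) (by fun_prop)
  have hsin := htest (f := fun x => Real.sin (k * L x)) (by fun_prop)
  have hint₁ : Integrable (fun x => B (rankOne e (fderiv ℝ η x)) (rankOne e (fderiv ℝ η x)))
      (volume.restrict (unitCube n)) :=
    ((hB.comp ((rankOne e).continuous.comp
      (hη₁.continuous_fderiv one_ne_zero))).integrable_of_hasCompactSupport
        (.intro hη.hasCompactSupport fun x hx => by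
          simp [fderiv_of_notMem_tsupport (𝕜 := ℝ) hx])).restrict
  have hsum := add_nonneg (hqc.secondVariation_nonneg hF z hcos)
    (hqc.secondVariation_nonneg hF z hsin)
  rw [← integral_add (hint hcos) (hint hsin)] at hsum
  rw [← integral_const_mul, ← integral_add hint₁ (hη.integrable_sq.const_mul _)]
  exact hsum.trans_eq (integral_congr_ae (.of_forall fun x =>
    oscillation_apply_apply_add B e L k (hη₁.differentiable one_ne_zero x)))

lemma IsQuasiconvex.fderiv_fderiv_rankOne_nonneg (hqc : IsQuasiconvex F) (hF : ContDiff ℝ 2 F)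
    (z : Mat N n) (e : Vec N) (L : Vec n →L[ℝ] ℝ) :
    0 ≤ fderiv ℝ (fderiv ℝ F) z (rankOne e L) (rankOne e L) := by
  obtain ⟨η, hη, hpos⟩ := exists_bump_unitCube n
  exact nonneg_of_forall_sq_mul_add_nonneg hpos (hqc.secondVariation_oscillation_nonneg hF z e L hη)

end RankOne

section GradGrowth

lemma mul_fderiv_le_of_second_deriv_nonneg {E : Type*} [NormedAddCommGroup E] [NormedSpace ℝ E]
    {F : E → ℝ} (hF : ContDiff ℝ 2 F) {v : E} (h : ∀ z, 0 ≤ fderiv ℝ (fderiv ℝ F) z v v) (z : E)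
    {t : ℝ} (ht : 0 < t) : t * fderiv ℝ F z v ≤ F (z + t • v) - F z := by
  have hd₁ := hasDerivAt_comp_add_smul (hF.differentiable two_ne_zero) z v
  have hd₂ := hasDerivAt_fderiv_comp_add_smul
    ((hF.fderiv_right (m := 1) le_rfl).differentiable one_ne_zero) z v
  have hderiv : deriv (fun t : ℝ => F (z + t • v)) = fun t => fderiv ℝ F (z + t • v) v :=
    funext fun t => (hd₁ t).deriv
  have hconv : ConvexOn ℝ univ (fun t : ℝ => F (z + t • v)) := by
    refine convexOn_univ_of_deriv2_nonneg (fun t => (hd₁ t).differentiableAt) ?_ fun t => ?_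
    · rw [hderiv]
      exact fun t => (hd₂ t).differentiableAt
    · rw [Function.iterate_succ, Function.iterate_one, Function.comp_apply, hderiv, (hd₂ t).deriv]
      exact h _
  have hslope := hconv.le_slope_of_hasDerivAt (mem_univ 0) (mem_univ t) ht (hd₁ 0)
  simp only [slope_def_field, zero_smul, add_zero, sub_zero] at hslope
  rw [mul_comm]
  exact (le_div_iff₀ ht).1 hslope

lemma fderiv_le_of_second_deriv_nonneg {E : Type*} [NormedAddCommGroup E] [NormedSpace ℝ E]
    {F : E → ℝ} (hF : ContDiff ℝ 2 F) {p c₁ : ℝ} (hp : 0 ≤ p)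
    (hgrowth : ∀ z, |F z| ≤ c₁ * (1 + ‖z‖ ^ p)) {v : E} (hv : ‖v‖ = 1)
    (h : ∀ z, 0 ≤ fderiv ℝ (fderiv ℝ F) z v v) (z : E) :
    fderiv ℝ F z v ≤ c₁ * (3 + 2 ^ p) * (1 + ‖z‖) ^ (p - 1) := by
  set t := 1 + ‖z‖
  have ht₁ : 1 ≤ t := le_add_of_nonneg_right (norm_nonneg z)
  have hzt : ‖z‖ ≤ t := le_add_of_nonneg_left zero_le_one
  have ht₀ : 0 < t := zero_lt_one.trans_le ht₁
  have hc₁ : 0 ≤ c₁ := nonneg_of_mul_nonneg_left ((abs_nonneg _).trans (hgrowth z)) (by positivity)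
  have hone : 1 ≤ t ^ p := Real.one_le_rpow ht₁ hp
  have hz : ‖z‖ ^ p ≤ t ^ p := Real.rpow_le_rpow (norm_nonneg _) hzt hp
  have hzv : ‖z + t • v‖ ^ p ≤ 2 ^ p * t ^ p := by
    rw [← Real.mul_rpow zero_le_two ht₀.le]
    refine Real.rpow_le_rpow (norm_nonneg _) ((norm_add_le _ _).trans ?_) hp
    rw [norm_smul, hv, Real.norm_of_nonneg ht₀.le]
    linarith
  refine le_of_mul_le_mul_left ?_ ht₀
  calc t * fderiv ℝ F z v ≤ F (z + t • v) - F z :=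
        mul_fderiv_le_of_second_deriv_nonneg hF h z ht₀
    _ ≤ c₁ * (1 + ‖z + t • v‖ ^ p) + c₁ * (1 + ‖z‖ ^ p) := by
        linarith [abs_le.1 (hgrowth (z + t • v)), abs_le.1 (hgrowth z)]
    _ ≤ c₁ * (t ^ p + 2 ^ p * t ^ p) + c₁ * (t ^ p + t ^ p) := by gcongr
    _ = c₁ * (3 + 2 ^ p) * t ^ p := by ring
    _ = t * (c₁ * (3 + 2 ^ p) * t ^ (p - 1)) := by
        rw [Real.rpow_sub_one ht₀.ne']
        field_simp

lemma norm_le_of_abs_apply_single_le {ι : Type*} [Fintype ι] [DecidableEq ι]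
    (L : EuclideanSpace ℝ ι →L[ℝ] ℝ) {K : ℝ} (hK : 0 ≤ K)
    (h : ∀ i, |L (EuclideanSpace.single i 1)| ≤ K) : ‖L‖ ≤ Fintype.card ι * K := by
  refine L.opNorm_le_bound (by positivity) fun ξ => ?_
  have hξ : ξ = ∑ i, ξ i • (EuclideanSpace.single i 1 : EuclideanSpace ℝ ι) := by
    simpa using ((EuclideanSpace.basisFun ι ℝ).sum_repr ξ).symm
  calc ‖L ξ‖ = ‖∑ i, ξ i • L (EuclideanSpace.single i 1)‖ := by
        conv_lhs => rw [hξ]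
        simp only [map_sum, map_smul]
    _ ≤ ∑ _i : ι, ‖ξ‖ * K := by
        refine norm_sum_le_of_le _ fun i _ => ?_
        rw [norm_smul]
        exact mul_le_mul (PiLp.norm_apply_le ξ i) (h i) (norm_nonneg _) (norm_nonneg _)
    _ = Fintype.card ι * K * ‖ξ‖ := by
        rw [Finset.sum_const, Finset.card_univ, nsmul_eq_mul]
        ring

lemma IsQuasiconvex.exists_hasGradGrowth {N n : ℕ} {p : ℝ} (hp : 0 ≤ p) {F : Mat N n → ℝ}
    (hF : ContDiff ℝ 2 F) (hgrowth : HasPGrowth p F) (hqc : IsQuasiconvex F) :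
    ∃ C, HasGradGrowth p C F := by
  obtain ⟨c₁, hc₁, hgrowth⟩ := hgrowth
  refine ⟨Fintype.card (Fin N × Fin n) * (c₁ * (3 + 2 ^ p)), fun z => ?_⟩
  rw [mul_assoc]
  refine norm_le_of_abs_apply_single_le _ (by positivity) fun ⟨i, j⟩ => ?_
  have hrank (z : Mat N n) : 0 ≤ fderiv ℝ (fderiv ℝ F) z (EuclideanSpace.single (i, j) 1)
      (EuclideanSpace.single (i, j) 1) := by
    simpa only [rankOne_single_proj] using hqc.fderiv_fderiv_rankOne_nonneg hF z
      (EuclideanSpace.single i 1) (EuclideanSpace.proj j)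
  have hpos := fderiv_le_of_second_deriv_nonneg hF hp hgrowth (by simp) hrank z
  have hneg := fderiv_le_of_second_deriv_nonneg hF hp hgrowth
    (v := -EuclideanSpace.single (i, j) 1) (by simp) (fun z => by simpa using hrank z) z
  rw [map_neg] at hneg
  exact abs_le.2 ⟨neg_le.1 hneg, hpos⟩

end GradGrowth

/-! ### Excess bounds from quasiconvexity -/

section C1TestFunction

variable {N n : ℕ} {U : Set (Vec n)} {φ : Vec n → Vec N}

/-- `φ ∈ C_c^1(U, ℝᴺ)`. -/
structure IsC1TestFunction (U : Set (Vec n)) (φ : Vec n → Vec N) : Prop where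
  contDiff : ContDiff ℝ 1 φ
  hasCompactSupport : HasCompactSupport φ
  tsupport_subset : tsupport φ ⊆ U

lemma IsTestFunction.isC1TestFunction (hφ : IsTestFunction U φ) : IsC1TestFunction U φ :=
  ⟨hφ.contDiff_one, hφ.hasCompactSupport, hφ.tsupport_subset⟩

lemma IsC1TestFunction.continuous_grad (hφ : IsC1TestFunction U φ) : Continuous (grad φ) :=
  Zhang.continuous_grad hφ.contDiff

lemma IsC1TestFunction.exists_norm_grad_le (hφ : IsC1TestFunction U φ) :
    ∃ M : ℝ, ∀ x, ‖grad φ x‖ ≤ M :=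
  Zhang.exists_norm_grad_le hφ.contDiff hφ.hasCompactSupport

lemma isC1TestFunction_of_support_subset {K : Set (Vec n)} (hK : IsCompact K) (hKU : K ⊆ U)
    (hφ : ContDiff ℝ 1 φ) (hφK : Function.support φ ⊆ K) : IsC1TestFunction U φ :=
  ⟨hφ, .of_support_subset_isCompact hK hφK, (closure_minimal hφK hK.isClosed).trans hKU⟩

lemma grad_eq_zero_of_notMem_tsupport {x : Vec n} (hx : x ∉ tsupport φ) : grad φ x = 0 := by
  rw [grad_eq_matEquiv, fderiv_of_notMem_tsupport (𝕜 := ℝ) hx, map_zero]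

end C1TestFunction

section Mollification

variable {N n : ℕ} {φ : Vec n → Vec N}

open scoped Convolution
open ContinuousLinearMap (lsmul)

lemma isTestFunction_convolution_normed {U : Set (Vec n)} {δ : ℝ} (hφ : Continuous φ)
    (hφc : HasCompactSupport φ) (hδU : cthickening δ (tsupport φ) ⊆ U)
    {ρ : ContDiffBump (0 : Vec n)} (hρ : ρ.rOut ≤ δ) :
    IsTestFunction U (ρ.normed volume ⋆[lsmul ℝ ℝ, volume] φ) := by
  refine isTestFunction_of_eq_zero_off (IsCompact.cthickening hφc) hδU
    (ρ.hasCompactSupport_normed.contDiff_convolution_left _ ρ.contDiff_normed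
      hφ.locallyIntegrable) (Function.support_subset_iff'.1 ?_)
  refine (support_convolution_subset (μ := volume) (lsmul ℝ ℝ)).trans ?_
  rw [ρ.support_normed_eq]
  rintro _ ⟨a, ha, b, hb, rfl⟩
  refine mem_cthickening_of_dist_le _ b _ _ (subset_tsupport _ hb) ?_
  rw [dist_eq_norm, add_sub_cancel_right]
  exact (mem_ball_zero_iff.1 ha).le.trans hρ

lemma fderiv_convolution_normed (hφ : ContDiff ℝ 1 φ) (hφc : HasCompactSupport φ)
    (ρ : ContDiffBump (0 : Vec n)) (x : Vec n) :
    fderiv ℝ (ρ.normed volume ⋆[lsmul ℝ ℝ, volume] φ) x =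
      (ρ.normed volume ⋆[lsmul ℝ ℝ, volume] fderiv ℝ φ) x :=
  (hφc.hasFDerivAt_convolution_right (lsmul ℝ ℝ) ρ.continuous_normed.locallyIntegrable hφ x).fderiv

lemma norm_convolution_normed_le {E : Type*} [NormedAddCommGroup E] [NormedSpace ℝ E]
    [CompleteSpace E] {f : Vec n → E} (hf : AEStronglyMeasurable f) {M : ℝ} (hM : ∀ x, ‖f x‖ ≤ M)
    (ρ : ContDiffBump (0 : Vec n)) (x : Vec n) :
    ‖(ρ.normed volume ⋆[lsmul ℝ ℝ, volume] f) x‖ ≤ M := by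
  simpa only [dist_zero_right] using dist_convolution_le (z₀ := (0 : E))
    ((norm_nonneg _).trans (hM x)) ρ.support_normed_eq.subset ρ.nonneg_normed
    ρ.integral_normed hf fun y _ => by simpa only [dist_zero_right] using hM y

lemma IsC1TestFunction.exists_mollification {U : Set (Vec n)} (hU : IsOpen U)
    (hφ : IsC1TestFunction U φ) : ∃ φk : ℕ → Vec n → Vec N, (∀ k, IsTestFunction U (φk k)) ∧
      (∃ M : ℝ, ∀ k x, ‖grad (φk k) x‖ ≤ M) ∧
      ∀ x, Tendsto (fun k => grad (φk k) x) atTop (𝓝 (grad φ x)) := by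
  have hφ' := hφ.contDiff.continuous_fderiv one_ne_zero
  obtain ⟨δ, hδ, hδU⟩ := IsCompact.exists_cthickening_subset_open hφ.hasCompactSupport hU
    hφ.tsupport_subset
  obtain ⟨M, hM⟩ := (hφ.hasCompactSupport.fderiv ℝ).exists_bound_of_continuous hφ'
  let ρ (k : ℕ) : ContDiffBump (0 : Vec n) :=
    ⟨δ / (k + 1) / 2, δ / (k + 1), by positivity, half_lt_self (by positivity)⟩
  have hρ : Tendsto (fun k => (ρ k).rOut) atTop (𝓝 0) := by
    simpa [ρ, div_eq_mul_inv] using tendsto_one_div_add_atTop_nhds_zero_nat.const_mul δ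
  refine ⟨fun k => (ρ k).normed volume ⋆[lsmul ℝ ℝ, volume] φ, fun k =>
    isTestFunction_convolution_normed hφ.contDiff.continuous hφ.hasCompactSupport hδU
      (div_le_self hδ.le (by simp)), ?_⟩
  simp only [grad_eq_matEquiv, fderiv_convolution_normed hφ.contDiff hφ.hasCompactSupport]
  refine ⟨⟨‖(matEquiv N n : (Vec n →L[ℝ] Vec N) →L[ℝ] Mat N n)‖ * M, fun k x => ?_⟩, fun x => ?_⟩
  · exact ContinuousLinearMap.le_opNorm_of_le
      (matEquiv N n : (Vec n →L[ℝ] Vec N) →L[ℝ] Mat N n)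
      (norm_convolution_normed_le hφ'.aestronglyMeasurable hM (ρ k) x)
  · exact ((matEquiv N n).continuous.tendsto _).comp
      (ContDiffBump.convolution_tendsto_right_of_continuous hρ hφ' x)

end Mollification

section ExcessBound

variable {N n : ℕ} {p c : ℝ} {F : Mat N n → ℝ} {z : Mat N n} {S T U : Set (Vec n)}
  {D : Vec n → Mat N n}

/-- Strong quasiconvexity on `S` at `z`, tested with the field `D`, in the normalized form
`c ∫_S |V(D)|² ≤ ∫_S (F(z + D) - F(z) - F'(z) D)`. -/
def ExcessBound (p c : ℝ) (F : Mat N n → ℝ) (z : Mat N n) (S : Set (Vec n))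
    (D : Vec n → Mat N n) : Prop :=
  c * ∫ x in S, ‖V p (D x)‖ ^ 2 ≤ ∫ x in S, excess F z (D x)

/- Testing with all multiples of `D` forces the linear term to have zero integral. -/
lemma excessBound_of_forall_smul (hc : 0 ≤ c) (hF : ContDiff ℝ 1 F) (hS : volume S ≠ ⊤)
    (hD : AEStronglyMeasurable D (volume.restrict S)) {M : ℝ} (hM : ∀ x, ‖D x‖ ≤ M)
    (h : ∀ t : ℝ, c * ∫ x in S, ‖V p (t • D x)‖ ^ 2 ≤ ∫ x in S, (F (z + t • D x) - F z)) :
    ExcessBound p c F z S D := by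
  have : IsFiniteMeasure (volume.restrict S) := isFiniteMeasure_restrict.2 hS
  have hM' : ∀ᵐ x ∂volume.restrict S, ‖D x‖ ≤ M := .of_forall hM
  have hlinear : ∫ x in S, fderiv ℝ F z (D x) = 0 :=
    integral_fderiv_eq_zero_of_nonneg hF hD hM' fun t =>
      (mul_nonneg hc (integral_nonneg fun x => sq_nonneg _)).trans (h t)
  have hFc := hF.continuous
  have hone := h 1
  simp only [one_smul] at hone
  unfold ExcessBound excess
  rwa [integral_sub, hlinear, sub_zero]
  · exact integrable_continuous_comp (H := fun ξ => F (z + ξ) - F z) hD hM' (by fun_prop)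
  · exact integrable_continuous_comp hD hM' (fderiv ℝ F z).continuous

lemma ExcessBound.of_tendsto (hF : Continuous F) (hS : volume S ≠ ⊤) {ι : Type*} {l : Filter ι}
    [l.NeBot] [l.IsCountablyGenerated] {Dk : ι → Vec n → Mat N n}
    (hDk : ∀ᶠ k in l, AEStronglyMeasurable (Dk k) (volume.restrict S)) {M : ℝ}
    (hM : ∀ᶠ k in l, ∀ᵐ x ∂volume.restrict S, ‖Dk k x‖ ≤ M)
    (hD : ∀ᵐ x ∂volume.restrict S, Tendsto (fun k => Dk k x) l (𝓝 (D x)))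
    (h : ∀ᶠ k in l, ExcessBound p c F z S (Dk k)) : ExcessBound p c F z S D := by
  have : IsFiniteMeasure (volume.restrict S) := isFiniteMeasure_restrict.2 hS
  exact le_of_tendsto_of_tendsto
    ((tendsto_integral_continuous_comp hDk hM hD (continuous_norm_V_sq p N n)).const_mul c)
    (tendsto_integral_continuous_comp hDk hM hD (continuous_excess_right hF z)) h

lemma excessBound_iff_of_subset (hST : S ⊆ T) (hT : MeasurableSet T)
    (hD : ∀ x ∈ T \ S, D x = 0) : ExcessBound p c F z S D ↔ ExcessBound p c F z T D := by
  unfold ExcessBound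
  rw [setIntegral_eq_of_subset_of_forall_sdiff_eq_zero hT hST fun x hx => by
      rw [hD x hx, norm_V_sq, norm_zero, vSq_zero],
    setIntegral_eq_of_subset_of_forall_sdiff_eq_zero hT hST fun x hx => by
      rw [hD x hx, excess_zero]]

lemma excessBound_grad_of_forall_isTestFunction (hF : Continuous F) (hS : volume S ≠ ⊤)
    (hU : IsOpen U)
    (h : ∀ φ : Vec n → Vec N, IsTestFunction U φ → ExcessBound p c F z S (grad φ))
    {φ : Vec n → Vec N} (hφ : IsC1TestFunction U φ) : ExcessBound p c F z S (grad φ) := by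
  obtain ⟨φk, hφk, ⟨M, hM⟩, hlim⟩ := hφ.exists_mollification hU
  exact .of_tendsto hF hS
    (.of_forall fun k => (hφk k).isC1TestFunction.continuous_grad.aestronglyMeasurable)
    (.of_forall fun k => .of_forall (hM k)) (.of_forall hlim) (.of_forall fun k => h _ (hφk k))

end ExcessBound

section Homothety

variable {N n : ℕ} {a b : Vec n} {σ : ℝ}

lemma setIntegral_comp_homothety (a b : Vec n) (hσ : 0 < σ) {T : Set (Vec n)}
    (hT : MeasurableSet T) (f : Vec n → ℝ) :
    ∫ y in (fun y => a + σ • (y - b)) ⁻¹' T, f (a + σ • (y - b)) =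
      (σ ^ n)⁻¹ * ∫ x in T, f x := by
  rw [← integral_indicator (hT.preimage (by fun_prop)), ← integral_indicator hT]
  change ∫ y, T.indicator f (a + σ • (y - b)) = _
  rw [integral_sub_right_eq_self (fun y => T.indicator f (a + σ • y)) b,
    Measure.integral_comp_smul volume (fun y => T.indicator f (a + y)) σ,
    integral_add_left_eq_self (T.indicator f) a, abs_of_pos (by positivity),
    finrank_euclideanSpace_fin, smul_eq_mul]

lemma ExcessBound.of_homothety {p c : ℝ} {F : Mat N n → ℝ} {z : Mat N n} (hσ : 0 < σ)
    {T : Set (Vec n)} (hT : MeasurableSet T) {D : Vec n → Mat N n}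
    (hD : ExcessBound p c F z ((fun y => a + σ • (y - b)) ⁻¹' T) fun y => D (a + σ • (y - b))) :
    ExcessBound p c F z T D := by
  unfold ExcessBound at hD ⊢
  rw [setIntegral_comp_homothety a b hσ hT fun x => ‖V p (D x)‖ ^ 2,
    setIntegral_comp_homothety a b hσ hT fun x => excess F z (D x), mul_left_comm] at hD
  exact le_of_mul_le_mul_left hD (by positivity)

lemma homothety_mem_ball_iff (hσ : 0 < σ) (s : ℝ) (y : Vec n) :
    a + σ • (y - b) ∈ ball a (σ * s) ↔ y ∈ ball b s := by
  rw [mem_ball, mem_ball, dist_eq_norm, dist_eq_norm, add_sub_cancel_left, norm_smul,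
    Real.norm_of_nonneg hσ.le, mul_lt_mul_iff_right₀ hσ]

lemma preimage_homothety_ball (hσ : 0 < σ) (s : ℝ) :
    (fun y => a + σ • (y - b)) ⁻¹' ball a (σ * s) = ball b s := by
  ext y
  rw [mem_preimage, homothety_mem_ball_iff hσ]

/-- The rescaling of `φ` by the homothety that takes `b` to `a` with ratio `σ`, normalized so that
gradients are not rescaled. -/
def rescale (a b : Vec n) (σ : ℝ) (φ : Vec n → Vec N) (y : Vec n) : Vec N :=
  σ⁻¹ • φ (a + σ • (y - b))

lemma grad_rescale (hσ : σ ≠ 0) {φ : Vec n → Vec N} (hφ : Differentiable ℝ φ) (y : Vec n) :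
    grad (rescale a b σ φ) y = grad φ (a + σ • (y - b)) := by
  have hinner : HasFDerivAt (fun y : Vec n => a + σ • (y - b))
      (σ • ContinuousLinearMap.id ℝ (Vec n)) y :=
    (((hasFDerivAt_id y).sub_const b).const_smul σ).const_add a
  refine congrArg toMat ((((hφ _).hasFDerivAt.comp y hinner).const_smul σ⁻¹).fderiv.trans ?_)
  ext v
  simp [smul_smul, inv_mul_cancel₀ hσ]

lemma IsC1TestFunction.rescale (hσ : 0 < σ) {φ : Vec n → Vec N} {s : ℝ}
    (hφ : IsC1TestFunction (ball a (σ * s)) φ) :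
    IsC1TestFunction (ball b s) (rescale a b σ φ) := by
  refine isC1TestFunction_of_support_subset (K := (fun x => b + σ⁻¹ • (x - a)) '' tsupport φ)
    (IsCompact.image hφ.hasCompactSupport (by fun_prop)) ?_
    ((hφ.contDiff.comp (by fun_prop)).const_smul _) fun y hy => ?_
  · rintro _ ⟨x, hx, rfl⟩
    rw [← homothety_mem_ball_iff (a := a) hσ, add_sub_cancel_left, smul_inv_smul₀ hσ.ne',
      add_sub_cancel]
    exact hφ.tsupport_subset hx
  · refine ⟨a + σ • (y - b), subset_tsupport _ fun hzero => hy ?_, ?_⟩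
    · rw [Zhang.rescale, hzero, smul_zero]
    · simp [smul_smul, inv_mul_cancel₀ hσ.ne']

end Homothety

section Quasiconvexity

variable {N n : ℕ} {p c₂ s : ℝ} {F : Mat N n → ℝ} {φ : Vec n → Vec N}

lemma IsStronglyQuasiconvex.excessBound_unitCube (hc₂ : 0 ≤ c₂) (hF : ContDiff ℝ 1 F)
    (hqc : IsStronglyQuasiconvex p c₂ F) (z : Mat N n) (hφ : IsC1TestFunction (unitCube n) φ) :
    ExcessBound p c₂ F z (unitCube n) (grad φ) := by
  have hcube := (isBounded_unitCube n).measure_lt_top (μ := volume).ne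
  refine excessBound_grad_of_forall_isTestFunction hF.continuous hcube (isOpen_unitCube n)
    (fun φ hφ => ?_) hφ
  obtain ⟨M, hM⟩ := hφ.isC1TestFunction.exists_norm_grad_le
  refine excessBound_of_forall_smul hc₂ hF hcube
    hφ.isC1TestFunction.continuous_grad.aestronglyMeasurable hM fun t => ?_
  simpa only [grad_const_smul] using
    hqc z _ _ ((hφ.const_smul t).isSobolevZeroInfty (isOpen_unitCube n))

lemma IsStronglyQuasiconvex.excessBound_ball (hc₂ : 0 ≤ c₂) (hF : ContDiff ℝ 1 F)
    (hqc : IsStronglyQuasiconvex p c₂ F) (z : Mat N n) (x₁ : Vec n) (hs : 0 < s)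
    (hφ : IsC1TestFunction (ball x₁ s) φ) : ExcessBound p c₂ F z (ball x₁ s) (grad φ) := by
  obtain ⟨σ, hσ, rfl⟩ : ∃ σ, 0 < σ ∧ s = σ * (1 / 2) := ⟨2 * s, by positivity, by ring⟩
  have hψ := hφ.rescale (b := cubeCenter n) hσ
  refine .of_homothety (a := x₁) (b := cubeCenter n) hσ measurableSet_ball ?_
  simp only [← grad_rescale hσ.ne' (hφ.contDiff.differentiable one_ne_zero)]
  rw [preimage_homothety_ball hσ, excessBound_iff_of_subset (ball_cubeCenter_subset n)
    (isOpen_unitCube n).measurableSet fun x hx =>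
      grad_eq_zero_of_notMem_tsupport fun h => hx.2 (hψ.tsupport_subset h)]
  exact hqc.excessBound_unitCube hc₂ hF z
    ⟨hψ.contDiff, hψ.hasCompactSupport, hψ.tsupport_subset.trans (ball_cubeCenter_subset n)⟩

/-- The part of the ball of radius `s` around `x₀` where `⟨y - x₀, ν⟩ < 0`; its radius is `1` in
`halfBall`. -/
def halfBallOfRadius (x₀ ν : Vec n) (s : ℝ) : Set (Vec n) :=
  {y ∈ ball x₀ s | inner ℝ (y - x₀) ν < 0}

lemma halfBallOfRadius_subset_ball (x₀ ν : Vec n) (s : ℝ) : halfBallOfRadius x₀ ν s ⊆ ball x₀ s :=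
  fun _ hy => hy.1

lemma isOpen_halfBallOfRadius (x₀ ν : Vec n) (s : ℝ) : IsOpen (halfBallOfRadius x₀ ν s) :=
  isOpen_ball.inter (isOpen_lt (f := fun y => inner ℝ (y - x₀) ν) (by fun_prop) continuous_const)

lemma preimage_homothety_halfBallOfRadius (x₀ ν : Vec n) (hs : 0 < s) :
    (fun y => x₀ + s • (y - x₀)) ⁻¹' halfBallOfRadius x₀ ν s = halfBall x₀ ν := by
  ext y
  refine and_congr ?_ ?_
  · simpa only [mul_one] using homothety_mem_ball_iff hs 1 y
  · rw [add_sub_cancel_left, real_inner_smul_left, ← smul_eq_mul, smul_neg_iff_of_pos_left hs]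

lemma IsStronglyQuasiconvexAtFreeBoundary.excessBound_halfBall (hc₂ : 0 ≤ c₂)
    (hF : ContDiff ℝ 1 F) {Ω ΓD : Set (Vec n)} {Du : Vec n → Mat N n}
    (hqc : IsStronglyQuasiconvexAtFreeBoundary p c₂ F Ω ΓD Du) {x₁ ν : Vec n}
    (hx₁ : x₁ ∈ freeBoundary Ω ΓD) (hν : IsOuterUnitNormal Ω x₁ ν)
    (hφ : IsC1TestFunction (ball x₁ 1) φ) :
    ExcessBound p c₂ F (Du x₁) (halfBall x₁ ν) (grad φ) := by
  have hhalf : volume (halfBall x₁ ν) ≠ ⊤ :=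
    (isBounded_ball.subset (halfBallOfRadius_subset_ball x₁ ν 1)).measure_lt_top.ne
  refine excessBound_grad_of_forall_isTestFunction hF.continuous hhalf isOpen_ball
    (fun φ hφ => ?_) hφ
  obtain ⟨M, hM⟩ := hφ.isC1TestFunction.exists_norm_grad_le
  refine excessBound_of_forall_smul hc₂ hF hhalf
    hφ.isC1TestFunction.continuous_grad.aestronglyMeasurable hM fun t => ?_
  have hsphere : ∀ x ∈ sphere x₁ 1 ∩ closure (halfBall x₁ ν), (t • φ) x = 0 := fun x hx => by
    have hxφ : x ∉ tsupport φ := fun h =>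
      (mem_ball.1 (hφ.tsupport_subset h)).ne (mem_sphere.1 hx.1)
    simp [image_eq_zero_of_notMem_tsupport hxφ]
  simpa only [grad_const_smul] using
    hqc x₁ hx₁ ν hν (t • φ) (hφ.const_smul t).contDiff.contDiffOn hsphere

lemma IsStronglyQuasiconvexAtFreeBoundary.excessBound_halfBallOfRadius (hc₂ : 0 ≤ c₂)
    (hF : ContDiff ℝ 1 F) {Ω ΓD : Set (Vec n)} {Du : Vec n → Mat N n}
    (hqc : IsStronglyQuasiconvexAtFreeBoundary p c₂ F Ω ΓD Du) {x₁ ν : Vec n}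
    (hx₁ : x₁ ∈ freeBoundary Ω ΓD) (hν : IsOuterUnitNormal Ω x₁ ν) (hs : 0 < s)
    (hφ : IsC1TestFunction (ball x₁ s) φ) :
    ExcessBound p c₂ F (Du x₁) (halfBallOfRadius x₁ ν s) (grad φ) := by
  refine .of_homothety (a := x₁) (b := x₁) hs (isOpen_halfBallOfRadius x₁ ν s).measurableSet ?_
  simp only [← grad_rescale hs.ne' (hφ.contDiff.differentiable one_ne_zero)]
  rw [preimage_homothety_halfBallOfRadius x₁ ν hs]
  rw [← mul_one s] at hφ
  exact hqc.excessBound_halfBall hc₂ hF hx₁ hν (hφ.rescale hs)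

end Quasiconvexity

/-! ### Straightening the boundary -/

section Shear

variable {n : ℕ} {h : Vec n → ℝ} {e : Vec n}

/-- The shear `x ↦ x + h(x) e`. It preserves volume when `h` is invariant under translations in
direction `e`. -/
def shear (h : Vec n → ℝ) (e x : Vec n) : Vec n := x + h x • e

lemma shear_neg_shear (hinv : ∀ x (t : ℝ), h (x + t • e) = h x) (x : Vec n) :
    shear (-h) e (shear h e x) = x := by
  simp [shear, hinv]

lemma shear_shear_neg (hinv : ∀ x (t : ℝ), h (x + t • e) = h x) (x : Vec n) :
    shear h e (shear (-h) e x) = x := by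
  simpa using shear_neg_shear (h := -h) (fun x t => by simp [hinv]) x

lemma contDiff_shear (hh : ContDiff ℝ 1 h) (e : Vec n) : ContDiff ℝ 1 (shear h e) :=
  contDiff_id.add (hh.smul contDiff_const)

lemma hasFDerivAt_shear (hh : Differentiable ℝ h) (e x : Vec n) :
    HasFDerivAt (shear h e) (ContinuousLinearMap.id ℝ _ + (fderiv ℝ h x).smulRight e) x :=
  (hasFDerivAt_id x).add ((hh x).hasFDerivAt.smul_const e)

lemma fderiv_apply_eq_zero_of_invariant (hh : Differentiable ℝ h)
    (hinv : ∀ x (t : ℝ), h (x + t • e) = h x) (x : Vec n) : fderiv ℝ h x e = 0 := by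
  have hcomp := hasDerivAt_comp_add_smul hh x e 0
  simp only [hinv, zero_smul, add_zero] at hcomp
  exact hcomp.unique (hasDerivAt_const _ _)

lemma setIntegral_shear_image (hh : Differentiable ℝ h) (hinv : ∀ x (t : ℝ), h (x + t • e) = h x)
    {S : Set (Vec n)} (hS : MeasurableSet S) (f : Vec n → ℝ) :
    ∫ y in shear h e '' S, f y = ∫ x in S, f (shear h e x) := by
  rw [integral_image_eq_integral_abs_det_fderiv_smul volume hS
    (fun x _ => (hasFDerivAt_shear hh e x).hasFDerivWithinAt)
    (Function.LeftInverse.injective (shear_neg_shear hinv)).injOn]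
  refine integral_congr_ae (.of_forall fun x => ?_)
  have hdet : (ContinuousLinearMap.id ℝ (Vec n) + (fderiv ℝ h x).smulRight e).det = 1 :=
    (LinearMap.transvection.det (fderiv ℝ h x : Vec n →ₗ[ℝ] ℝ) e).trans <| by
      rw [ContinuousLinearMap.coe_coe, fderiv_apply_eq_zero_of_invariant hh hinv, add_zero]
  simp only [hdet, abs_one, one_smul]

variable {N : ℕ} {φ : Vec n → Vec N}

lemma tsupport_comp_shear_neg_subset (hh : Continuous (shear h e))
    (hinv : ∀ x (t : ℝ), h (x + t • e) = h x) (hφ : HasCompactSupport φ) :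
    tsupport (φ ∘ shear (-h) e) ⊆ shear h e '' tsupport φ :=
  closure_minimal (fun y hy => ⟨shear (-h) e y, subset_tsupport _ hy, shear_shear_neg hinv y⟩)
    (IsCompact.image hφ hh).isClosed

lemma IsC1TestFunction.comp_shear_neg {U W : Set (Vec n)} (hh : ContDiff ℝ 1 h)
    (hinv : ∀ x (t : ℝ), h (x + t • e) = h x) (hUW : MapsTo (shear h e) U W)
    (hφ : IsC1TestFunction U φ) : IsC1TestFunction W (φ ∘ shear (-h) e) :=
  isC1TestFunction_of_support_subset
    (IsCompact.image hφ.hasCompactSupport (contDiff_shear hh e).continuous)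
    (hUW.mono_left hφ.tsupport_subset).image_subset (hφ.contDiff.comp (contDiff_shear hh.neg e))
    ((subset_tsupport _).trans (tsupport_comp_shear_neg_subset (contDiff_shear hh e).continuous
      hinv hφ.hasCompactSupport))

lemma grad_comp_shear_neg (hh : Differentiable ℝ h) (hinv : ∀ x (t : ℝ), h (x + t • e) = h x)
    (hφ : Differentiable ℝ φ) (x : Vec n) :
    grad (φ ∘ shear (-h) e) (shear h e x) = mulRight (grad φ x)
      (ContinuousLinearMap.id ℝ _ + (fderiv ℝ (-h) (shear h e x)).smulRight e) := by
  have hφx : HasFDerivAt φ (fderiv ℝ φ x) (shear (-h) e (shear h e x)) := by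
    rw [shear_neg_shear hinv]
    exact (hφ x).hasFDerivAt
  rw [mulRight, grad_eq_matEquiv φ, ContinuousLinearEquiv.symm_apply_apply]
  exact congrArg toMat (hφx.comp _ (hasFDerivAt_shear hh.neg e _)).fderiv

end Shear

section FirstOrderTaylor

variable {n : ℕ} {g : Vec n → ℝ} {x₁ : Vec n}

/-- The first-order Taylor polynomial of `g` at `x₁`, minus `g`: the height by which the graph of
`g` has to be moved to reach its tangent plane. -/
def taylorDefect (g : Vec n → ℝ) (x₁ x : Vec n) : ℝ := g x₁ + fderiv ℝ g x₁ (x - x₁) - g x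

lemma contDiff_taylorDefect (hg : ContDiff ℝ 1 g) : ContDiff ℝ 1 (taylorDefect g x₁) :=
  (contDiff_const.add ((fderiv ℝ g x₁).contDiff.comp (contDiff_id.sub contDiff_const))).sub hg

lemma fderiv_taylorDefect (hg : Differentiable ℝ g) (x : Vec n) :
    fderiv ℝ (taylorDefect g x₁) x = fderiv ℝ g x₁ - fderiv ℝ g x :=
  ((((fderiv ℝ g x₁).hasFDerivAt.comp x ((hasFDerivAt_id x).sub_const x₁)).const_add (g x₁)).sub
    (hg x).hasFDerivAt).fderiv

lemma taylorDefect_add_smul {e : Vec n} (hg : Differentiable ℝ g)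
    (hinv : ∀ x (t : ℝ), g (x + t • e) = g x) (x : Vec n) (t : ℝ) :
    taylorDefect g x₁ (x + t • e) = taylorDefect g x₁ x := by
  simp only [taylorDefect, hinv, add_sub_right_comm, map_add, map_smul,
    fderiv_apply_eq_zero_of_invariant hg hinv, smul_zero, add_zero]

lemma abs_taylorDefect_le {ρ δ : ℝ} (hg : Differentiable ℝ g)
    (hδ : ∀ x ∈ ball x₁ ρ, ‖fderiv ℝ g x - fderiv ℝ g x₁‖ ≤ δ) {x : Vec n} (hx : x ∈ ball x₁ ρ) :
    |taylorDefect g x₁ x| ≤ δ * ‖x - x₁‖ := by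
  have hle := (convex_ball x₁ ρ).norm_image_sub_le_of_norm_fderiv_le' (𝕜 := ℝ) (fun y _ => hg y)
    hδ (mem_ball_self (pos_of_mem_ball hx)) hx
  rwa [Real.norm_eq_abs, sub_sub, abs_sub_comm] at hle

end FirstOrderTaylor

section Graph

variable {n : ℕ} {Ω : Set (Vec n)} {x₁ : Vec n} {r : ℝ} {e : Vec n} {g : Vec n → ℝ}

lemma IsC1Graph.inner_eq (hG : IsC1Graph Ω x₁ r e g) (hΩ : IsOpen Ω) (hx₁ : x₁ ∈ frontier Ω) :
    inner ℝ e x₁ = g x₁ := by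
  have hmem : x₁ ∈ ball x₁ r := mem_ball_self hG.radius_pos
  rw [hΩ.frontier_eq] at hx₁
  refine le_antisymm ?_ (not_lt.1 fun hlt => hx₁.2 ((hG.mem_iff x₁ hmem).2 hlt))
  by_contra! hlt
  have habove : ∀ᶠ x in 𝓝 x₁, g x < inner ℝ e x :=
    hG.contDiff.continuous.continuousAt.eventually_lt (by fun_prop) hlt
  obtain ⟨x, hx, hxΩ⟩ :=
    mem_closure_iff_nhds.1 hx₁.1 _ (habove.and (ball_mem_nhds x₁ hG.radius_pos))
  exact hx.1.not_gt ((hG.mem_iff x hx.2).1 hxΩ)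

/- The shear by the Taylor defect takes the graph of `g` to its tangent plane. -/
lemma IsC1Graph.inner_shear_sub (hG : IsC1Graph Ω x₁ r e g) (hΩ : IsOpen Ω)
    (hx₁ : x₁ ∈ frontier Ω) (x : Vec n) :
    inner ℝ (shear (taylorDefect g x₁) e x - x₁) (e - gradient g x₁) = inner ℝ e x - g x := by
  have hge : fderiv ℝ g x₁ e = 0 := fderiv_apply_eq_zero_of_invariant
    (hG.contDiff.differentiable one_ne_zero) hG.invariant x₁
  have hee : inner ℝ e e = (1 : ℝ) := by rw [real_inner_self_eq_norm_sq, hG.norm_eq_one, one_pow]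
  rw [shear, add_sub_right_comm, inner_sub_right, real_inner_comm, real_inner_comm (gradient g x₁),
    gradient, InnerProductSpace.toDual_symm_apply, inner_add_right, inner_sub_right,
    real_inner_smul_right, hee, hG.inner_eq hΩ hx₁, map_add, map_smul, hge, taylorDefect,
    smul_zero]
  ring

lemma IsC1Graph.inner_shear_sub_normal_neg_iff (hG : IsC1Graph Ω x₁ r e g) (hΩ : IsOpen Ω)
    (hx₁ : x₁ ∈ frontier Ω) (x : Vec n) :
    inner ℝ (shear (taylorDefect g x₁) e x - x₁)
      (‖e - gradient g x₁‖⁻¹ • (e - gradient g x₁)) < 0 ↔ inner ℝ e x < g x := by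
  have hne : e - gradient g x₁ ≠ 0 := fun hzero => by
    have hge := fderiv_apply_eq_zero_of_invariant
      (hG.contDiff.differentiable one_ne_zero) hG.invariant x₁
    rw [← InnerProductSpace.toDual_symm_apply, ← gradient, ← sub_eq_zero.1 hzero,
      real_inner_self_eq_norm_sq, hG.norm_eq_one] at hge
    norm_num at hge
  rw [real_inner_smul_right, hG.inner_shear_sub hΩ hx₁, ← smul_eq_mul,
    smul_neg_iff_of_pos_left (inv_pos.2 (norm_pos_iff.2 hne)), sub_neg]

lemma shear_mem_ball {h : Vec n → ℝ} {s : ℝ} (he : ‖e‖ = 1) {x : Vec n}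
    (hx : |h x| ≤ ‖x - x₁‖) (hxs : x ∈ ball x₁ s) : shear h e x ∈ ball x₁ (2 * s) := by
  rw [mem_ball, dist_eq_norm] at hxs ⊢
  calc ‖shear h e x - x₁‖ = ‖(x - x₁) + h x • e‖ := by rw [shear, add_sub_right_comm]
    _ ≤ ‖x - x₁‖ + |h x| := by
        refine (norm_add_le _ _).trans_eq ?_
        rw [norm_smul, he, mul_one, Real.norm_eq_abs]
    _ < 2 * s := by linarith

end Graph

section Perturbation

variable {N n : ℕ} {p c K : ℝ} {F : Mat N n → ℝ} {z : Mat N n}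

lemma ExcessBound.of_norm_sub_le (hp : 0 ≤ p) (hc : 0 ≤ c) (hF : Continuous F) {S : Set (Vec n)}
    (hS : MeasurableSet S) (hS' : volume S ≠ ⊤) {D D' : Vec n → Mat N n} {M M' d : ℝ}
    (hDm : AEStronglyMeasurable D (volume.restrict S)) (hDM : ∀ x, ‖D x‖ ≤ M)
    (hDm' : AEStronglyMeasurable D' (volume.restrict S)) (hDM' : ∀ x, ‖D' x‖ ≤ M')
    (hd : 0 ≤ d) (hd1 : d < 1) (hDD' : ∀ x ∈ S, ‖D' x - D x‖ ≤ d * ‖D x‖)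
    (hK : ∀ (d : ℝ) (ξ η : Mat N n), 0 ≤ d → d ≤ 1 → ‖η - ξ‖ ≤ d * ‖ξ‖ →
      |excess F z η - excess F z ξ| ≤ K * d * vSq p ‖ξ‖)
    (h : ExcessBound p c F z S D') :
    ExcessBound p (c - (c * (|p - 2| + 2) + K) * d) F z S D := by
  have : IsFiniteMeasure (volume.restrict S) := isFiniteMeasure_restrict.2 hS'
  have hV := integrable_continuous_comp hDm (.of_forall hDM) (continuous_norm_V_sq p N n)
  have hV' := integrable_continuous_comp hDm' (.of_forall hDM') (continuous_norm_V_sq p N n)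
  have hE := integrable_continuous_comp hDm (.of_forall hDM) (continuous_excess_right hF z)
  have hE' := integrable_continuous_comp hDm' (.of_forall hDM') (continuous_excess_right hF z)
  have hlower : (1 - (|p - 2| + 2) * d) * ∫ x in S, ‖V p (D x)‖ ^ 2 ≤
      ∫ x in S, ‖V p (D' x)‖ ^ 2 := by
    rw [← integral_const_mul]
    refine setIntegral_mono_on (hV.const_mul _) hV' hS fun x hx => ?_
    rw [norm_V_sq, norm_V_sq]
    refine one_sub_mul_vSq_le hp hd hd1 (norm_nonneg _) ?_
    linarith [hDD' x hx, norm_sub_norm_le (D x) (D' x), norm_sub_rev (D x) (D' x)]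
  have hupper : ∫ x in S, excess F z (D' x) ≤
      (∫ x in S, excess F z (D x)) + K * d * ∫ x in S, ‖V p (D x)‖ ^ 2 := by
    rw [← integral_const_mul, ← integral_add hE (hV.const_mul _)]
    refine setIntegral_mono_on hE' (hE.add (hV.const_mul _)) hS fun x hx => ?_
    rw [norm_V_sq]
    linarith [(abs_le.1 (hK d _ _ hd hd1.le (hDD' x hx))).2]
  have hlower_mul := mul_le_mul_of_nonneg_left hlower hc
  unfold ExcessBound at h ⊢
  linarith

end Perturbation

section GraphBound

variable {N n : ℕ} {p c K C δ s : ℝ} {F : Mat N n → ℝ} {z : Mat N n} {Ω : Set (Vec n)}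
  {x₁ : Vec n} {ρ : ℝ} {e : Vec n} {g : Vec n → ℝ} {φ : Vec n → Vec N}

lemma IsC1Graph.mapsTo_shear (hG : IsC1Graph Ω x₁ ρ e g) (hδ1 : δ ≤ 1)
    (hδ : ∀ x ∈ ball x₁ ρ, ‖fderiv ℝ g x - fderiv ℝ g x₁‖ ≤ δ) (hsρ : s ≤ ρ) :
    MapsTo (shear (taylorDefect g x₁) e) (ball x₁ s) (ball x₁ (2 * s)) := fun _ hx =>
  shear_mem_ball hG.norm_eq_one
    ((abs_taylorDefect_le (hG.contDiff.differentiable one_ne_zero) hδ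
      (ball_subset_ball hsρ hx)).trans (mul_le_of_le_one_left (norm_nonneg _) hδ1)) hx

lemma IsC1Graph.norm_grad_comp_shear_neg_sub_le (hG : IsC1Graph Ω x₁ ρ e g)
    (hδ : ∀ x ∈ ball x₁ ρ, ‖fderiv ℝ g x - fderiv ℝ g x₁‖ ≤ δ) (hC0 : 0 ≤ C)
    (hC : ∀ (ξ : Mat N n) (A : Vec n →L[ℝ] Vec n),
      ‖mulRight ξ A - ξ‖ ≤ C * ‖A - ContinuousLinearMap.id ℝ _‖ * ‖ξ‖)
    (hφ : Differentiable ℝ φ) {x : Vec n} (hx : shear (taylorDefect g x₁) e x ∈ ball x₁ ρ) :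
    ‖grad (φ ∘ shear (-taylorDefect g x₁) e) (shear (taylorDefect g x₁) e x) - grad φ x‖ ≤
      C * δ * ‖grad φ x‖ := by
  have hg := hG.contDiff.differentiable one_ne_zero
  rw [grad_comp_shear_neg ((contDiff_taylorDefect hG.contDiff).differentiable one_ne_zero)
    (taylorDefect_add_smul hg hG.invariant) hφ]
  refine (hC _ _).trans ?_
  gcongr
  rw [add_sub_cancel_left, ContinuousLinearMap.norm_smulRight_apply, hG.norm_eq_one, mul_one,
    fderiv_neg, norm_neg, fderiv_taylorDefect hg, norm_sub_rev]
  exact hδ _ hx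

/- Composition with the inverse shear turns `φ` into a test function on a half ball. -/
lemma IsC1Graph.excessBound_shear_image (hG : IsC1Graph Ω x₁ ρ e g) (hΩ : IsOpen Ω)
    (hx₁ : x₁ ∈ frontier Ω) (hδ1 : δ ≤ 1)
    (hδ : ∀ x ∈ ball x₁ ρ, ‖fderiv ℝ g x - fderiv ℝ g x₁‖ ≤ δ) (hsρ : s ≤ ρ)
    (hhalf : ∀ φ : Vec n → Vec N, IsC1TestFunction (ball x₁ (2 * s)) φ →
      ExcessBound p c F z (halfBallOfRadius x₁ (‖e - gradient g x₁‖⁻¹ • (e - gradient g x₁))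
        (2 * s)) (grad φ)) (hφ : IsC1TestFunction (ball x₁ s) φ) :
    ExcessBound p c F z (shear (taylorDefect g x₁) e '' (Ω ∩ ball x₁ s))
      (grad (φ ∘ shear (-taylorDefect g x₁) e)) := by
  have hh := contDiff_taylorDefect (x₁ := x₁) hG.contDiff
  have hinv := taylorDefect_add_smul (x₁ := x₁) (hG.contDiff.differentiable one_ne_zero)
    hG.invariant
  have hmaps := hG.mapsTo_shear hδ1 hδ hsρ
  have hside := hG.inner_shear_sub_normal_neg_iff hΩ hx₁
  refine (excessBound_iff_of_subset ?_ (isOpen_halfBallOfRadius _ _ _).measurableSet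
    fun y hy => ?_).2 (hhalf _ (hφ.comp_shear_neg hh hinv hmaps))
  · rintro _ ⟨x, hx, rfl⟩
    exact ⟨hmaps hx.2,
      (hside x).2 ((hG.mem_iff x (ball_subset_ball hsρ hx.2)).1 hx.1)⟩
  · refine grad_eq_zero_of_notMem_tsupport fun hyφ => hy.2 ?_
    obtain ⟨x, hx, rfl⟩ := tsupport_comp_shear_neg_subset
      (contDiff_shear hh e).continuous hinv hφ.hasCompactSupport hyφ
    have hxs := hφ.tsupport_subset hx
    exact ⟨x, ⟨(hG.mem_iff x (ball_subset_ball hsρ hxs)).2 ((hside x).1 hy.1.2), hxs⟩, rfl⟩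

lemma IsC1Graph.excessBound (hG : IsC1Graph Ω x₁ ρ e g) (hΩ : IsOpen Ω) (hx₁ : x₁ ∈ frontier Ω)
    (hp : 0 ≤ p) (hc : 0 ≤ c) (hF : Continuous F) (hδ1 : δ ≤ 1)
    (hδ : ∀ x ∈ ball x₁ ρ, ‖fderiv ℝ g x - fderiv ℝ g x₁‖ ≤ δ) (hs : 0 < s) (hsρ : 2 * s ≤ ρ)
    (hhalf : ∀ φ : Vec n → Vec N, IsC1TestFunction (ball x₁ (2 * s)) φ →
      ExcessBound p c F z (halfBallOfRadius x₁ (‖e - gradient g x₁‖⁻¹ • (e - gradient g x₁))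
        (2 * s)) (grad φ)) (hC0 : 0 ≤ C)
    (hC : ∀ (ξ : Mat N n) (A : Vec n →L[ℝ] Vec n),
      ‖mulRight ξ A - ξ‖ ≤ C * ‖A - ContinuousLinearMap.id ℝ _‖ * ‖ξ‖) (hCδ : C * δ < 1)
    (hK : ∀ (d : ℝ) (ξ η : Mat N n), 0 ≤ d → d ≤ 1 → ‖η - ξ‖ ≤ d * ‖ξ‖ →
      |excess F z η - excess F z ξ| ≤ K * d * vSq p ‖ξ‖) (hφ : IsC1TestFunction (ball x₁ s) φ) :
    ExcessBound p (c - (c * (|p - 2| + 2) + K) * (C * δ)) F z (Ω ∩ ball x₁ s) (grad φ) := by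
  have hδ0 : 0 ≤ δ := (norm_nonneg _).trans (hδ x₁ (mem_ball_self hG.radius_pos))
  have hsρ' : s ≤ ρ := by linarith
  have hh := contDiff_taylorDefect (x₁ := x₁) hG.contDiff
  have hinv := taylorDefect_add_smul (x₁ := x₁) (hG.contDiff.differentiable one_ne_zero)
    hG.invariant
  have hmaps := hG.mapsTo_shear hδ1 hδ hsρ'
  have hψ := hφ.comp_shear_neg hh hinv hmaps
  have hS : MeasurableSet (Ω ∩ ball x₁ s) := (hΩ.inter isOpen_ball).measurableSet
  have hbound := hG.excessBound_shear_image hΩ hx₁ hδ1 hδ hsρ' hhalf hφ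
  unfold ExcessBound at hbound
  simp only [setIntegral_shear_image (hh.differentiable one_ne_zero) hinv hS] at hbound
  obtain ⟨M, hM⟩ := hφ.exists_norm_grad_le
  obtain ⟨M', hM'⟩ := hψ.exists_norm_grad_le
  exact .of_norm_sub_le hp hc hF hS (isBounded_ball.subset inter_subset_right).measure_lt_top.ne
    hφ.continuous_grad.aestronglyMeasurable hM
    (hψ.continuous_grad.comp (contDiff_shear hh e).continuous).aestronglyMeasurable
    (fun x => hM' _) (by positivity) hCδ
    (fun x hx => hG.norm_grad_comp_shear_neg_sub_le hδ hC0 hC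
      (hφ.contDiff.differentiable one_ne_zero) (ball_subset_ball hsρ (hmaps hx.2))) hK hbound

end GraphBound

lemma IsC1Closure.contDiffOn {N n : ℕ} {U : Set (Vec n)} {φ : Vec n → Vec N}
    {Dφ : Vec n → Mat N n} (hU : IsOpen U) (h : IsC1Closure U φ Dφ) : ContDiffOn ℝ 1 φ U := by
  rw [show (1 : WithTop ℕ∞) = 0 + 1 from (zero_add 1).symm,
    contDiffOn_succ_iff_fderiv_of_isOpen hU, contDiffOn_zero]
  refine ⟨fun y hy => (h.differentiableAt y hy).differentiableWithinAt, by simp, ?_⟩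
  refine ((matEquiv N n).symm.continuous.comp_continuousOn
    (h.continuousOn_grad.mono subset_closure)).congr fun y hy => ?_
  rw [Function.comp_apply, ← h.grad_eq y hy, grad_eq_matEquiv,
    ContinuousLinearEquiv.symm_apply_apply]

lemma IsC1Closure.contDiffAt {N n : ℕ} {U : Set (Vec n)} {φ : Vec n → Vec N}
    {Dφ : Vec n → Mat N n} (hU : IsOpen U) (h : IsC1Closure U φ Dφ) {x : Vec n} (hx : x ∈ U) :
    ContDiffAt ℝ 1 φ x :=
  (h.contDiffOn hU).contDiffAt (hU.mem_nhds hx)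

section GraphTranslation

variable {n : ℕ} {Ω : Set (Vec n)} {x₁ e : Vec n} {ρ : ℝ} {g : Vec n → ℝ}

lemma IsC1Graph.inner_add_smul (hG : IsC1Graph Ω x₁ ρ e g) (x : Vec n) (t : ℝ) :
    inner ℝ e (x + t • e) = inner ℝ e x + t := by
  rw [inner_add_right, real_inner_smul_right, real_inner_self_eq_norm_sq, hG.norm_eq_one, one_pow,
    mul_one]

lemma IsC1Graph.sub_smul_mem_iff (hG : IsC1Graph Ω x₁ ρ e g) {x : Vec n} {t : ℝ}
    (hx : x - t • e ∈ ball x₁ ρ) : x - t • e ∈ Ω ↔ inner ℝ e x - g x < t := by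
  rw [hG.mem_iff _ hx, sub_eq_add_neg, ← neg_smul, hG.inner_add_smul, hG.invariant]
  constructor <;> intro h <;> linarith

lemma IsC1Graph.dist_sub_smul_self (hG : IsC1Graph Ω x₁ ρ e g) (x : Vec n) {t : ℝ} (ht : 0 ≤ t) :
    dist (x - t • e) x = t := by
  rw [dist_eq_norm, sub_sub_cancel_left, norm_neg, norm_smul, hG.norm_eq_one, mul_one,
    Real.norm_of_nonneg ht]

lemma IsC1Graph.sub_smul_mem (hG : IsC1Graph Ω x₁ ρ e g) {s t : ℝ} (ht : 0 < t) (hts : s + t ≤ ρ)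
    {x : Vec n} (hx : x ∈ Ω ∩ ball x₁ s) : x - t • e ∈ Ω := by
  have hxρ : x ∈ ball x₁ ρ := ball_subset_ball (by linarith) hx.2
  refine (hG.sub_smul_mem_iff (mem_ball.2 ?_)).2 ?_
  · linarith [dist_triangle (x - t • e) x x₁, hG.dist_sub_smul_self x ht.le, mem_ball.1 hx.2]
  · linarith [(hG.mem_iff x hxρ).1 hx.1]

variable {N : ℕ} {η : Vec n → Vec N} {Dη : Vec n → Mat N n} {a s t : ℝ}

/-- The translate of `η` by `t e`, cut off between the graph of `g` and its translate. Translation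
moves the set below the graph where `η` is regular past the graph, so that this is `C¹` on all of
`ℝⁿ`, and it approximates `η` below the graph as `t → 0⁺`. -/
def translateExtension (g : Vec n → ℝ) (e : Vec n) (η : Vec n → Vec N) (t : ℝ) (x : Vec n) :
    Vec N :=
  Real.smoothTransition (1 - 2 * ((inner ℝ e x - g x) / t)) • η (x - t • e)

lemma support_translateExtension_subset (hG : IsC1Graph Ω x₁ ρ e g) (ht : 0 < t)
    (hη : ∀ x ∉ closedBall x₁ a, η x = 0) :
    Function.support (translateExtension g e η t) ⊆ closedBall x₁ (a + t) := by
  intro x hx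
  have hxa : x - t • e ∈ closedBall x₁ a := by
    by_contra hxa
    exact hx (by rw [translateExtension, hη _ hxa, smul_zero])
  rw [mem_closedBall] at hxa ⊢
  linarith [dist_triangle x (x - t • e) x₁, dist_comm x (x - t • e),
    hG.dist_sub_smul_self x ht.le]

lemma translateExtension_eventuallyEq_zero_of_le (hg : Continuous g) {x : Vec n} (ht : 0 < t)
    (hx : t ≤ inner ℝ e x - g x) : translateExtension g e η t =ᶠ[𝓝 x] 0 := by
  have hhalf : 1 / 2 < (inner ℝ e x - g x) / t := by rw [lt_div_iff₀ ht]; linarith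
  have hcont : ContinuousAt (fun y => (inner ℝ e y - g y) / t) x := by fun_prop
  filter_upwards [hcont.eventually_const_lt hhalf] with y hy
  rw [translateExtension, Real.smoothTransition.zero_of_nonpos (by linarith), zero_smul,
    Pi.zero_apply]

lemma translateExtension_eventuallyEq_translate (hg : Continuous g) {x : Vec n} (ht : 0 < t)
    (hx : inner ℝ e x < g x) :
    translateExtension g e η t =ᶠ[𝓝 x] fun y => η (y - t • e) := by
  have hcont : ContinuousAt (fun y => inner ℝ e y - g y) x := by fun_prop
  filter_upwards [hcont.eventually_lt_const (sub_neg.2 hx)] with y hy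
  rw [translateExtension, Real.smoothTransition.one_of_one_le, one_smul]
  linarith [div_neg_of_neg_of_pos hy ht]

lemma contDiff_translateExtension (hG : IsC1Graph Ω x₁ ρ e g) (hΩ : IsOpen Ω) (haρ : a < ρ)
    (hη : IsC1Closure Ω η Dη) (hη₀ : ∀ x ∉ closedBall x₁ a, η x = 0) (ht : 0 < t) :
    ContDiff ℝ 1 (translateExtension g e η t) := by
  have hg := hG.contDiff
  refine contDiff_iff_contDiffAt.2 fun x => ?_
  by_cases hxa : x - t • e ∈ closedBall x₁ a
  · have hxρ : x - t • e ∈ ball x₁ ρ := closedBall_subset_ball haρ hxa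
    by_cases hxΩ : x - t • e ∈ Ω
    · have hcutoff : ContDiff ℝ 1 fun y => Real.smoothTransition
          (1 - 2 * ((inner ℝ e y - g y) / t)) := Real.smoothTransition.contDiff.comp <|
        contDiff_const.sub (contDiff_const.mul
          (((contDiff_const.inner ℝ contDiff_id).sub hg).div_const t))
      exact hcutoff.contDiffAt.smul
        ((hη.contDiffAt hΩ hxΩ).comp x (contDiffAt_id.sub contDiffAt_const))
    · rw [hG.sub_smul_mem_iff hxρ, not_lt] at hxΩ
      exact contDiffAt_const.congr_of_eventuallyEq
        (translateExtension_eventuallyEq_zero_of_le hg.continuous ht hxΩ)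
  · have hcont : ContinuousAt (fun y : Vec n => y - t • e) x := by fun_prop
    refine (contDiffAt_const (c := (0 : Vec N))).congr_of_eventuallyEq ?_
    filter_upwards [hcont.eventually (isClosed_closedBall.isOpen_compl.mem_nhds hxa)] with y hy
    rw [translateExtension, hη₀ _ hy, smul_zero]

lemma grad_translateExtension (hG : IsC1Graph Ω x₁ ρ e g) (hη : IsC1Closure Ω η Dη) (ht : 0 < t)
    (hts : s + t ≤ ρ) {x : Vec n} (hx : x ∈ Ω ∩ ball x₁ s) :
    grad (translateExtension g e η t) x = Dη (x - t • e) := by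
  have hxg := (hG.mem_iff x (ball_subset_ball (by linarith) hx.2)).1 hx.1
  rw [← hη.grad_eq _ (hG.sub_smul_mem ht hts hx), grad_eq_matEquiv, grad_eq_matEquiv,
    (translateExtension_eventuallyEq_translate hG.contDiff.continuous ht hxg).fderiv_eq,
    fderiv_comp_sub]

lemma tendsto_grad_translateExtension (hG : IsC1Graph Ω x₁ ρ e g) (hΩ : IsOpen Ω)
    (hη : IsC1Closure Ω η Dη) (hsρ : s < ρ) {x : Vec n} (hx : x ∈ Ω ∩ ball x₁ s) :
    Tendsto (fun t => grad (translateExtension g e η t) x) (𝓝[>] 0) (𝓝 (Dη x)) := by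
  have hDη : ContinuousAt Dη x :=
    (hη.continuousOn_grad.mono subset_closure).continuousAt (hΩ.mem_nhds hx.1)
  have htranslate : Tendsto (fun t : ℝ => x - t • e) (𝓝[>] 0) (𝓝 x) :=
    ((by fun_prop : Continuous fun t : ℝ => x - t • e).tendsto' 0 x (by simp)).mono_left
      nhdsWithin_le_nhds
  refine (hDη.tendsto.comp htranslate).congr' ?_
  filter_upwards [Ioo_mem_nhdsGT (sub_pos.2 hsρ)] with t ht
  exact (grad_translateExtension hG hη ht.1 (by linarith [ht.2]) hx).symm

lemma excessBound_of_isC1Closure {p c M : ℝ} {F : Mat N n → ℝ} {z : Mat N n} (hF : Continuous F)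
    (hΩ : IsOpen Ω) (hG : IsC1Graph Ω x₁ ρ e g) (has : a < s) (hsρ : s < ρ)
    (hgraph : ∀ φ : Vec n → Vec N, IsC1TestFunction (ball x₁ s) φ →
      ExcessBound p c F z (Ω ∩ ball x₁ s) (grad φ))
    (hη : IsC1Closure Ω η Dη) (hη₀ : ∀ x ∉ closedBall x₁ a, η x = 0) (hM : ∀ x ∈ Ω, ‖Dη x‖ ≤ M) :
    ExcessBound p c F z (Ω ∩ ball x₁ s) Dη := by
  have hmeas : MeasurableSet (Ω ∩ ball x₁ s) := (hΩ.inter isOpen_ball).measurableSet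
  have hC1 {t : ℝ} (ht : 0 < t) := contDiff_translateExtension hG hΩ (has.trans hsρ) hη hη₀ ht
  have hρ := Ioo_mem_nhdsGT (sub_pos.2 hsρ)
  refine ExcessBound.of_tendsto (l := 𝓝[>] (0 : ℝ)) (M := M)
    (Dk := fun t => grad (translateExtension g e η t)) hF
    (measure_ne_top_of_subset inter_subset_right measure_ball_lt_top.ne) ?_ ?_
    (ae_restrict_of_forall_mem hmeas fun x hx =>
      tendsto_grad_translateExtension hG hΩ hη hsρ hx) ?_
  · filter_upwards [hρ] with t ht using (continuous_grad (hC1 ht.1)).aestronglyMeasurable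
  · filter_upwards [hρ] with t ht
    have hts : s + t ≤ ρ := by linarith [ht.2]
    refine ae_restrict_of_forall_mem hmeas fun x hx => ?_
    rw [grad_translateExtension hG hη ht.1 hts hx]
    exact hM _ (hG.sub_smul_mem ht.1 hts hx)
  · filter_upwards [Ioo_mem_nhdsGT (sub_pos.2 has)] with t ht
    exact hgraph _ (isC1TestFunction_of_support_subset (isCompact_closedBall _ _)
      (closedBall_subset_ball (by linarith [ht.2])) (hC1 ht.1)
      (support_translateExtension_subset hG ht.1 hη₀))

end GraphTranslation

section LocalConnectedness

variable {n : ℕ} {Ω U : Set (Vec n)} {x : Vec n} {r : ℝ} {e : Vec n} {g : Vec n → ℝ}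

lemma IsC1Graph.exists_isPreconnected (hG : IsC1Graph Ω x r e g) {O : Set (Vec n)}
    (hO : O ∈ 𝓝 x) :
    ∃ W P : Set (Vec n), IsOpen W ∧ x ∈ W ∧ IsPreconnected P ∧ W ∩ Ω ⊆ P ∧ P ⊆ O ∩ Ω := by
  have hshear : Continuous (shear g e) := (contDiff_shear hG.contDiff e).continuous
  have hshear_neg : Continuous (shear (-g) e) := (contDiff_shear hG.contDiff.neg e).continuous
  have hshear_shear (y : Vec n) : shear g e (shear (-g) e y) = y := shear_shear_neg hG.invariant y
  have hpre : shear g e ⁻¹' (O ∩ ball x r) ∈ 𝓝 (shear (-g) e x) := by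
    refine hshear.continuousAt.preimage_mem_nhds ?_
    rw [hshear_shear]
    exact inter_mem hO (ball_mem_nhds _ hG.radius_pos)
  obtain ⟨σ, hσ, hσsub⟩ := Metric.mem_nhds_iff.1 hpre
  have hhalf : Convex ℝ {y : Vec n | inner ℝ e y < 0} :=
    convex_halfSpace_lt (innerSL ℝ e).isLinear 0
  refine ⟨shear (-g) e ⁻¹' ball (shear (-g) e x) σ,
    shear g e '' (ball (shear (-g) e x) σ ∩ {y | inner ℝ e y < 0}), isOpen_ball.preimage hshear_neg,
    mem_preimage.2 (mem_ball_self hσ),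
    ((convex_ball _ _).inter hhalf).isPreconnected.image _ hshear.continuousOn, ?_, ?_⟩
  · rintro y ⟨hy, hyΩ⟩
    have hyr : y ∈ ball x r := by simpa only [hshear_shear] using (hσsub hy).2
    refine ⟨shear (-g) e y, ⟨hy, ?_⟩, hshear_shear y⟩
    change inner ℝ e (y + (-g y) • e) < 0
    rw [hG.inner_add_smul]
    linarith [(hG.mem_iff y hyr).1 hyΩ]
  · rintro _ ⟨y, ⟨hy, hy₀⟩, rfl⟩
    refine ⟨(hσsub hy).1, (hG.mem_iff _ (hσsub hy).2).2 ?_⟩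
    rw [shear, hG.inner_add_smul, hG.invariant]
    exact add_lt_of_neg_left _ hy₀

lemma IsC1Graph.closure_mem_nhdsWithin (hG : IsC1Graph Ω x r e g) (hU : IsOpen U) (hUΩ : U ⊆ Ω)
    (hxU : x ∈ closure U) (hx : x ∉ closure (frontier U ∩ Ω)) : closure U ∈ 𝓝[closure Ω] x := by
  obtain ⟨W, P, hW, hxW, hP, hWP, hPO⟩ := hG.exists_isPreconnected
    (isClosed_closure.isOpen_compl.mem_nhds hx)
  have hPU : P ⊆ U := by
    refine hP.subset_of_closure_inter_subset hU ?_ ?_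
    · obtain ⟨y, hyW, hyU⟩ := mem_closure_iff.1 hxU W hW hxW
      exact ⟨y, hWP ⟨hyW, hUΩ hyU⟩, hyU⟩
    · rintro y ⟨hyU, hyP⟩
      by_contra hyU'
      exact (hPO hyP).1 (subset_closure ⟨hU.frontier_eq ▸ ⟨hyU, hyU'⟩, (hPO hyP).2⟩)
  exact mem_nhdsWithin.2
    ⟨W, hW, hxW, hW.inter_closure.trans (closure_mono (hWP.trans hPU))⟩

end LocalConnectedness

/-! ### Truncation and extension by zero -/

section SmoothTruncation

/-- A `C¹` map `ℝᴺ → ℝᴺ` that vanishes on the unit ball and is the identity outside the ball of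
radius `2`. -/
def smoothTruncation (N : ℕ) (v : Vec N) : Vec N :=
  (1 - (⟨1, 2, one_pos, one_lt_two⟩ : ContDiffBump (0 : Vec N)) v) • v

variable {N : ℕ} {v : Vec N}

lemma contDiff_smoothTruncation (N : ℕ) : ContDiff ℝ 1 (smoothTruncation N) :=
  (contDiff_const.sub (ContDiffBump.contDiff _)).smul contDiff_id

lemma continuous_fderiv_smoothTruncation (N : ℕ) : Continuous (fderiv ℝ (smoothTruncation N)) :=
  (contDiff_smoothTruncation N).continuous_fderiv one_ne_zero

lemma smoothTruncation_eq_zero (hv : ‖v‖ < 1) : smoothTruncation N v = 0 := by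
  rw [smoothTruncation, ContDiffBump.one_of_mem_closedBall _ (mem_closedBall_zero_iff.2 hv.le),
    sub_self, zero_smul]

lemma smoothTruncation_eq_self (hv : 2 < ‖v‖) : smoothTruncation N v = v := by
  rw [smoothTruncation, ContDiffBump.zero_of_le_dist _ ((dist_zero_right v).symm ▸ hv.le),
    sub_zero, one_smul]

lemma fderiv_smoothTruncation_eq_zero (hv : ‖v‖ < 1) : fderiv ℝ (smoothTruncation N) v = 0 := by
  have hzero : smoothTruncation N =ᶠ[𝓝 v] fun _ => 0 := by
    filter_upwards [continuous_norm.continuousAt.eventually_lt_const hv] with w hw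
      using smoothTruncation_eq_zero hw
  rw [hzero.fderiv_eq, fderiv_fun_const, Pi.zero_apply]

lemma fderiv_smoothTruncation_eq_id (hv : 2 < ‖v‖) :
    fderiv ℝ (smoothTruncation N) v = ContinuousLinearMap.id ℝ _ := by
  have hid : smoothTruncation N =ᶠ[𝓝 v] id := by
    filter_upwards [continuous_norm.continuousAt.eventually_const_lt hv] with w hw
      using smoothTruncation_eq_self hw
  rw [hid.fderiv_eq, fderiv_id]

lemma exists_norm_fderiv_smoothTruncation_le (N : ℕ) :
    ∃ K : ℝ, ∀ v, ‖fderiv ℝ (smoothTruncation N) v‖ ≤ K := by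
  obtain ⟨K, hK⟩ := (isCompact_closedBall (0 : Vec N) 2).exists_bound_of_continuousOn
    (continuous_fderiv_smoothTruncation N).continuousOn
  refine ⟨max K 1, fun v => ?_⟩
  rcases le_or_gt ‖v‖ 2 with hv | hv
  · exact (hK v (mem_closedBall_zero_iff.2 hv)).trans (le_max_left _ _)
  · rw [fderiv_smoothTruncation_eq_id hv]
    exact ContinuousLinearMap.norm_id_le.trans (le_max_right _ _)

end SmoothTruncation

section Trunc

variable {N n : ℕ} {U : Set (Vec n)} {ψ : Vec n → Vec N} {Dψ : Vec n → Mat N n} {δ : ℝ} {x : Vec n}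

/-- The truncation of `ψ` at level `δ`, extended by zero outside `closure U`. It vanishes near the
zeros of `ψ` in `closure U`. -/
def trunc (δ : ℝ) (U : Set (Vec n)) (ψ : Vec n → Vec N) : Vec n → Vec N :=
  (closure U).indicator fun x => δ • smoothTruncation N (δ⁻¹ • ψ x)

/-- The gradient of `trunc δ U ψ` when `ψ` has gradient `Dψ`. -/
def truncGrad (δ : ℝ) (U : Set (Vec n)) (ψ : Vec n → Vec N) (Dψ : Vec n → Mat N n) :
    Vec n → Mat N n :=
  (closure U).indicator fun x => matEquiv N n
    ((fderiv ℝ (smoothTruncation N) (δ⁻¹ • ψ x)).comp ((matEquiv N n).symm (Dψ x)))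

lemma trunc_of_notMem (hx : x ∉ closure U) : trunc δ U ψ x = 0 := indicator_of_notMem hx _

lemma truncGrad_of_notMem (hx : x ∉ closure U) : truncGrad δ U ψ Dψ x = 0 :=
  indicator_of_notMem hx _

lemma trunc_eq_zero_of_norm_lt (hx : ‖δ⁻¹ • ψ x‖ < 1) : trunc δ U ψ x = 0 :=
  indicator_apply_eq_zero.2 fun _ => by rw [smoothTruncation_eq_zero hx, smul_zero]

lemma truncGrad_eq_zero_of_norm_lt (hx : ‖δ⁻¹ • ψ x‖ < 1) : truncGrad δ U ψ Dψ x = 0 :=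
  indicator_apply_eq_zero.2 fun _ => by
    rw [fderiv_smoothTruncation_eq_zero hx, ContinuousLinearMap.zero_comp, map_zero]

lemma trunc_eq_zero (hx : x ∈ closure U → ψ x = 0) : trunc δ U ψ x = 0 := by
  by_cases hxU : x ∈ closure U
  · exact trunc_eq_zero_of_norm_lt (by simp [hx hxU])
  · exact trunc_of_notMem hxU

lemma eventually_trunc_eq_zero (hψ : ContinuousOn ψ (closure U)) (hx : x ∈ closure U → ψ x = 0) :
    ∀ᶠ y in 𝓝 x, trunc δ U ψ y = 0 ∧ truncGrad δ U ψ Dψ y = 0 := by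
  by_cases hxU : x ∈ closure U
  · have hsmall : ∀ᶠ y in 𝓝[closure U] x, ‖δ⁻¹ • ψ y‖ < 1 := by
      refine ((hψ x hxU).const_smul δ⁻¹).norm.eventually_lt continuousWithinAt_const ?_
      simp [hx hxU]
    filter_upwards [eventually_nhdsWithin_iff.1 hsmall] with y hy
    by_cases hyU : y ∈ closure U
    · exact ⟨trunc_eq_zero_of_norm_lt (hy hyU), truncGrad_eq_zero_of_norm_lt (hy hyU)⟩
    · exact ⟨trunc_of_notMem hyU, truncGrad_of_notMem hyU⟩
  · filter_upwards [isClosed_closure.isOpen_compl.mem_nhds hxU] with y hy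
      using ⟨trunc_of_notMem hy, truncGrad_of_notMem hy⟩

lemma continuousOn_trunc (hψ : ContinuousOn ψ (closure U)) :
    ContinuousOn (trunc δ U ψ) (closure U) :=
  (((contDiff_smoothTruncation N).continuous.comp_continuousOn
    (hψ.const_smul δ⁻¹)).const_smul δ).congr fun _ hx => indicator_of_mem hx _

lemma continuousOn_truncGrad (hψ : ContinuousOn ψ (closure U)) (hDψ : ContinuousOn Dψ (closure U)) :
    ContinuousOn (truncGrad δ U ψ Dψ) (closure U) :=
  ((matEquiv N n).continuous.comp_continuousOn
    (((continuous_fderiv_smoothTruncation N).comp_continuousOn (hψ.const_smul δ⁻¹)).clm_comp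
      ((matEquiv N n).symm.continuous.comp_continuousOn hDψ))).congr
    fun _ hx => indicator_of_mem hx _

lemma hasFDerivAt_trunc (hδ : δ ≠ 0) (hU : IsOpen U) (h : IsC1Closure U ψ Dψ) (hx : x ∈ U) :
    HasFDerivAt (trunc δ U ψ) ((matEquiv N n).symm (truncGrad δ U ψ Dψ x)) x := by
  have hψ : HasFDerivAt ψ ((matEquiv N n).symm (Dψ x)) x := by
    rw [← h.grad_eq x hx, grad_eq_matEquiv, ContinuousLinearEquiv.symm_apply_apply]
    exact (h.differentiableAt x hx).hasFDerivAt
  have hcomp := ((((contDiff_smoothTruncation N).differentiable one_ne_zero _).hasFDerivAt.comp x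
    (hψ.const_smul δ⁻¹)).const_smul δ).congr_of_eventuallyEq (f₁ := trunc δ U ψ) (by
      filter_upwards [hU.mem_nhds hx] with y hy using indicator_of_mem (subset_closure hy) _)
  rw [ContinuousLinearMap.comp_smul, smul_smul, mul_inv_cancel₀ hδ, one_smul] at hcomp
  rw [truncGrad, indicator_of_mem (subset_closure hx), ContinuousLinearEquiv.symm_apply_apply]
  exact hcomp

lemma exists_norm_truncGrad_le (hU : Bornology.IsBounded U) (hDψ : ContinuousOn Dψ (closure U)) :
    ∃ M : ℝ, ∀ (δ : ℝ) (x : Vec n), ‖truncGrad δ U ψ Dψ x‖ ≤ M := by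
  obtain ⟨K, hK⟩ := exists_norm_fderiv_smoothTruncation_le N
  obtain ⟨M, hM⟩ := hU.isCompact_closure.exists_bound_of_continuousOn
    ((matEquiv N n).symm.continuous.comp_continuousOn hDψ)
  have hK0 : 0 ≤ K := (norm_nonneg _).trans (hK 0)
  refine ⟨‖(matEquiv N n : (Vec n →L[ℝ] Vec N) →L[ℝ] Mat N n)‖ * (K * |M|), fun δ x => ?_⟩
  by_cases hx : x ∈ closure U
  · rw [truncGrad, indicator_of_mem hx]
    refine (matEquiv N n : (Vec n →L[ℝ] Vec N) →L[ℝ] Mat N n).le_opNorm_of_le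
      ((ContinuousLinearMap.opNorm_comp_le _ _).trans ?_)
    gcongr
    · exact hK _
    · exact (hM x hx).trans (le_abs_self M)
  · rw [truncGrad_of_notMem hx, norm_zero]
    positivity

end Trunc

section TruncExtension

variable {N n : ℕ} {Ω U : Set (Vec n)} {ψ : Vec n → Vec N} {Dψ : Vec n → Mat N n} {δ : ℝ}
  {x : Vec n}

/-- The boundary of `Ω` is of class `C¹`. -/
def HasC1Boundary (Ω : Set (Vec n)) : Prop :=
  ∀ x₀ ∈ frontier Ω, ∃ (r : ℝ) (e : Vec n) (g : Vec n → ℝ), IsC1Graph Ω x₀ r e g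

lemma eq_zero_of_mem_closure {A : Set (Vec n)} (hψ : ContinuousOn ψ (closure U))
    (hA : A ⊆ closure U) (hψA : ∀ x ∈ A, ψ x = 0) (hx : x ∈ closure A) : ψ x = 0 :=
  closure_minimal (image_subset_iff.2 hψA : ψ '' A ⊆ {0}) isClosed_singleton
    (((hψ x (closure_minimal hA isClosed_closure hx)).mono hA).mem_closure_image hx)

lemma mem_of_ne_zero (hU : IsOpen U) (hψ₀ : ∀ x ∈ frontier U ∩ Ω, ψ x = 0) (hxU : x ∈ closure U)
    (hxΩ : x ∈ Ω) (hψx : ψ x ≠ 0) : x ∈ U := by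
  by_contra hx
  exact hψx (hψ₀ x ⟨hU.frontier_eq ▸ ⟨hxU, hx⟩, hxΩ⟩)

lemma closure_mem_nhdsWithin_of_ne_zero (hΩ : IsOpen Ω) (hΩC1 : HasC1Boundary Ω) (hU : IsOpen U)
    (hUΩ : U ⊆ Ω) (hψ : ContinuousOn ψ (closure U)) (hψ₀ : ∀ x ∈ frontier U ∩ Ω, ψ x = 0)
    (hxU : x ∈ closure U) (hψx : ψ x ≠ 0) : closure U ∈ 𝓝[closure Ω] x := by
  by_cases hxΩ : x ∈ Ω
  · exact mem_nhdsWithin_of_mem_nhds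
      (mem_of_superset (hU.mem_nhds (mem_of_ne_zero hU hψ₀ hxU hxΩ hψx)) subset_closure)
  · obtain ⟨r, e, g, hG⟩ := hΩC1 x (hΩ.frontier_eq ▸ ⟨closure_mono hUΩ hxU, hxΩ⟩)
    exact hG.closure_mem_nhdsWithin hU hUΩ hxU fun hx =>
      hψx (eq_zero_of_mem_closure hψ (fun y hy => frontier_subset_closure hy.1) hψ₀ hx)

/- Truncation makes `ψ` vanish near its zeros, in particular near `∂U ∩ Ω`; elsewhere, local
connectedness of the domain at its boundary makes `closure U` a neighbourhood in `closure Ω`. -/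
lemma isC1Closure_trunc (hΩ : IsOpen Ω) (hΩC1 : HasC1Boundary Ω) (hδ : δ ≠ 0) (hU : IsOpen U)
    (hUΩ : U ⊆ Ω) (h : IsC1Closure U ψ Dψ) (hψ₀ : ∀ x ∈ frontier U ∩ Ω, ψ x = 0) :
    IsC1Closure Ω (trunc δ U ψ) (truncGrad δ U ψ Dψ) := by
  have hcases (x : Vec n) : (x ∈ closure U ∧ ψ x ≠ 0) ∨
      (trunc δ U ψ =ᶠ[𝓝 x] fun _ => 0) ∧ truncGrad δ U ψ Dψ =ᶠ[𝓝 x] fun _ => 0 := by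
    refine or_iff_not_imp_left.2 fun hx => eventually_and.1 ?_
    exact eventually_trunc_eq_zero h.continuousOn fun hxU => not_not.1 fun hψx => hx ⟨hxU, hψx⟩
  have hnhds {x : Vec n} (hx : x ∈ closure U ∧ ψ x ≠ 0) : closure U ∈ 𝓝[closure Ω] x :=
    closure_mem_nhdsWithin_of_ne_zero hΩ hΩC1 hU hUΩ h.continuousOn hψ₀ hx.1 hx.2
  have hderiv {x : Vec n} (hxΩ : x ∈ Ω) (hx : x ∈ closure U ∧ ψ x ≠ 0) :=
    hasFDerivAt_trunc hδ hU h (mem_of_ne_zero hU hψ₀ hx.1 hxΩ hx.2)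
  refine ⟨fun x _ => ?_, fun x hxΩ => ?_, fun x hxΩ => ?_, fun x _ => ?_⟩ <;>
    rcases hcases x with hx | ⟨htrunc, hgrad⟩
  · exact (continuousOn_trunc h.continuousOn x hx.1).mono_of_mem_nhdsWithin (hnhds hx)
  · exact (continuousAt_const.congr htrunc.symm).continuousWithinAt
  · exact (hderiv hxΩ hx).differentiableAt
  · exact (differentiableAt_const _).congr_of_eventuallyEq htrunc
  · rw [grad_eq_matEquiv, (hderiv hxΩ hx).fderiv, ContinuousLinearEquiv.apply_symm_apply]
  · rw [hgrad.self_of_nhds, grad_eq_matEquiv, htrunc.fderiv_eq, fderiv_fun_const, Pi.zero_apply,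
      map_zero]
  · exact (continuousOn_truncGrad h.continuousOn h.continuousOn_grad x
      hx.1).mono_of_mem_nhdsWithin (hnhds hx)
  · exact (continuousAt_const.congr hgrad.symm).continuousWithinAt

end TruncExtension

section C1Closure

variable {N n : ℕ} {Ω ΓD : Set (Vec n)} {φ : Vec n → Vec N} {Dφ : Vec n → Mat N n}

lemma memLp_of_continuousOn_closure {E : Type*} [NormedAddCommGroup E] {f : Vec n → E}
    (hΩ : IsOpen Ω) (hb : Bornology.IsBounded Ω) (hf : ContinuousOn f (closure Ω)) (q : ENNReal) :
    MemLp f q (volume.restrict Ω) := by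
  have : IsFiniteMeasure (volume.restrict Ω) := isFiniteMeasure_restrict.2 hb.measure_lt_top.ne
  obtain ⟨M, hM⟩ := hb.isCompact_closure.exists_bound_of_continuousOn hf
  refine MemLp.of_bound ((hf.mono subset_closure).aestronglyMeasurable hΩ.measurableSet) M ?_
  filter_upwards [ae_restrict_mem hΩ.measurableSet] with x hx using hM x (subset_closure hx)

lemma IsC1Closure.isSobolev (hΩ : IsOpen Ω) (hb : Bornology.IsBounded Ω)
    (h : IsC1Closure Ω φ Dφ) (q : ENNReal) : IsSobolev Ω q φ Dφ where
  memLp := memLp_of_continuousOn_closure hΩ hb h.continuousOn q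
  memLp_grad := memLp_of_continuousOn_closure hΩ hb h.continuousOn_grad q
  weak_grad := fun _ => setIntegral_mul_fderiv_eq_neg_of_grad_eq hΩ h.differentiableAt h.grad_eq
    (h.continuousOn_grad.mono subset_closure)

lemma IsC1Closure.isVariation (hΩ : IsOpen Ω) (hb : Bornology.IsBounded Ω)
    (h : IsC1Closure Ω φ Dφ) (hφ : ∀ x ∈ ΓD, φ x = 0) (p : ℝ) : IsVariation Ω ΓD p Ω φ Dφ where
  isSobolev := h.isSobolev hΩ hb _
  approx := fun ε hε => by
    refine ⟨φ, Dφ, h, ?_, by simpa [sobolevDist] using hε⟩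
    rintro x (hx | hx)
    · exact hφ x hx.1
    · exact absurd hx.2 (hΩ.frontier_eq ▸ hx.1).2

lemma IsExtremal.setIntegral_fderiv_eq_zero {p : ℝ} {F : Mat N n → ℝ} {u : Vec n → Vec N}
    {Du : Vec n → Mat N n} (hext : IsExtremal p F Ω ΓD u Du) (h : IsVariation Ω ΓD p Ω φ Dφ) :
    ∫ x in Ω, fderiv ℝ F (Du x) (Dφ x) = 0 := by
  simpa only [inner_gradient_left] using hext.euler_lagrange φ Dφ h

end C1Closure

section UniformGraph

variable {n : ℕ} {Ω : Set (Vec n)} {x₁ e : Vec n} {r δ : ℝ} {g : Vec n → ℝ}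

lemma IsC1Graph.of_ball_subset (hG : IsC1Graph Ω x₁ r e g) {x : Vec n} {ρ : ℝ} (hρ : 0 < ρ)
    (h : ball x ρ ⊆ ball x₁ r) : IsC1Graph Ω x ρ e g :=
  { hG with radius_pos := hρ, mem_iff := fun y hy => hG.mem_iff y (h hy) }

lemma IsC1Graph.exists_norm_fderiv_sub_le (hG : IsC1Graph Ω x₁ r e g) (hδ : 0 < δ) :
    ∃ ρ, 0 < ρ ∧ ρ ≤ r ∧
      ∀ y ∈ ball x₁ ρ, ∀ y' ∈ ball x₁ ρ, ‖fderiv ℝ g y - fderiv ℝ g y'‖ ≤ δ := by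
  have hcont : ContinuousAt (fderiv ℝ g) x₁ :=
    (hG.contDiff.continuous_fderiv one_ne_zero).continuousAt
  obtain ⟨ρ, hρ, hball⟩ := Metric.continuousAt_iff.1 hcont (δ / 2) (half_pos hδ)
  refine ⟨min ρ r, lt_min hρ hG.radius_pos, min_le_right _ _, fun y hy y' hy' => ?_⟩
  have hy₁ := hball (ball_subset_ball (min_le_left _ _) hy)
  have hy₂ := hball (ball_subset_ball (min_le_left _ _) hy')
  rw [← dist_eq_norm]
  linarith [dist_triangle_right (fderiv ℝ g y) (fderiv ℝ g y') (fderiv ℝ g x₁)]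

lemma HasC1Boundary.exists_uniform_graph (hb : Bornology.IsBounded Ω) (hΩC1 : HasC1Boundary Ω)
    (hδ : 0 < δ) : ∃ ρ : ℝ, 0 < ρ ∧ ∀ x₁ ∈ frontier Ω, ∃ (e : Vec n) (g : Vec n → ℝ),
      IsC1Graph Ω x₁ ρ e g ∧ ∀ x ∈ ball x₁ ρ, ‖fderiv ℝ g x - fderiv ℝ g x₁‖ ≤ δ := by
  choose! r e g hG using hΩC1
  choose! ρ hρ₀ hρr hosc using fun x hx => (hG x hx).exists_norm_fderiv_sub_le hδ
  have hcompact : IsCompact (frontier Ω) :=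
    hb.isCompact_closure.of_isClosed_subset isClosed_frontier frontier_subset_closure
  obtain ⟨σ, hσ, hball⟩ := lebesgue_number_lemma_of_metric
    (c := fun x : frontier Ω => ball x.1 (ρ x)) hcompact (fun _ => isOpen_ball)
    fun x hx => mem_iUnion.2 ⟨⟨x, hx⟩, mem_ball_self (hρ₀ x hx)⟩
  refine ⟨σ, hσ, fun x₁ hx₁ => ?_⟩
  obtain ⟨⟨x, hx⟩, hsub⟩ := hball x₁ hx₁
  exact ⟨e x, g x, (hG x hx).of_ball_subset hσ (hsub.trans (ball_subset_ball (hρr x hx))),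
    fun y hy => hosc x hx y (hsub hy) x₁ (hsub (mem_ball_self hσ))⟩

end UniformGraph

section TruncLimit

lemma ae_restrict_fderiv_eq_zero {E : Type*} [NormedAddCommGroup E] [NormedSpace ℝ E]
    [FiniteDimensional ℝ E] [MeasurableSpace E] [BorelSpace E] (μ : Measure E)
    [μ.IsAddHaarMeasure] {f : E → ℝ} {f' : E → E →L[ℝ] ℝ} {S : Set E} (hS : MeasurableSet S)
    (hf : ∀ x ∈ S, HasFDerivAt f (f' x) x) (hf₀ : ∀ x ∈ S, f x = 0) :
    ∀ᵐ x ∂μ.restrict S, f' x = 0 := by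
  rcases subsingleton_or_nontrivial E with _ | _
  · exact Eventually.of_forall fun x => Subsingleton.elim _ _
  obtain ⟨v, hv⟩ := exists_norm_eq E (zero_le_one (α := ℝ))
  -- The library's a.e. bound concerns maps `E → E`, hence the detour through `f • v`.
  have happrox : ApproximatesLinearOn (fun x => f x • v) (0 : E →L[ℝ] E) S 0 := by
    intro x hx y hy
    simp [hf₀ x hx, hf₀ y hy]
  have hle := happrox.norm_fderiv_sub_le μ hS (fun x => (f' x).smulRight v) fun x hx =>
    ((hf x hx).smul_const v).hasFDerivWithinAt
  filter_upwards [hle] with x hx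
  rwa [sub_zero, nonpos_iff_eq_zero, nnnorm_eq_zero, ← norm_eq_zero,
    ContinuousLinearMap.norm_smulRight_apply, hv, mul_one, norm_eq_zero] at hx

variable {N n : ℕ} {U : Set (Vec n)} {ψ : Vec n → Vec N} {Dψ : Vec n → Mat N n}

lemma IsC1Closure.ae_grad_eq_zero (hU : IsOpen U) (h : IsC1Closure U ψ Dψ) :
    ∀ᵐ x ∂volume.restrict U, ψ x = 0 → Dψ x = 0 := by
  have hS : MeasurableSet (U ∩ ψ ⁻¹' {0}) := by
    have hclosed := h.continuousOn.preimage_isClosed_of_isClosed isClosed_closure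
      (isClosed_singleton (x := (0 : Vec N)))
    have := hU.measurableSet.inter hclosed.measurableSet
    rwa [← inter_assoc, inter_eq_left.2 subset_closure] at this
  have hcoord (i : Fin N) : ∀ᵐ x ∂volume.restrict (U ∩ ψ ⁻¹' {0}),
      (EuclideanSpace.proj i : Vec N →L[ℝ] ℝ).comp (fderiv ℝ ψ x) = 0 :=
    ae_restrict_fderiv_eq_zero (f := fun x => ψ x i) volume hS
      (fun x hx => (EuclideanSpace.proj i : Vec N →L[ℝ] ℝ).hasFDerivAt.comp x
        (h.differentiableAt x hx.1).hasFDerivAt)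
      (fun x hx => by rw [show ψ x = 0 from hx.2, PiLp.zero_apply])
  rw [ae_restrict_iff' hU.measurableSet]
  filter_upwards [(ae_restrict_iff' hS).1 (ae_all_iff.2 hcoord)] with x hx hxU hψx
  rw [← h.grad_eq x hxU]
  ext ⟨i, j⟩
  exact DFunLike.congr_fun (hx ⟨hxU, hψx⟩ i) (EuclideanSpace.single j 1)

lemma ae_tendsto_truncGrad (hU : IsOpen U) (h : IsC1Closure U ψ Dψ) :
    ∀ᵐ x ∂volume.restrict U, Tendsto (fun δ => truncGrad δ U ψ Dψ x) (𝓝[>] 0) (𝓝 (Dψ x)) := by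
  filter_upwards [h.ae_grad_eq_zero hU, ae_restrict_mem hU.measurableSet] with x hx hxU
  have hxU' := subset_closure hxU
  by_cases hψ : ψ x = 0
  · simp [truncGrad, indicator_of_mem hxU', hx hψ]
  · refine tendsto_const_nhds.congr' ?_
    filter_upwards [Ioo_mem_nhdsGT (half_pos (norm_pos_iff.2 hψ))] with δ hδ
    have hlarge : 2 < ‖δ⁻¹ • ψ x‖ := by
      rw [norm_smul, norm_inv, Real.norm_of_nonneg hδ.1.le, lt_inv_mul_iff₀ hδ.1]
      linarith [hδ.2]
    rw [truncGrad, indicator_of_mem hxU', fderiv_smoothTruncation_eq_id hlarge,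
      ContinuousLinearMap.id_comp, ContinuousLinearEquiv.apply_symm_apply]

end TruncLimit

/-! ### Continuity of functionals of growth `p` -/

section GrowthContinuity

variable {α E : Type*} [MeasurableSpace α] {μ : Measure α} [NormedAddCommGroup E] {p C : ℝ}
  {H : α → E → ℝ} {D : α → E}

lemma eLpNorm_ofReal_eq_lintegral (hp : 0 < p) {G : Type*} [NormedAddCommGroup G] (f : α → G) :
    eLpNorm f (ENNReal.ofReal p) μ = (∫⁻ x, ‖f x‖ₑ ^ p ∂μ) ^ (1 / p) := by
  rw [eLpNorm_eq_lintegral_rpow_enorm_toReal (ENNReal.ofReal_pos.2 hp).ne' ENNReal.ofReal_ne_top,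
    ENNReal.toReal_ofReal hp.le]

lemma lintegral_enorm_sub_le (hp : 1 < p) {D' : α → E}
    (hH : ∀ᵐ x ∂μ, ∀ ξ η, |H x ξ - H x η| ≤ C * (1 + ‖ξ‖ + ‖η‖) ^ (p - 1) * ‖ξ - η‖)
    (hD : AEStronglyMeasurable D μ) (hD' : AEStronglyMeasurable D' μ) :
    ∫⁻ x, ‖H x (D x) - H x (D' x)‖ₑ ∂μ ≤
      ENNReal.ofReal C * (eLpNorm (D - D') (ENNReal.ofReal p) μ *
        eLpNorm (fun x => 1 + ‖D x‖ + ‖D' x‖) (ENNReal.ofReal p) μ ^ (p - 1)) := by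
  have hp₀ : 0 < p := one_pos.trans hp
  set b : α → ℝ := fun x => 1 + ‖D x‖ + ‖D' x‖
  have hb₀ (x : α) : 0 ≤ b x := by positivity
  have hb : AEStronglyMeasurable b μ := (aestronglyMeasurable_const.add hD.norm).add hD'.norm
  have hpointwise : ∀ᵐ x ∂μ, ‖H x (D x) - H x (D' x)‖ₑ ≤
      ENNReal.ofReal C * (‖(D - D') x‖ₑ * ‖b x‖ₑ ^ (p - 1)) := by
    filter_upwards [hH] with x hx
    rw [Real.enorm_eq_ofReal_abs, Real.enorm_of_nonneg (hb₀ x), ← ofReal_norm,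
      ENNReal.ofReal_rpow_of_nonneg (hb₀ x) (sub_pos.2 hp).le,
      ← ENNReal.ofReal_mul (norm_nonneg _), ← ENNReal.ofReal_mul' (by positivity)]
    exact ENNReal.ofReal_le_ofReal ((hx _ _).trans_eq (by simp only [b, Pi.sub_apply]; ring))
  calc ∫⁻ x, ‖H x (D x) - H x (D' x)‖ₑ ∂μ
      ≤ ENNReal.ofReal C * ∫⁻ x, ‖(D - D') x‖ₑ * ‖b x‖ₑ ^ (p - 1) ∂μ :=
        (lintegral_mono_ae hpointwise).trans_eq (lintegral_const_mul' _ _ ENNReal.ofReal_ne_top)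
    _ ≤ _ := by
        gcongr
        have hholder := ENNReal.lintegral_mul_rpow_le_lintegral_rpow_mul_lintegral_rpow
          (Real.HolderConjugate.conjExponent hp) (hD.sub hD').enorm hb.enorm
        refine hholder.trans_eq ?_
        rw [eLpNorm_ofReal_eq_lintegral hp₀, eLpNorm_ofReal_eq_lintegral hp₀, ← ENNReal.rpow_mul,
          Real.conjExponent, one_div_div, one_div_mul_eq_div]

variable [IsFiniteMeasure μ]

lemma memLp_one_add_norm_add_norm {D' : α → E} (hD : MemLp D (ENNReal.ofReal p) μ)
    (hD' : MemLp D' (ENNReal.ofReal p) μ) :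
    MemLp (fun x => 1 + ‖D x‖ + ‖D' x‖) (ENNReal.ofReal p) μ := by
  have hone : MemLp (fun _ => (1 : ℝ)) (ENNReal.ofReal p) μ := memLp_const 1
  exact (hone.add hD.norm).add hD'.norm

lemma integrable_comp_of_memLp (hp : 1 < p)
    (hH : ∀ᵐ x ∂μ, ∀ ξ η, |H x ξ - H x η| ≤ C * (1 + ‖ξ‖ + ‖η‖) ^ (p - 1) * ‖ξ - η‖)
    (hH₀ : Integrable (fun x => H x 0) μ) (hD : MemLp D (ENNReal.ofReal p) μ)
    (hm : AEStronglyMeasurable (fun x => H x (D x)) μ) : Integrable (fun x => H x (D x)) μ := by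
  have hD₀ : MemLp (0 : α → E) (ENNReal.ofReal p) μ := MemLp.zero
  have hsub : Integrable (fun x => H x (D x) - H x 0) μ := by
    refine ⟨hm.sub hH₀.aestronglyMeasurable, (lintegral_enorm_sub_le hp hH
      hD.aestronglyMeasurable hD₀.aestronglyMeasurable).trans_lt ?_⟩
    exact ENNReal.mul_lt_top ENNReal.ofReal_lt_top (ENNReal.mul_lt_top (hD.sub hD₀).eLpNorm_lt_top
      (ENNReal.rpow_lt_top_of_nonneg (sub_pos.2 hp).le
        (memLp_one_add_norm_add_norm hD hD₀).eLpNorm_ne_top))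
  exact (hsub.add hH₀).congr (.of_forall fun x => sub_add_cancel _ _)

lemma tendsto_integral_of_tendsto_eLpNorm_sub (hp : 1 < p)
    (hH : ∀ᵐ x ∂μ, ∀ ξ η, |H x ξ - H x η| ≤ C * (1 + ‖ξ‖ + ‖η‖) ^ (p - 1) * ‖ξ - η‖)
    (hH₀ : Integrable (fun x => H x 0) μ)
    (hm : ∀ D : α → E, AEStronglyMeasurable D μ → AEStronglyMeasurable (fun x => H x (D x)) μ)
    {ι : Type*} {l : Filter ι} {Dk : ι → α → E} (hD : MemLp D (ENNReal.ofReal p) μ)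
    (hDk : ∀ k, MemLp (Dk k) (ENNReal.ofReal p) μ)
    (hlim : Tendsto (fun k => eLpNorm (Dk k - D) (ENNReal.ofReal p) μ) l (𝓝 0)) :
    Tendsto (fun k => ∫ x, H x (Dk k x) ∂μ) l (𝓝 (∫ x, H x (D x) ∂μ)) := by
  set P := ENNReal.ofReal p
  have hP : 1 ≤ P := ENNReal.one_le_ofReal.2 hp.le
  set A := eLpNorm (fun x => 1 + ‖D x‖ + ‖D x‖) P μ
  have hA : A ≠ ⊤ := (memLp_one_add_norm_add_norm hD hD).eLpNorm_ne_top
  have hbound (k : ι) : eLpNorm (fun x => 1 + ‖Dk k x‖ + ‖D x‖) P μ ≤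
      A + eLpNorm (Dk k - D) P μ := by
    refine (eLpNorm_mono_real
      (g := fun x => (1 + ‖D x‖ + ‖D x‖) + ‖(Dk k - D) x‖) fun x => ?_).trans
      ((eLpNorm_add_le (memLp_one_add_norm_add_norm hD hD).aestronglyMeasurable
        ((hDk k).sub hD).norm.aestronglyMeasurable hP).trans_eq (by rw [eLpNorm_norm]))
    rw [Real.norm_of_nonneg (by positivity), Pi.sub_apply]
    linarith [norm_le_norm_add_norm_sub' (Dk k x) (D x)]
  have herror : Tendsto (fun k => ENNReal.ofReal C * (eLpNorm (Dk k - D) P μ *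
      (A + eLpNorm (Dk k - D) P μ) ^ (p - 1))) l (𝓝 0) := by
    have hpow : Tendsto (fun k => (A + eLpNorm (Dk k - D) P μ) ^ (p - 1)) l (𝓝 (A ^ (p - 1))) := by
      simpa only [add_zero] using (tendsto_const_nhds.add hlim).ennrpow_const (p - 1)
    simpa only [zero_mul, mul_zero] using ENNReal.Tendsto.const_mul
      (ENNReal.Tendsto.mul hlim (Or.inr (ENNReal.rpow_ne_top_of_nonneg (sub_pos.2 hp).le hA)) hpow
        (Or.inr ENNReal.zero_ne_top)) (Or.inr ENNReal.ofReal_ne_top)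
  refine tendsto_integral_of_L1 _ (hm D hD.aestronglyMeasurable)
    (Eventually.of_forall fun k => integrable_comp_of_memLp hp hH hH₀ (hDk k)
      (hm _ (hDk k).aestronglyMeasurable))
    (tendsto_of_tendsto_of_tendsto_of_le_of_le tendsto_const_nhds herror
      (fun _ => zero_le) fun k => ?_)
  refine (lintegral_enorm_sub_le hp hH (hDk k).aestronglyMeasurable hD.aestronglyMeasurable).trans
    ?_
  gcongr
  exact hbound k

end GrowthContinuity

/-! ### The inequality on small sets -/

section VariableBasePoint

variable {N n : ℕ} {p c c' ε M M' : ℝ} {F : Mat N n → ℝ} {z : Mat N n} {S : Set (Vec n)}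
  {D D' Du : Vec n → Mat N n}

lemma ExcessBound.mono (h : ExcessBound p c F z S D) (hc : c' ≤ c) : ExcessBound p c' F z S D :=
  (mul_le_mul_of_nonneg_right hc (integral_nonneg fun _ => by positivity)).trans h

lemma ExcessBound.congr (hS : MeasurableSet S) (h : ExcessBound p c F z S D)
    (hD : EqOn D D' S) : ExcessBound p c F z S D' := by
  have hV : ∫ x in S, ‖V p (D x)‖ ^ 2 = ∫ x in S, ‖V p (D' x)‖ ^ 2 :=
    setIntegral_congr_fun hS fun x hx => by simp only [hD hx]
  have hexcess : ∫ x in S, excess F z (D x) = ∫ x in S, excess F z (D' x) :=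
    setIntegral_congr_fun hS fun x hx => by simp only [hD hx]
  unfold ExcessBound at h ⊢
  rwa [← hV, ← hexcess]

lemma ExcessBound.le_integral_excess [IsFiniteMeasure (volume.restrict S)] (hF : ContDiff ℝ 1 F)
    (hS : MeasurableSet S) (h : ExcessBound p (c + ε) F z S D)
    (hDm : AEStronglyMeasurable D (volume.restrict S))
    (hDum : AEStronglyMeasurable Du (volume.restrict S)) (hM : ∀ x ∈ S, ‖D x‖ ≤ M)
    (hM' : ∀ x ∈ S, ‖Du x‖ ≤ M')
    (hz : ∀ x ∈ S, |excess F (Du x) (D x) - excess F z (D x)| ≤ ε * vSq p ‖D x‖) :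
    c * ∫ x in S, ‖V p (D x)‖ ^ 2 ≤ ∫ x in S, excess F (Du x) (D x) := by
  have hmem := ae_restrict_mem hS (μ := volume)
  have hV : Integrable (fun x => ‖V p (D x)‖ ^ 2) (volume.restrict S) :=
    integrable_continuous_comp hDm (hmem.mono hM) (continuous_norm_V_sq p N n)
  have hfrozen : Integrable (fun x => excess F z (D x)) (volume.restrict S) :=
    integrable_continuous_comp hDm (hmem.mono hM) (continuous_excess_right hF.continuous z)
  have hvariable : Integrable (fun x => excess F (Du x) (D x)) (volume.restrict S) :=
    integrable_continuous_comp (f := fun x => (Du x, D x)) (hDum.prodMk hDm)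
      (hmem.mono fun x hx => max_le_max (hM' x hx) (hM x hx)) (continuous_excess hF)
  have hle : ∫ x in S, excess F z (D x) ≤
      (∫ x in S, excess F (Du x) (D x)) + ε * ∫ x in S, ‖V p (D x)‖ ^ 2 := by
    rw [← integral_const_mul, ← integral_add hvariable (hV.const_mul _)]
    refine setIntegral_mono_on hfrozen (hvariable.add (hV.const_mul _)) hS fun x hx => ?_
    rw [norm_V_sq]
    linarith [(abs_le.1 (hz x hx)).1]
  unfold ExcessBound at h
  linarith

lemma integral_excess_eq [IsFiniteMeasure (volume.restrict S)] (hF : ContDiff ℝ 1 F)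
    (hS : MeasurableSet S) (hDm : AEStronglyMeasurable D (volume.restrict S))
    (hDum : AEStronglyMeasurable Du (volume.restrict S)) (hM : ∀ x ∈ S, ‖D x‖ ≤ M)
    (hM' : ∀ x ∈ S, ‖Du x‖ ≤ M') (hlinear : ∫ x in S, fderiv ℝ F (Du x) (D x) = 0) :
    ∫ x in S, excess F (Du x) (D x) = ∫ x in S, (F (Du x + D x) - F (Du x)) := by
  have hpair : ∀ᵐ x ∂volume.restrict S, ‖(Du x, D x)‖ ≤ max M' M :=
    (ae_restrict_mem hS).mono fun x hx => max_le_max (hM' x hx) (hM x hx)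
  have hFc := hF.continuous
  unfold excess
  rw [integral_sub, hlinear, sub_zero]
  · exact integrable_continuous_comp (H := fun q : Mat N n × Mat N n => F (q.1 + q.2) - F q.1)
      (hDum.prodMk hDm) hpair (by fun_prop)
  · exact integrable_continuous_comp (H := fun q : Mat N n × Mat N n => fderiv ℝ F q.1 q.2)
      (hDum.prodMk hDm) hpair
      (((hF.continuous_fderiv one_ne_zero).comp continuous_fst).clm_apply continuous_snd)

end VariableBasePoint

section TruncTestFunction

variable {N n : ℕ} {p c δ : ℝ} {F : Mat N n → ℝ} {Ω ΓD U W : Set (Vec n)}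
  {ψ : Vec n → Vec N} {Dψ : Vec n → Mat N n} {x x₀ : Vec n} {s : ℝ}

lemma truncGrad_eq_zero (hU : IsOpen U) (hψ : ContinuousOn ψ (closure U))
    (hψ₀ : ∀ x ∈ frontier U ∩ Ω, ψ x = 0) (hxΩ : x ∈ Ω) (hxU : x ∉ U) :
    truncGrad δ U ψ Dψ x = 0 :=
  (eventually_trunc_eq_zero hψ fun hx =>
    hψ₀ x ⟨hU.frontier_eq ▸ ⟨hx, hxU⟩, hxΩ⟩).self_of_nhds.2

lemma aestronglyMeasurable_truncGrad (hU : MeasurableSet U) (h : IsC1Closure U ψ Dψ) (δ : ℝ) :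
    AEStronglyMeasurable (truncGrad δ U ψ Dψ) (volume.restrict U) :=
  ((continuousOn_truncGrad h.continuousOn h.continuousOn_grad).mono
    subset_closure).aestronglyMeasurable hU

lemma isC1Closure_trunc_self (hδ : δ ≠ 0) (hU : IsOpen U) (h : IsC1Closure U ψ Dψ) :
    IsC1Closure U (trunc δ U ψ) (truncGrad δ U ψ Dψ) where
  continuousOn := continuousOn_trunc h.continuousOn
  differentiableAt _ hx := (hasFDerivAt_trunc hδ hU h hx).differentiableAt
  grad_eq x hx := by
    rw [grad_eq_matEquiv, (hasFDerivAt_trunc hδ hU h hx).fderiv,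
      ContinuousLinearEquiv.apply_symm_apply]
  continuousOn_grad := continuousOn_truncGrad h.continuousOn h.continuousOn_grad

lemma eventuallyEq_trunc_zero (hU : IsOpen U) (hψ : ContinuousOn ψ (closure U))
    (hψ₀ : ∀ x ∈ frontier U, ψ x = 0) (hx : x ∉ U) : trunc δ U ψ =ᶠ[𝓝 x] fun _ => 0 :=
  (eventually_trunc_eq_zero (Dψ := fun _ => 0) hψ fun hxU =>
    hψ₀ x (hU.frontier_eq ▸ ⟨hxU, hx⟩)).mono fun _ hy => hy.1

lemma isC1TestFunction_trunc (hδ : δ ≠ 0) (hU : IsOpen U) (hUb : Bornology.IsBounded U)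
    (hUW : closure U ⊆ W) (h : IsC1Closure U ψ Dψ) (hψ₀ : ∀ x ∈ frontier U, ψ x = 0) :
    IsC1TestFunction W (trunc δ U ψ) := by
  refine isC1TestFunction_of_support_subset hUb.isCompact_closure hUW
    (contDiff_iff_contDiffAt.2 fun x => ?_) support_indicator_subset
  by_cases hx : x ∈ U
  · exact (isC1Closure_trunc_self hδ hU h).contDiffAt hU hx
  · exact contDiffAt_const.congr_of_eventuallyEq
      (eventuallyEq_trunc_zero hU h.continuousOn hψ₀ hx)

lemma IsStronglyQuasiconvex.excessBound_truncGrad (hc : 0 ≤ c) (hF : ContDiff ℝ 1 F)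
    (hqc : IsStronglyQuasiconvex p c F) (z : Mat N n) (hδ : δ ≠ 0) (hU : IsOpen U)
    (hs : 0 < s) (hUs : closure U ⊆ ball x₀ s) (h : IsC1Closure U ψ Dψ)
    (hψ₀ : ∀ x ∈ frontier U, ψ x = 0) : ExcessBound p c F z U (truncGrad δ U ψ Dψ) := by
  have hball := hqc.excessBound_ball hc hF z x₀ hs (isC1TestFunction_trunc hδ hU
    (isBounded_ball.subset (subset_closure.trans hUs)) hUs h hψ₀)
  rw [← excessBound_iff_of_subset (subset_closure.trans hUs) measurableSet_ball fun x hx => by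
    rw [grad_eq_matEquiv, (eventuallyEq_trunc_zero hU h.continuousOn hψ₀ hx.2).fderiv_eq,
      fderiv_fun_const, Pi.zero_apply, map_zero]] at hball
  exact hball.congr hU.measurableSet (isC1Closure_trunc_self hδ hU h).grad_eq

lemma eq_zero_of_mem_frontier (hΩ : IsOpen Ω) (hΩC1 : HasC1Boundary Ω) (hΓD : ΓD ⊆ frontier Ω)
    (hU : IsOpen U) (hUΩ : U ⊆ Ω) (hψ : ContinuousOn ψ (closure U))
    (hψ₀ : ∀ x ∈ (ΓD ∩ closure U) ∪ (frontier U ∩ Ω), ψ x = 0)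
    (hUΓD : closure U ∩ frontier Ω ⊆ closure ΓD) (hx : x ∈ frontier U) : ψ x = 0 := by
  by_cases hxΩ : x ∈ Ω
  · exact hψ₀ x (.inr ⟨hx, hxΩ⟩)
  by_contra hne
  have hxU : x ∈ closure U := frontier_subset_closure hx
  have hxΓD : x ∈ closure ΓD := hUΓD ⟨hxU, hΩ.frontier_eq ▸ ⟨closure_mono hUΩ hxU, hxΩ⟩⟩
  have hnhds := closure_mem_nhdsWithin_of_ne_zero hΩ hΩC1 hU hUΩ hψ
    (fun y hy => hψ₀ y (.inr hy)) hxU hne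
  refine hne (eq_zero_of_mem_closure hψ inter_subset_right (fun y hy => hψ₀ y (.inl hy))
    (mem_closure_iff_frequently.2 ?_))
  refine ((mem_closure_iff_frequently.1 hxΓD).and_eventually
    (eventually_nhdsWithin_iff.1 hnhds)).mono fun y hy => ⟨hy.1, ?_⟩
  exact hy.2 (frontier_subset_closure (hΓD hy.1))

end TruncTestFunction

section SmallRadius

variable {N n : ℕ} {p c₂ ε M : ℝ} {F : Mat N n → ℝ} {Ω ΓD U : Set (Vec n)}
  {Du : Vec n → Mat N n}

lemma IsStronglyQuasiconvexAtFreeBoundary.exists_excessBound (hp : 1 ≤ p) (hc₂ : 0 ≤ c₂)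
    (hF : ContDiff ℝ 2 F) {C : ℝ} (hgrowth : HasGradGrowth p C F)
    (hqc : IsStronglyQuasiconvexAtFreeBoundary p c₂ F Ω ΓD Du) (hΩ : IsOpen Ω)
    (hb : Bornology.IsBounded Ω) (hΩC1 : HasC1Boundary Ω)
    (hM : ∀ x ∈ freeBoundary Ω ΓD, ‖Du x‖ ≤ M) (hε : 0 < ε) :
    ∃ ρ : ℝ, 0 < ρ ∧ ∀ x₁ ∈ freeBoundary Ω ΓD, ∀ (a s M' : ℝ) (η : Vec n → Vec N)
      (Dη : Vec n → Mat N n), a < s → 0 < s → 2 * s ≤ ρ → IsC1Closure Ω η Dη →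
      (∀ x ∉ closedBall x₁ a, η x = 0) → (∀ x ∈ Ω, ‖Dη x‖ ≤ M') →
      ExcessBound p (c₂ - ε) F (Du x₁) (Ω ∩ ball x₁ s) Dη := by
  obtain ⟨K, hK⟩ := exists_abs_excess_sub_excess_le hp hF hgrowth M
  obtain ⟨C', hC'0, hC'⟩ := exists_norm_mulRight_sub_le N n
  have hsmall : ∀ᶠ γ in 𝓝[>] (0 : ℝ),
      γ < 1 ∧ C' * γ < 1 ∧ (c₂ * (|p - 2| + 2) + K) * (C' * γ) < ε := by
    refine nhdsWithin_le_nhds ((eventually_lt_nhds one_pos).and (.and ?_ ?_)) <;>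
      refine Tendsto.eventually_lt_const ?_ (Continuous.tendsto (by fun_prop) 0) <;> simp [hε]
  obtain ⟨γ, ⟨hγ1, hγC', hγε⟩, hγ0⟩ := (hsmall.and self_mem_nhdsWithin).exists
  obtain ⟨ρ, hρ, hgraph⟩ := hΩC1.exists_uniform_graph hb hγ0
  refine ⟨ρ, hρ, fun x₁ hx₁ a s M' η Dη has hs hsρ hη hη₀ hM' => ?_⟩
  obtain ⟨e, g, hG, hg⟩ := hgraph x₁ hx₁.1
  refine excessBound_of_isC1Closure hF.continuous hΩ hG has (by linarith) (fun φ hφ => ?_)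
    hη hη₀ hM'
  refine (hG.excessBound hΩ hx₁.1 (by linarith) hc₂ hF.continuous hγ1.le hg hs hsρ
    (fun φ hφ => ?_) hC'0.le hC' hγC' (hK _ (hM x₁ hx₁)) hφ).mono (by linarith)
  exact hqc.excessBound_halfBallOfRadius hc₂ (hF.of_le one_le_two) hx₁ ⟨ρ, e, g, hG, rfl⟩
    (by positivity) hφ

lemma exists_excessBound_truncGrad (hp : 1 ≤ p) (hc₂ : 0 ≤ c₂) (hF : ContDiff ℝ 2 F) {C : ℝ}
    (hgrowth : HasGradGrowth p C F) (hqc : IsStronglyQuasiconvex p c₂ F)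
    (hqc' : IsStronglyQuasiconvexAtFreeBoundary p c₂ F Ω ΓD Du) (hΩ : IsOpen Ω)
    (hb : Bornology.IsBounded Ω) (hΩC1 : HasC1Boundary Ω) (hΓD : ΓD ⊆ frontier Ω)
    (hM : ∀ x ∈ closure Ω, ‖Du x‖ ≤ M) (hε : 0 < ε) :
    ∃ ρ : ℝ, 0 < ρ ∧ ∀ R, 0 < R → R ≤ ρ → ∀ x₀ ∈ closure Ω, ∀ U, IsOpen U → U ⊆ Ω ∩ ball x₀ R →
      ∀ (ψ : Vec n → Vec N) (Dψ : Vec n → Mat N n), IsC1Closure U ψ Dψ →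
      (∀ x ∈ (ΓD ∩ closure U) ∪ (frontier U ∩ Ω), ψ x = 0) → ∀ δ : ℝ, δ ≠ 0 →
      ∃ z ∈ closure Ω, U ⊆ closedBall z (2 * R) ∧
        ExcessBound p (c₂ - ε) F (Du z) U (truncGrad δ U ψ Dψ) := by
  obtain ⟨ρ, hρ, hfree⟩ := hqc'.exists_excessBound hp hc₂ hF hgrowth hΩ hb hΩC1
    (fun x hx => hM x (frontier_subset_closure hx.1)) hε
  refine ⟨ρ / 6, by positivity, fun R hR hRρ x₀ hx₀ U hU hUR ψ Dψ h hψ₀ δ hδ => ?_⟩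
  have hUΩ : U ⊆ Ω := hUR.trans inter_subset_left
  have hcl : closure U ⊆ closedBall x₀ R :=
    closure_minimal (fun x hx => ball_subset_closedBall (hUR hx).2) isClosed_closedBall
  by_cases hUΓD : closure U ∩ frontier Ω ⊆ closure ΓD
  · refine ⟨x₀, hx₀, subset_closure.trans (hcl.trans (closedBall_subset_closedBall (by linarith))),
      (hqc.excessBound_truncGrad hc₂ (hF.of_le one_le_two) (Du x₀) hδ hU (s := 2 * R)
        (by positivity) (hcl.trans (closedBall_subset_ball (by linarith))) h fun x hx => ?_).mono
      (by linarith)⟩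
    exact eq_zero_of_mem_frontier hΩ hΩC1 hΓD hU hUΩ h.continuousOn hψ₀ hUΓD hx
  · obtain ⟨x₁, hx₁, hx₁ΓD⟩ := not_subset.1 hUΓD
    have hcl₁ : closure U ⊆ closedBall x₁ (2 * R) := fun x hx => mem_closedBall.2 <| by
      linarith [mem_closedBall.1 (hcl hx), mem_closedBall.1 (hcl hx₁.1),
        dist_triangle_right x x₁ x₀]
    refine ⟨x₁, frontier_subset_closure hx₁.2, subset_closure.trans hcl₁, ?_⟩
    have hψ₀' : ∀ x ∈ frontier U ∩ Ω, ψ x = 0 := fun x hx => hψ₀ x (.inr hx)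
    obtain ⟨M', hM'⟩ := exists_norm_truncGrad_le (ψ := ψ) (hb.subset hUΩ) h.continuousOn_grad
    rw [excessBound_iff_of_subset (T := Ω ∩ ball x₁ (3 * R)) (fun x hx => ⟨hUΩ hx,
        closedBall_subset_ball (by linarith) (hcl₁ (subset_closure hx))⟩)
      (hΩ.inter isOpen_ball).measurableSet
      fun x hx => truncGrad_eq_zero hU h.continuousOn hψ₀' hx.1.1 hx.2]
    exact hfree x₁ ⟨hx₁.2, hx₁ΓD⟩ (2 * R) (3 * R) M' _ _ (by linarith) (by positivity)
      (by linarith) (isC1Closure_trunc hΩ hΩC1 hδ hU hUΩ h hψ₀')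
      (fun x hx => trunc_of_notMem fun hxU => hx (hcl₁ hxU)) fun x _ => hM' δ x

lemma IsExtremal.setIntegral_truncGrad_eq_zero {u : Vec n → Vec N} {ψ : Vec n → Vec N}
    {Dψ : Vec n → Mat N n} {δ : ℝ} (hext : IsExtremal p F Ω ΓD u Du) (hΩ : IsOpen Ω)
    (hb : Bornology.IsBounded Ω) (hΩC1 : HasC1Boundary Ω) (hU : IsOpen U) (hUΩ : U ⊆ Ω)
    (h : IsC1Closure U ψ Dψ) (hψ₀ : ∀ x ∈ (ΓD ∩ closure U) ∪ (frontier U ∩ Ω), ψ x = 0)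
    (hδ : δ ≠ 0) : ∫ x in U, fderiv ℝ F (Du x) (truncGrad δ U ψ Dψ x) = 0 := by
  have hψ₀' : ∀ x ∈ frontier U ∩ Ω, ψ x = 0 := fun x hx => hψ₀ x (.inr hx)
  rw [← setIntegral_eq_of_subset_of_forall_sdiff_eq_zero hΩ.measurableSet hUΩ fun x hx => by
    rw [truncGrad_eq_zero hU h.continuousOn hψ₀' hx.1 hx.2, map_zero]]
  exact hext.setIntegral_fderiv_eq_zero ((isC1Closure_trunc hΩ hΩC1 hδ hU hUΩ h hψ₀').isVariation
    hΩ hb (fun x hx => trunc_eq_zero fun hxU => hψ₀ x (.inl ⟨hx, hxU⟩)) p)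

lemma exists_radius_truncGrad {c : ℝ} (hp : 1 ≤ p) (hc₂ : 0 ≤ c₂) (hc : c < c₂)
    (hF : ContDiff ℝ 2 F) {C : ℝ} (hgrowth : HasGradGrowth p C F)
    (hqc : IsStronglyQuasiconvex p c₂ F)
    (hqc' : IsStronglyQuasiconvexAtFreeBoundary p c₂ F Ω ΓD Du) (hΩ : IsOpen Ω)
    (hb : Bornology.IsBounded Ω) (hΩC1 : HasC1Boundary Ω) (hΓD : ΓD ⊆ frontier Ω)
    (hDu : ContinuousOn Du (closure Ω)) {u : Vec n → Vec N} (hext : IsExtremal p F Ω ΓD u Du) :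
    ∃ R : ℝ, 0 < R ∧ ∀ x₀ ∈ closure Ω, ∀ U, IsOpen U → U ⊆ Ω ∩ ball x₀ R →
      ∀ (ψ : Vec n → Vec N) (Dψ : Vec n → Mat N n), IsC1Closure U ψ Dψ →
      (∀ x ∈ (ΓD ∩ closure U) ∪ (frontier U ∩ Ω), ψ x = 0) → ∀ δ : ℝ, δ ≠ 0 →
        c * ∫ x in U, ‖V p (truncGrad δ U ψ Dψ x)‖ ^ 2 ≤
          ∫ x in U, (F (Du x + truncGrad δ U ψ Dψ x) - F (Du x)) := by
  obtain ⟨M, hM⟩ := hb.isCompact_closure.exists_bound_of_continuousOn hDu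
  have hε : 0 < (c₂ - c) / 2 := by linarith
  obtain ⟨τ, hτ, hbase⟩ := exists_abs_excess_sub_excess_base_le hp hF hgrowth M hε
  obtain ⟨κ, hκ, huc⟩ := Metric.uniformContinuousOn_iff.1
    (hb.isCompact_closure.uniformContinuousOn_of_continuous hDu) τ hτ
  obtain ⟨ρ, hρ, hbound⟩ :=
    exists_excessBound_truncGrad hp hc₂ hF hgrowth hqc hqc' hΩ hb hΩC1 hΓD hM hε
  refine ⟨min ρ (κ / 3), by positivity, fun x₀ hx₀ U hU hUR ψ Dψ h hψ₀ δ hδ => ?_⟩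
  have hUΩ : U ⊆ Ω := hUR.trans inter_subset_left
  have hUcl : U ⊆ closure Ω := hUΩ.trans subset_closure
  obtain ⟨z, hz, hUz, hzbound⟩ :=
    hbound _ (by positivity) (min_le_left _ _) x₀ hx₀ U hU hUR ψ Dψ h hψ₀ δ hδ
  have : IsFiniteMeasure (volume.restrict U) :=
    isFiniteMeasure_restrict.2 (hb.subset hUΩ).measure_lt_top.ne
  have hDm := aestronglyMeasurable_truncGrad hU.measurableSet h δ
  have hDum := (hDu.mono hUcl).aestronglyMeasurable (μ := volume) hU.measurableSet
  obtain ⟨M', hM'⟩ := exists_norm_truncGrad_le (ψ := ψ) (hb.subset hUΩ) h.continuousOn_grad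
  have hF1 := hF.of_le one_le_two
  rw [← integral_excess_eq hF1 hU.measurableSet hDm hDum (fun x _ => hM' δ x)
    (fun x hx => hM x (hUcl hx))
    (hext.setIntegral_truncGrad_eq_zero hΩ hb hΩC1 hU hUΩ h hψ₀ hδ)]
  refine (hzbound.mono (c' := c + (c₂ - c) / 2) (by linarith)).le_integral_excess hF1
    hU.measurableSet hDm hDum (fun x _ => hM' δ x) (fun x hx => hM x (hUcl hx)) fun x hx => ?_
  refine hbase _ _ (hM x (hUcl hx)) (hM z hz) ?_ _
  rw [← dist_eq_norm]
  exact (huc x (hUcl hx) z hz (by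
    linarith [mem_closedBall.1 (hUz hx), min_le_right ρ (κ / 3)])).le

end SmallRadius

section DensityPassage

variable {N n : ℕ} {p c C M : ℝ} {F : Mat N n → ℝ} {Ω ΓD U : Set (Vec n)}
  {Du : Vec n → Mat N n}

lemma le_integral_of_forall_truncGrad (hF : Continuous F) (hU : IsOpen U)
    (hUb : Bornology.IsBounded U) (hDum : AEStronglyMeasurable Du (volume.restrict U))
    (hDu : ∀ x ∈ U, ‖Du x‖ ≤ M) {ψ : Vec n → Vec N} {Dψ : Vec n → Mat N n}
    (h : IsC1Closure U ψ Dψ)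
    (htrunc : ∀ δ : ℝ, δ ≠ 0 → c * ∫ x in U, ‖V p (truncGrad δ U ψ Dψ x)‖ ^ 2 ≤
      ∫ x in U, (F (Du x + truncGrad δ U ψ Dψ x) - F (Du x))) :
    c * ∫ x in U, ‖V p (Dψ x)‖ ^ 2 ≤ ∫ x in U, (F (Du x + Dψ x) - F (Du x)) := by
  have : IsFiniteMeasure (volume.restrict U) := isFiniteMeasure_restrict.2 hUb.measure_lt_top.ne
  obtain ⟨M', hM'⟩ := exists_norm_truncGrad_le (ψ := ψ) hUb h.continuousOn_grad
  have hm := aestronglyMeasurable_truncGrad hU.measurableSet h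
  have hlim := ae_tendsto_truncGrad hU h
  have hpairM (δ : ℝ) : ∀ᵐ x ∂volume.restrict U, ‖(Du x, truncGrad δ U ψ Dψ x)‖ ≤ max M M' :=
    (ae_restrict_mem hU.measurableSet).mono fun x hx => max_le_max (hDu x hx) (hM' δ x)
  refine le_of_tendsto_of_tendsto
    ((tendsto_integral_continuous_comp (.of_forall hm) (.of_forall fun δ => .of_forall (hM' δ)) hlim
      (continuous_norm_V_sq p N n)).const_mul c)
    (tendsto_integral_continuous_comp (H := fun q : Mat N n × Mat N n => F (q.1 + q.2) - F q.1)
      (.of_forall fun δ => hDum.prodMk (hm δ)) (.of_forall hpairM)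
      (hlim.mono fun x hx => tendsto_const_nhds.prodMk_nhds hx) (by fun_prop)) ?_
  filter_upwards [self_mem_nhdsWithin] with δ hδ using htrunc δ (mem_Ioi.1 hδ).ne'

lemma IsVariation.exists_seq_tendsto {φ : Vec n → Vec N} {Dφ : Vec n → Mat N n}
    (hφ : IsVariation Ω ΓD p U φ Dφ) :
    ∃ (ψ : ℕ → Vec n → Vec N) (Dψ : ℕ → Vec n → Mat N n),
      (∀ k, IsC1Closure U (ψ k) (Dψ k) ∧
        ∀ x ∈ (ΓD ∩ closure U) ∪ (frontier U ∩ Ω), ψ k x = 0) ∧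
      Tendsto (fun k => eLpNorm (Dψ k - Dφ) (ENNReal.ofReal p) (volume.restrict U))
        atTop (𝓝 0) := by
  choose ψ Dψ hψ hψ₀ hdist using fun k : ℕ => hφ.approx ((k : ENNReal) + 1)⁻¹ (by simp)
  refine ⟨ψ, Dψ, fun k => ⟨hψ k, hψ₀ k⟩, tendsto_of_tendsto_of_tendsto_of_le_of_le
    tendsto_const_nhds
    (by simpa using (tendsto_add_atTop_iff_nat 1).2 ENNReal.tendsto_inv_nat_nhds_zero)
    (fun _ => zero_le) fun k => ?_⟩
  rw [eLpNorm_sub_comm]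
  exact (le_add_self.trans_lt (hdist k)).le

lemma IsVariation.le_integral (hp : 1 < p) (hF : Differentiable ℝ F)
    (hgrowth : HasGradGrowth p C F) (hU : IsOpen U) (hUb : Bornology.IsBounded U)
    (hDum : AEStronglyMeasurable Du (volume.restrict U)) (hDu : ∀ x ∈ U, ‖Du x‖ ≤ M)
    (hC1 : ∀ (ψ : Vec n → Vec N) (Dψ : Vec n → Mat N n), IsC1Closure U ψ Dψ →
      (∀ x ∈ (ΓD ∩ closure U) ∪ (frontier U ∩ Ω), ψ x = 0) →
      c * ∫ x in U, ‖V p (Dψ x)‖ ^ 2 ≤ ∫ x in U, (F (Du x + Dψ x) - F (Du x)))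
    {φ : Vec n → Vec N} {Dφ : Vec n → Mat N n} (hφ : IsVariation Ω ΓD p U φ Dφ) :
    c * ∫ x in U, ‖V p (Dφ x)‖ ^ 2 ≤ ∫ x in U, (F (Du x + Dφ x) - F (Du x)) := by
  have : IsFiniteMeasure (volume.restrict U) := isFiniteMeasure_restrict.2 hUb.measure_lt_top.ne
  obtain ⟨ψ, Dψ, hψ, hlim⟩ := hφ.exists_seq_tendsto
  have hDφ := hφ.isSobolev.memLp_grad
  have hDψ (k : ℕ) := ((hψ k).1.isSobolev hU hUb (ENNReal.ofReal p)).memLp_grad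
  have hFc := hF.continuous
  refine le_of_tendsto_of_tendsto'
    ((tendsto_integral_of_tendsto_eLpNorm_sub (H := fun _ ξ => ‖V p ξ‖ ^ 2) hp
      (.of_forall fun _ => abs_norm_V_sq_sub_le hp.le) (integrable_const _)
      (fun D hD => (continuous_norm_V_sq p N n).comp_aestronglyMeasurable hD)
      hDφ hDψ hlim).const_mul c)
    (tendsto_integral_of_tendsto_eLpNorm_sub (H := fun x ξ => F (Du x + ξ) - F (Du x)) hp
      ((ae_restrict_mem hU.measurableSet).mono fun x hx =>
        hgrowth.abs_sub_translate_le hp.le hF (hDu x hx)) (by simp) (fun D hD => ?_) hDφ hDψ hlim)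
    fun k => hC1 _ _ (hψ k).1 (hψ k).2
  exact (by fun_prop : Continuous fun q : Mat N n × Mat N n =>
    F (q.1 + q.2) - F q.1).comp_aestronglyMeasurable (hDum.prodMk hD)

end DensityPassage

end Zhang

end

open Zhang MeasureTheory Metric Set in
theorem theorem3p6_general {N n : ℕ} {p c c₂ : ℝ} (hp : 1 < p) (hc₂ : 0 ≤ c₂) (hc : c < c₂)
    {Ω ΓD : Set (Vec n)} (hΩ : IsOpen Ω) (hb : Bornology.IsBounded Ω)
    (hΩC1 : HasC1Boundary Ω) (hΓD : ΓD ⊆ frontier Ω) {F : Mat N n → ℝ}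
    {u : Vec n → Vec N} {Du : Vec n → Mat N n} (H0 : ContDiff ℝ 2 F)
    (H1 : HasPGrowth p F) (H2 : IsStronglyQuasiconvex p c₂ F) (hu : IsC1Closure Ω u Du)
    (H2' : IsStronglyQuasiconvexAtFreeBoundary p c₂ F Ω ΓD Du)
    (hext : IsExtremal p F Ω ΓD u Du) :
    ∃ R : ℝ, 0 < R ∧ ∀ x₀ ∈ closure Ω, ∀ U, IsOpen U → U ⊆ Ω ∩ ball x₀ R →
      ∀ (φ : Vec n → Vec N) (Dφ : Vec n → Mat N n), IsVariation Ω ΓD p U φ Dφ →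
        c * ∫ x in U, ‖V p (Dφ x)‖ ^ 2 ≤ ∫ x in U, (F (Du x + Dφ x) - F (Du x)) := by
  obtain ⟨C, hgrowth⟩ :=
    (H2.isQuasiconvex hc₂).exists_hasGradGrowth (zero_lt_one.trans hp).le H0 H1
  obtain ⟨M, hM⟩ := hb.isCompact_closure.exists_bound_of_continuousOn hu.continuousOn_grad
  obtain ⟨R, hR, htrunc⟩ := exists_radius_truncGrad hp.le hc₂ hc H0 hgrowth H2 H2' hΩ hb hΩC1 hΓD
    hu.continuousOn_grad hext
  refine ⟨R, hR, fun x₀ hx₀ U hU hUR φ Dφ hφ => ?_⟩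
  have hUΩ : U ⊆ Ω := hUR.trans inter_subset_left
  have hUb := hb.subset hUΩ
  have hDum : AEStronglyMeasurable Du (volume.restrict U) :=
    (hu.continuousOn_grad.mono (hUΩ.trans subset_closure)).aestronglyMeasurable hU.measurableSet
  have hDu : ∀ x ∈ U, ‖Du x‖ ≤ M := fun x hx => hM x (subset_closure (hUΩ hx))
  exact hφ.le_integral hp (H0.differentiable two_ne_zero) hgrowth hU hUb hDum hDu
    fun ψ Dψ hψ hψ₀ => le_integral_of_forall_truncGrad H0.continuous hU hUb hDum hDu hψ
      (htrunc x₀ hx₀ U hU hUR ψ Dψ hψ hψ₀)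

theorem theorem3p6 {N n : ℕ} (p c₂ : ℝ) (hp : 1 < p) (hc₂ : 0 < c₂)
    (Ω ΓD : Set (Zhang.Vec n)) (hΩ : Zhang.IsBoundedC1Domain Ω) (hΓD : ΓD ⊆ frontier Ω)
    (F : Zhang.Mat N n → ℝ) (u : Zhang.Vec n → Zhang.Vec N) (Du : Zhang.Vec n → Zhang.Mat N n)
    (H0 : ContDiff ℝ 2 F) (H1 : Zhang.HasPGrowth p F)
    (H2 : Zhang.IsStronglyQuasiconvex p c₂ F)
    (hu : Zhang.IsC1Closure Ω u Du)
    (H2' : Zhang.IsStronglyQuasiconvexAtFreeBoundary p c₂ F Ω ΓD Du)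
    (hext : Zhang.IsExtremal p F Ω ΓD u Du) :
    ∃ R : ℝ, 0 < R ∧ ∀ x₀ ∈ closure Ω,
      ∀ (φ : Zhang.Vec n → Zhang.Vec N) (Dφ : Zhang.Vec n → Zhang.Mat N n),
        Zhang.IsVariation Ω ΓD p (Ω ∩ Metric.ball x₀ R) φ Dφ →
          c₂ / 2 * ∫ x in Ω ∩ Metric.ball x₀ R, ‖Zhang.V p (Dφ x)‖ ^ 2 ≤
            ∫ x in Ω ∩ Metric.ball x₀ R, (F (Du x + Dφ x) - F (Du x)) := by
  obtain ⟨R, hR, h⟩ := theorem3p6_general hp hc₂.le (half_lt_self hc₂) hΩ.isOpen hΩ.isBounded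
    hΩ.isC1 hΓD H0 H1 H2 hu H2' hext
  exact ⟨R, hR, fun x₀ hx₀ => h x₀ hx₀ _ (hΩ.isOpen.inter Metric.isOpen_ball) subset_rfl⟩
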